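/- Let $V$ be a finite dimensional real vector space and $Y$ a smooth manifold. A presheaf on manifolds is a contravariant functor from the category of smooth (finite dimensional) manifolds and smooth maps to sets. Consider the presheaf $Y\times(\Omega^1\otimes V)$, which sends a manifold $M$ to the set of pairs $(\varphi,\alpha)$ of a smooth map $\varphi\colon M\to Y$ and a $V$-valued $1$-form $\alpha\in\Omega^1(M;V)=\Omega^1(M)\otimes V$. A differential $q$-form on a presheaf $\mathcal F$ is a natural transformation $\mathcal F\to\Omega^q$ of functors to sets; these forms, with the wedge product and the exterior derivative taken on each test manifold, make up the de Rham complex $\Omega^\bullet(\mathcal F)=\bigoplus_q\Omega^q(\mathcal F)$. Let $K^\bullet V^*=\bigwedge^\bullet V^*\otimes\mathrm{Sym}^\bullet V^*$ be the Koszul algebra, where $\ell\in V^*=\bigwedge^1V^*$ has degree $1$ and the corresponding element $\tilde\ell\in V^*=\mathrm{Sym}^1V^*$ has degree $2$, and let $d_K$ be the graded derivation of degree $1$ with $d_K\ell=\tilde\ell$ and $d_K\tilde\ell=0$. Let $\Omega(Y;K^\bullet V^*)^\bullet$ be the algebra of differential forms on $Y$ with values in $K^\bullet V^*$, graded by total degree,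 $\Omega(Y;K^\bullet V^*)^n=\bigoplus_{r+m=n}\Omega^r(Y)\otimes K^mV^*$, with product $(\beta\otimes\kappa)(\beta'\otimes\kappa')=(-1)^{|\kappa||\beta'|}\,\beta\wedge\beta'\otimes\kappa\kappa'$ and differential $d_Y+d_K$, where $d_Y(\beta\otimes\kappa)=d\beta\otimes\kappa$ and $d_K(\beta\otimes\kappa)=(-1)^{|\beta|}\beta\otimes d_K\kappa$. Then there is an isomorphism of differential graded algebras $$\eta_Y\colon \bigl(\Omega(Y;K^\bullet V^*)^\bullet,\ d_Y+d_K\bigr)\longrightarrow\bigl(\Omega^\bullet(Y\times(\Omega^1\otimes V)),\ d\bigr),$$ that is, a linear bijection which preserves degrees, units and products and commutes with the differentials, given on generators as follows: $\beta\in\Omega^r(Y)$ goes to the form $(\varphi,\alpha)\mapsto\varphi^*\beta$; $\ell\in\bigwedge^1V^*$ goes to the $1$-form $\eta(\ell)\colon(\varphi,\sum_i\alpha_i\otimes v_i)\mapsto\sum_i\langle v_i,\ell\rangle\,\alpha_i$; and $\tilde\ell\in\mathrm{Sym}^1V^*$ goes to the $2$-form $d\eta(\ell)$. -/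

import Mathlib

open scoped Manifold ContDiff TensorProduct DirectSum

universe u v w

noncomputable section

namespace NatForm

section LinearAlgebra

variable {T T' : Type*} [AddCommGroup T] [Module ℝ T] [TopologicalSpace T]
  [AddCommGroup T'] [Module ℝ T'] [TopologicalSpace T']

/-- The `p + q`-linear map `v ↦ a (v₁, …, v_p) * b (v_{p+1}, …, v_{p+q})`. -/
def tensorAlt {p q : ℕ} (a : T [⋀^Fin p]→L[ℝ] ℝ) (b : T [⋀^Fin q]→L[ℝ] ℝ) :
    ContinuousMultilinearMap ℝ (fun _ : Fin (p + q) => T) ℝ where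
  toMultilinearMap :=
    LinearMap.mul' ℝ ℝ |>.compMultilinearMap
      ((a.toMultilinearMap.domCoprod b.toMultilinearMap).domDomCongr finSumFinEquiv)
  cont := by
    have : (fun v : Fin (p + q) → T =>
      a (fun i => v (Fin.castAdd q i)) * b (fun i => v (Fin.natAdd p i))) =
      (LinearMap.mul' ℝ ℝ |>.compMultilinearMap
      ((a.toMultilinearMap.domCoprod b.toMultilinearMap).domDomCongr finSumFinEquiv)) := by
      ext v
      simp
    refine Continuous.congr (f := fun v : Fin (p + q) → T =>
      a (fun i => v (Fin.castAdd q i)) * b (fun i => v (Fin.natAdd p i))) ?_ (fun v => congrFun this v)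
    exact (a.cont.comp (by fun_prop)).mul (b.cont.comp (by fun_prop))

theorem tensorAlt_apply {p q : ℕ} (a : T [⋀^Fin p]→L[ℝ] ℝ) (b : T [⋀^Fin q]→L[ℝ] ℝ)
    (v : Fin (p + q) → T) :
    tensorAlt a b v = a (fun i => v (Fin.castAdd q i)) * b (fun i => v (Fin.natAdd p i)) := by
  change (LinearMap.mul' ℝ ℝ |>.compMultilinearMap
      ((a.toMultilinearMap.domCoprod b.toMultilinearMap).domDomCongr finSumFinEquiv)) v = _
  simp

/-- The wedge product of alternating forms,
`(a ∧ b)(v₁, …, v_{p+q}) = (p! q!)⁻¹ ∑_σ sgn σ a(v_{σ 1}, …, v_{σ p}) b(v_{σ(p+1)}, …, v_{σ(p+q)})`,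
the normalization that goes with Mathlib's exterior derivative `extDeriv`. -/
def wedgeAlt (p q : ℕ) :
    (T [⋀^Fin p]→L[ℝ] ℝ) →ₗ[ℝ] (T [⋀^Fin q]→L[ℝ] ℝ) →ₗ[ℝ] T [⋀^Fin (p + q)]→L[ℝ] ℝ :=
  LinearMap.mk₂ ℝ
    (fun a b => ((p.factorial : ℝ) * q.factorial)⁻¹ • (tensorAlt a b).alternatization)
    (fun a a' b => by
      ext v
      simp [ContinuousMultilinearMap.alternatization_apply_apply, tensorAlt_apply, add_mul,
        Finset.sum_add_distrib, mul_add])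
    (fun c a b => by
      ext v
      simp [ContinuousMultilinearMap.alternatization_apply_apply, tensorAlt_apply,
        Finset.mul_sum]
      refine Finset.sum_congr rfl fun σ _ => ?_
      simp only [Units.smul_def, zsmul_eq_mul]; ring)
    (fun a b b' => by
      ext v
      simp [ContinuousMultilinearMap.alternatization_apply_apply, tensorAlt_apply, mul_add,
        Finset.sum_add_distrib])
    (fun c a b => by
      ext v
      simp [ContinuousMultilinearMap.alternatization_apply_apply, tensorAlt_apply,
        Finset.mul_sum]
      refine Finset.sum_congr rfl fun σ _ => ?_
      simp only [Units.smul_def, zsmul_eq_mul]; ring)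

theorem wedgeAlt_apply {p q : ℕ} (a : T [⋀^Fin p]→L[ℝ] ℝ) (b : T [⋀^Fin q]→L[ℝ] ℝ)
    (v : Fin (p + q) → T) :
    wedgeAlt p q a b v = ((p.factorial : ℝ) * q.factorial)⁻¹ *
      ∑ σ : Equiv.Perm (Fin (p + q)), (Equiv.Perm.sign σ : ℝ) *
        (a (fun i => v (σ (Fin.castAdd q i))) * b (fun i => v (σ (Fin.natAdd p i)))) := by
  simp [wedgeAlt, ContinuousMultilinearMap.alternatization_apply_apply, tensorAlt_apply,
    Units.smul_def]

theorem wedgeAlt_comp {p q : ℕ} (a : T [⋀^Fin p]→L[ℝ] ℝ) (b : T [⋀^Fin q]→L[ℝ] ℝ)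
    (L : T' →L[ℝ] T) :
    (wedgeAlt p q a b).compContinuousLinearMap L =
      wedgeAlt p q (a.compContinuousLinearMap L) (b.compContinuousLinearMap L) := by
  ext v
  simp only [ContinuousAlternatingMap.compContinuousLinearMap_apply, wedgeAlt_apply]
  rfl

end LinearAlgebra

section FiniteDim

/-- Restates a derivative with the normed structures of `E` and `F` (used to pass from tangent
spaces to their model spaces). -/
theorem hasFDerivAt_coe {E F : Type*} [NormedAddCommGroup E] [NormedSpace ℝ E]
    [NormedAddCommGroup F] [NormedSpace ℝ F] {f : E → F} {L : E →L[ℝ] F} {x : E}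
    (h : HasFDerivAt f L x) : HasFDerivAt f L x := h

variable {E F : Type*} [NormedAddCommGroup E] [NormedSpace ℝ E] [FiniteDimensional ℝ E]
  [NormedAddCommGroup F] [NormedSpace ℝ F]

theorem finiteDimensional_cmm (p : ℕ) :
    FiniteDimensional ℝ (ContinuousMultilinearMap ℝ (fun _ : Fin p => E) ℝ) :=
  FiniteDimensional.of_injective
    ({ toFun := fun f => f.toMultilinearMap, map_add' := fun _ _ => rfl,
       map_smul' := fun _ _ => rfl } :
      ContinuousMultilinearMap ℝ (fun _ : Fin p => E) ℝ →ₗ[ℝ] MultilinearMap ℝ (fun _ : Fin p => E) ℝ) ContinuousMultilinearMap.toMultilinearMap_injective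

theorem finiteDimensional_alt (p : ℕ) : FiniteDimensional ℝ (E [⋀^Fin p]→L[ℝ] ℝ) := by
  have := finiteDimensional_cmm (E := E) p
  exact FiniteDimensional.of_injective
    (ContinuousAlternatingMap.toContinuousMultilinearMapCLM (𝕜 := ℝ) (E := E) (F := ℝ)
      (ι := Fin p) ℝ).toLinearMap ContinuousAlternatingMap.toContinuousMultilinearMap_injective

theorem contDiff_comp (p : ℕ) :
    ContDiff ℝ ∞ (fun x : (F [⋀^Fin p]→L[ℝ] ℝ) × (E →L[ℝ] F) =>
      x.1.compContinuousLinearMap x.2) := by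
  have := finiteDimensional_cmm (E := E) p
  let J := ContinuousAlternatingMap.toContinuousMultilinearMapCLM (𝕜 := ℝ) (E := E) (F := ℝ)
      (ι := Fin p) ℝ
  obtain ⟨R, hR⟩ := J.toLinearMap.exists_leftInverse_of_injective
    (LinearMap.ker_eq_bot.2 ContinuousAlternatingMap.toContinuousMultilinearMap_injective)
  let J' := ContinuousAlternatingMap.toContinuousMultilinearMapCLM (𝕜 := ℝ) (E := F) (F := ℝ)
      (ι := Fin p) ℝ
  have key : ContDiff ℝ ∞ (fun x : (F [⋀^Fin p]→L[ℝ] ℝ) × (E →L[ℝ] F) =>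
      ContinuousMultilinearMap.compContinuousLinearMapContinuousMultilinear ℝ
        (fun _ : Fin p => E) (fun _ : Fin p => F) ℝ (fun _ => x.2) (J' x.1)) := by
    refine ContDiff.clm_apply ?_ (J'.contDiff.comp contDiff_fst)
    exact (ContinuousMultilinearMap.contDiff _).comp (contDiff_pi.2 fun _ => contDiff_snd)
  have := R.toContinuousLinearMap.contDiff.comp key
  convert this using 1
  ext1 x
  exact (LinearMap.congr_fun hR (x.1.compContinuousLinearMap x.2)).symm


end FiniteDim

/-- A smooth manifold: Hausdorff, second countable, without boundary, modelled on a
finite-dimensional real vector space. -/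
structure Man : Type (u + 1) where
  carrier : Type u
  model : Type u
  [normedAddCommGroup : NormedAddCommGroup model]
  [normedSpace : NormedSpace ℝ model]
  [finiteDimensional : FiniteDimensional ℝ model]
  [topologicalSpace : TopologicalSpace carrier]
  [chartedSpace : ChartedSpace model carrier]
  [isManifold : IsManifold 𝓘(ℝ, model) ∞ carrier]
  [t2Space : T2Space carrier]
  [secondCountable : SecondCountableTopology carrier]

attribute [instance] Man.normedAddCommGroup Man.normedSpace Man.finiteDimensional
  Man.topologicalSpace Man.chartedSpace Man.isManifold Man.t2Space Man.secondCountable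

/-- Smooth maps. -/
abbrev SmoothMap (M : Man.{u}) (N : Man.{v}) : Type (max u v) :=
  C^∞⟮𝓘(ℝ, M.model), M.carrier; 𝓘(ℝ, N.model), N.carrier⟯

/-- The tangent space of `M` at `x`. -/
abbrev Tan (M : Man.{u}) (x : M.carrier) : Type u := TangentSpace 𝓘(ℝ, M.model) x

/-- A field of alternating `r`-forms on the tangent spaces of `M`, with no smoothness. -/
abbrev FormField (M : Man.{u}) (r : ℕ) : Type u :=
  ∀ x : M.carrier, Tan M x [⋀^Fin r]→L[ℝ] ℝ

section Forms

variable {M : Man.{u}} {N : Man.{v}} {r : ℕ}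

/-- The coordinate expression of a form field in the preferred chart at `x₀`: its pullback along
the inverse of the chart. It is meaningful on the target of the chart. -/
def inChart (a : FormField M r) (x₀ : M.carrier) (y : M.model) : M.model [⋀^Fin r]→L[ℝ] ℝ :=
  (a ((chartAt M.model x₀).symm y)).compContinuousLinearMap
    (mfderiv 𝓘(ℝ, M.model) 𝓘(ℝ, M.model) (chartAt M.model x₀).symm y)

/-- Smoothness: all coordinate expressions are smooth. -/
def IsSmooth (a : FormField M r) : Prop :=
  ∀ x₀ : M.carrier, ContDiffOn ℝ ∞ (inChart a x₀) (chartAt M.model x₀).target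

/-- Pullback of a form field, `(f^* a)_x = a_{f x} ∘ df_x`. -/
def pullbackField (f : SmoothMap M N) (a : FormField N r) : FormField M r := fun x =>
  (a (f x)).compContinuousLinearMap (mfderiv 𝓘(ℝ, M.model) 𝓘(ℝ, N.model) f x)

theorem mdiff_chart (x₀ : M.carrier) {x : M.carrier} (hx : x ∈ (chartAt M.model x₀).source) :
    MDifferentiableAt 𝓘(ℝ, M.model) 𝓘(ℝ, M.model) (chartAt M.model x₀) x :=
  ((contMDiffOn_chart (n := ∞) (x := x₀)).contMDiffAt
    ((chartAt M.model x₀).open_source.mem_nhds hx)).mdifferentiableAt (by simp)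

theorem mdiff_chart_symm (x₀ : M.carrier) {y : M.model} (hy : y ∈ (chartAt M.model x₀).target) :
    MDifferentiableAt 𝓘(ℝ, M.model) 𝓘(ℝ, M.model) (chartAt M.model x₀).symm y :=
  ((contMDiffOn_chart_symm (n := ∞) (x := x₀)).contMDiffAt
    ((chartAt M.model x₀).open_target.mem_nhds hy)).mdifferentiableAt (by simp)


theorem mfderiv_symm_comp (x₀ : M.carrier) {x : M.carrier}
    (hx : x ∈ (chartAt M.model x₀).source) (v : M.model) :
    (mfderiv 𝓘(ℝ, M.model) 𝓘(ℝ, M.model) (chartAt M.model x₀).symm (chartAt M.model x₀ x)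
      (mfderiv 𝓘(ℝ, M.model) 𝓘(ℝ, M.model) (chartAt M.model x₀) x v) : M.model) = v := by
  have h1 := (mdiff_chart x₀ hx).hasMFDerivAt
  have h2 := (mdiff_chart_symm x₀ ((chartAt M.model x₀).map_source hx)).hasMFDerivAt
  have h3 : HasMFDerivAt 𝓘(ℝ, M.model) 𝓘(ℝ, M.model) id x _ := (h2.comp x h1).congr_of_eventuallyEq
    (by filter_upwards [(chartAt M.model x₀).open_source.mem_nhds hx] with z hz
        simp [(chartAt M.model x₀).left_inv hz])
  exact congrArg (fun L : M.model →L[ℝ] M.model => L v) (hasMFDerivAt_unique h3 (hasMFDerivAt_id x))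

theorem mfderiv_comp_symm (x₀ : M.carrier) {y : M.model}
    (hy : y ∈ (chartAt M.model x₀).target) (v : M.model) :
    (mfderiv 𝓘(ℝ, M.model) 𝓘(ℝ, M.model) (chartAt M.model x₀) ((chartAt M.model x₀).symm y)
      (mfderiv 𝓘(ℝ, M.model) 𝓘(ℝ, M.model) (chartAt M.model x₀).symm y v) : M.model) = v := by
  have h1 := (mdiff_chart x₀ ((chartAt M.model x₀).map_target hy)).hasMFDerivAt
  have h2 := (mdiff_chart_symm x₀ hy).hasMFDerivAt
  have h3 : HasMFDerivAt 𝓘(ℝ, M.model) 𝓘(ℝ, M.model) id y _ := (h1.comp y h2).congr_of_eventuallyEq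
    (by filter_upwards [(chartAt M.model x₀).open_target.mem_nhds hy] with z hz
        simp [(chartAt M.model x₀).right_inv hz])
  exact congrArg (fun L : M.model →L[ℝ] M.model => L v) (hasMFDerivAt_unique h3 (hasMFDerivAt_id y))

theorem formField_congr (a : FormField M r) {x x' : M.carrier} (h : x = x')
    (v v' : Fin r → M.model) (hv : ∀ i, v i = v' i) : a x v = a x' v' := by
  subst h
  rw [funext hv]

/-- The coordinate expression of a smooth map. -/
def coordMap (f : SmoothMap M N) (x₀ : M.carrier) (p₀ : N.carrier) (y : M.model) : N.model :=
  chartAt N.model p₀ (f ((chartAt M.model x₀).symm y))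

/-- The open set on which `coordMap` is the coordinate expression of `f`. -/
def coordDom (f : SmoothMap M N) (x₀ : M.carrier) (p₀ : N.carrier) : Set M.model :=
  (chartAt M.model x₀).target ∩
    (fun y => f ((chartAt M.model x₀).symm y)) ⁻¹' (chartAt N.model p₀).source

theorem isOpen_coordDom (f : SmoothMap M N) (x₀ : M.carrier) (p₀ : N.carrier) :
    IsOpen (coordDom f x₀ p₀) :=
  (f.contMDiff.continuous.comp_continuousOn (chartAt M.model x₀).continuousOn_symm).isOpen_inter_preimage
    (chartAt M.model x₀).open_target (chartAt N.model p₀).open_source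

theorem contDiffOn_coordMap (f : SmoothMap M N) (x₀ : M.carrier) (p₀ : N.carrier) :
    ContDiffOn ℝ ∞ (coordMap f x₀ p₀) (coordDom f x₀ p₀) := by
  apply ContMDiffOn.contDiffOn
  refine ContMDiffOn.comp (t := (chartAt N.model p₀).source) contMDiffOn_chart ?_ (fun y hy => hy.2)
  exact f.contMDiff.comp_contMDiffOn (contMDiffOn_chart_symm.mono fun y hy => hy.1)

theorem inChart_pullback (f : SmoothMap M N) (a : FormField N r) (x₀ : M.carrier)
    (p₀ : N.carrier) {y : M.model} (hy : y ∈ coordDom f x₀ p₀) :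
    inChart (pullbackField f a) x₀ y =
      (inChart a p₀ (coordMap f x₀ p₀ y)).compContinuousLinearMap
        (fderiv ℝ (coordMap f x₀ p₀) y) := by
  obtain ⟨hy1, hy2⟩ := hy
  have hf := (f.contMDiff.mdifferentiable (by simp)) ((chartAt M.model x₀).symm y)
  have hs := mdiff_chart_symm x₀ hy1
  have hc := mdiff_chart p₀ hy2
  have e : ∀ v : M.model, fderiv ℝ (coordMap f x₀ p₀) y v =
      mfderiv 𝓘(ℝ, N.model) 𝓘(ℝ, N.model) (chartAt N.model p₀)
        (f ((chartAt M.model x₀).symm y))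
      (mfderiv 𝓘(ℝ, M.model) 𝓘(ℝ, N.model) f ((chartAt M.model x₀).symm y)
        (mfderiv 𝓘(ℝ, M.model) 𝓘(ℝ, M.model) (chartAt M.model x₀).symm y v)) := fun v => by
    have h := (hc.hasMFDerivAt.comp y (hf.hasMFDerivAt.comp y hs.hasMFDerivAt))
    exact congrArg (fun L : M.model →L[ℝ] N.model => L v)
      (hasFDerivAt_coe h.hasFDerivAt).fderiv
  have h' : (chartAt N.model p₀).symm (coordMap f x₀ p₀ y) = f ((chartAt M.model x₀).symm y) :=
    (chartAt N.model p₀).left_inv hy2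
  ext v
  refine (formField_congr a h' _ _ fun i => ?_).symm
  exact (congrArg _ (e (v i))).trans (mfderiv_symm_comp p₀ hy2 _)

theorem inChart_eventuallyEq (f : SmoothMap M N) (a : FormField N r) (x₀ : M.carrier)
    (p₀ : N.carrier) {y : M.model} (hy : y ∈ coordDom f x₀ p₀) :
    inChart (pullbackField f a) x₀ =ᶠ[nhds y] fun y =>
      (inChart a p₀ (coordMap f x₀ p₀ y)).compContinuousLinearMap
        (fderiv ℝ (coordMap f x₀ p₀) y) := by
  filter_upwards [(isOpen_coordDom f x₀ p₀).mem_nhds hy] with z hz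
  exact inChart_pullback f a x₀ p₀ hz

theorem IsSmooth.contDiffAt {a : FormField M r} (ha : IsSmooth a) (x₀ : M.carrier) {y : M.model}
    (hy : y ∈ (chartAt M.model x₀).target) : ContDiffAt ℝ ∞ (inChart a x₀) y :=
  (ha x₀).contDiffAt ((chartAt M.model x₀).open_target.mem_nhds hy)

theorem contDiffAt_coordMap (f : SmoothMap M N) (x₀ : M.carrier) (p₀ : N.carrier)
    {y : M.model} (hy : y ∈ coordDom f x₀ p₀) : ContDiffAt ℝ ∞ (coordMap f x₀ p₀) y :=
  (contDiffOn_coordMap f x₀ p₀).contDiffAt ((isOpen_coordDom f x₀ p₀).mem_nhds hy)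

theorem mem_coordDom_self (f : SmoothMap M N) (x₀ : M.carrier) {y : M.model}
    (hy : y ∈ (chartAt M.model x₀).target) :
    y ∈ coordDom f x₀ (f ((chartAt M.model x₀).symm y)) :=
  ⟨hy, mem_chart_source _ _⟩

theorem coordMap_mem_target (f : SmoothMap M N) (x₀ : M.carrier) (p₀ : N.carrier)
    {y : M.model} (hy : y ∈ coordDom f x₀ p₀) :
    coordMap f x₀ p₀ y ∈ (chartAt N.model p₀).target :=
  (chartAt N.model p₀).map_source hy.2

theorem IsSmooth.pullback (f : SmoothMap M N) {a : FormField N r} (ha : IsSmooth a) :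
    IsSmooth (pullbackField f a) := by
  intro x₀ y hy
  have hy' := mem_coordDom_self f x₀ hy
  refine ContDiffAt.contDiffWithinAt ?_
  refine ContDiffAt.congr_of_eventuallyEq ?_ (inChart_eventuallyEq f a x₀ _ hy')
  have hg := contDiffAt_coordMap f x₀ _ hy'
  exact ((contDiff_comp r).contDiffAt).comp y
    (((ha.contDiffAt _ (coordMap_mem_target f x₀ _ hy')).comp y hg).prodMk
      (hg.fderiv_right (m := ∞) (by simp)))

/-- A form field is determined by its coordinate expressions. -/
theorem formField_ext {a b : FormField M r}
    (h : ∀ x₀ : M.carrier, ∀ y ∈ (chartAt M.model x₀).target, inChart a x₀ y = inChart b x₀ y) :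
    a = b := by
  funext x
  ext v
  have hx := mem_chart_source M.model x
  have h1 := DFunLike.congr_fun (h x _ ((chartAt M.model x).map_source hx))
    (fun i => mfderiv 𝓘(ℝ, M.model) 𝓘(ℝ, M.model) (chartAt M.model x) x (v i))
  have e : ∀ c : FormField M r, inChart c x (chartAt M.model x x)
    (fun i => mfderiv 𝓘(ℝ, M.model) 𝓘(ℝ, M.model) (chartAt M.model x) x (v i)) = c x v := fun c =>
    formField_congr c ((chartAt M.model x).left_inv hx) _ _ fun i => mfderiv_symm_comp x hx (v i)
  rw [← e a, ← e b]
  exact h1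

/-- The exterior derivative, computed at `x` in the preferred chart at `x`; by
`inChart_extDerivField` every other chart gives the same result on smooth forms. -/
def extDerivField (a : FormField M r) : FormField M (r + 1) := fun x =>
  (extDeriv (inChart a x) (chartAt M.model x x)).compContinuousLinearMap
    (mfderiv 𝓘(ℝ, M.model) 𝓘(ℝ, M.model) (chartAt M.model x) x)

theorem pullbackField_id (a : FormField M r) : pullbackField ContMDiffMap.id a = a := by
  funext x
  ext v
  refine formField_congr a rfl _ _ fun i => ?_
  change (mfderiv 𝓘(ℝ, M.model) 𝓘(ℝ, M.model) id x (v i) : M.model) = v i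
  rw [mfderiv_id]
  rfl

theorem extDeriv_inChart (f : SmoothMap M N) {a : FormField N r} (ha : IsSmooth a)
    (x₀ : M.carrier) (p₀ : N.carrier) {y : M.model} (hy : y ∈ coordDom f x₀ p₀) :
    extDeriv (inChart (pullbackField f a) x₀) y =
      (extDeriv (inChart a p₀) (coordMap f x₀ p₀ y)).compContinuousLinearMap
        (fderiv ℝ (coordMap f x₀ p₀) y) := by
  rw [(inChart_eventuallyEq f a x₀ p₀ hy).extDeriv_eq]
  exact extDeriv_pullback (r := ∞)
    ((ha.contDiffAt p₀ (coordMap_mem_target f x₀ p₀ hy)).differentiableAt (by simp))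
    (contDiffAt_coordMap f x₀ p₀ hy) (by simpa using ENat.LEInfty.out)

/-- In every chart, the exterior derivative is that of the coordinate expression. -/
theorem inChart_extDerivField {a : FormField M r} (ha : IsSmooth a) (x₀ : M.carrier)
    {y : M.model} (hy : y ∈ (chartAt M.model x₀).target) :
    inChart (extDerivField a) x₀ y = extDeriv (inChart a x₀) y := by
  have hy' := mem_coordDom_self (ContMDiffMap.id : SmoothMap M M) x₀ hy
  have h := extDeriv_inChart (ContMDiffMap.id : SmoothMap M M) ha x₀ _ hy'
  rw [pullbackField_id] at h
  rw [h]
  ext v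
  have hs := (mdiff_chart_symm x₀ hy).hasMFDerivAt
  have hc := (mdiff_chart ((chartAt M.model x₀).symm y)
    (mem_chart_source M.model ((chartAt M.model x₀).symm y))).hasMFDerivAt
  have e := (hasFDerivAt_coe (f := coordMap (ContMDiffMap.id : SmoothMap M M) x₀
    ((chartAt M.model x₀).symm y)) (hc.comp y hs).hasFDerivAt).fderiv
  change extDeriv (inChart a ((chartAt M.model x₀).symm y)) _ _ =
    extDeriv (inChart a ((chartAt M.model x₀).symm y)) _ _
  congr 1
  funext i
  exact (congrArg (fun L : M.model →L[ℝ] M.model => L (v i)) e).symm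

theorem IsSmooth.extDeriv {a : FormField M r} (ha : IsSmooth a) : IsSmooth (extDerivField a) := by
  intro x₀
  refine ContDiffOn.congr ?_ fun y hy => inChart_extDerivField ha x₀ hy
  exact (ContinuousAlternatingMap.alternatizeUncurryFinCLM ℝ M.model ℝ).contDiff.comp_contDiffOn
    ((ha x₀).fderiv_of_isOpen (chartAt M.model x₀).open_target (m := ∞) le_rfl)

theorem pullback_extDeriv (f : SmoothMap M N) {a : FormField N r} (ha : IsSmooth a) :
    pullbackField f (extDerivField a) = extDerivField (pullbackField f a) := by
  refine formField_ext fun x₀ y hy => ?_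
  have hy' := mem_coordDom_self f x₀ hy
  rw [inChart_extDerivField (ha.pullback f) x₀ hy, extDeriv_inChart f ha x₀ _ hy',
    inChart_pullback f _ x₀ _ hy', inChart_extDerivField ha _ (coordMap_mem_target f x₀ _ hy')]

theorem pullbackField_comp {L : Man.{w}} (f : SmoothMap M N) (g : SmoothMap L M)
    (a : FormField N r) :
    pullbackField (f.comp g) a = pullbackField g (pullbackField f a) := by
  funext x
  ext v
  refine formField_congr a rfl _ _ fun i => ?_
  have h := ((f.contMDiff.mdifferentiable (by simp) (g x)).hasMFDerivAt.comp x
    (g.contMDiff.mdifferentiable (by simp) x).hasMFDerivAt).mfderiv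
  exact congrArg (fun L' : L.model →L[ℝ] N.model => L' (v i)) h

/-- The pointwise wedge product. -/
def wedgeField {p q : ℕ} (a : FormField M p) (b : FormField M q) : FormField M (p + q) :=
  fun x => wedgeAlt p q (a x) (b x)

theorem IsSmooth.wedge {p q : ℕ} {a : FormField M p} {b : FormField M q} (ha : IsSmooth a)
    (hb : IsSmooth b) : IsSmooth (wedgeField a b) := by
  intro x₀
  have := finiteDimensional_alt (E := M.model) p
  have := finiteDimensional_alt (E := M.model) q
  refine ContDiffOn.congr (f := fun y => (wedgeAlt (T := M.model) p q).toContinuousBilinearMap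
    (inChart a x₀ y) (inChart b x₀ y)) ?_ fun y hy => ?_
  · exact ((wedgeAlt (T := M.model) p q).toContinuousBilinearMap.contDiff.comp_contDiffOn
      (ha x₀)).clm_apply (hb x₀)
  · exact wedgeAlt_comp _ _ _


variable (M r) in
/-- `Ω^r(M)`, the space of smooth differential `r`-forms on `M`. -/
def Form : Submodule ℝ (FormField M r) where
  carrier := {a | IsSmooth a}
  add_mem' := fun ha hb x₀ => (ha x₀).add (hb x₀)
  zero_mem' := fun _ => contDiffOn_const (c := 0)
  smul_mem' := fun c _ ha x₀ => (ha x₀).const_smul c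

namespace Form

/-- The pullback `f^* : Ω^r(N) → Ω^r(M)`. -/
def pullback (f : SmoothMap M N) : Form N r →ₗ[ℝ] Form M r where
  toFun a := ⟨pullbackField f a.1, a.2.pullback f⟩
  map_add' _ _ := rfl
  map_smul' _ _ := rfl

theorem pullback_id : pullback (ContMDiffMap.id : SmoothMap M M) =
    (LinearMap.id : Form M r →ₗ[ℝ] Form M r) :=
  LinearMap.ext fun a => Subtype.ext (pullbackField_id a.1)

theorem pullback_comp {L : Man.{w}} (f : SmoothMap M N) (g : SmoothMap L M) :
    pullback (f.comp g) = (pullback g).comp (pullback f : Form N r →ₗ[ℝ] Form M r) :=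
  LinearMap.ext fun a => Subtype.ext (pullbackField_comp f g a.1)

/-- The exterior derivative `Ω^r(M) → Ω^{r+1}(M)`. -/
def d (r : ℕ) : Form M r →ₗ[ℝ] Form M (r + 1) where
  toFun a := ⟨extDerivField a.1, a.2.extDeriv⟩
  map_add' a b := Subtype.ext <| funext fun x => by
    have hx := (chartAt M.model x).map_source (mem_chart_source M.model x)
    have h := extDeriv_add ((a.2.contDiffAt x hx).differentiableAt (by simp))
      ((b.2.contDiffAt x hx).differentiableAt (by simp))
    exact congrArg (fun c : M.model [⋀^Fin (r + 1)]→L[ℝ] ℝ => c.compContinuousLinearMap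
      (mfderiv 𝓘(ℝ, M.model) 𝓘(ℝ, M.model) (chartAt M.model x) x)) h
  map_smul' c a := Subtype.ext <| funext fun x => by
    have h := extDeriv_smul (x := chartAt M.model x x) c (inChart a.1 x)
    exact congrArg (fun c : M.model [⋀^Fin (r + 1)]→L[ℝ] ℝ => c.compContinuousLinearMap
      (mfderiv 𝓘(ℝ, M.model) 𝓘(ℝ, M.model) (chartAt M.model x) x)) h

theorem pullback_d (f : SmoothMap M N) (a : Form N r) :
    pullback f (d r a) = d r (pullback f a) :=
  Subtype.ext (pullback_extDeriv f a.2)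

/-- The wedge product `Ω^p(M) × Ω^q(M) → Ω^{p+q}(M)`. -/
def wedge (p q : ℕ) : Form M p →ₗ[ℝ] Form M q →ₗ[ℝ] Form M (p + q) :=
  LinearMap.mk₂ ℝ (fun a b => ⟨wedgeField a.1 b.1, a.2.wedge b.2⟩)
    (fun a a' b => Subtype.ext <| funext fun x => (wedgeAlt p q).map_add₂ (a.1 x) (a'.1 x) (b.1 x))
    (fun c a b => Subtype.ext <| funext fun x => (wedgeAlt p q).map_smul₂ c (a.1 x) (b.1 x))
    (fun a b b' => Subtype.ext <| funext fun x => (wedgeAlt p q (a.1 x)).map_add (b.1 x) (b'.1 x))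
    (fun c a b => Subtype.ext <| funext fun x => (wedgeAlt p q (a.1 x)).map_smul c (b.1 x))

theorem pullback_wedge (f : SmoothMap M N) {p q : ℕ} (a : Form N p) (b : Form N q) :
    pullback f (wedge p q a b) = wedge p q (pullback f a) (pullback f b) :=
  Subtype.ext <| funext fun x => wedgeAlt_comp (a.1 (f x)) (b.1 (f x))
    (mfderiv 𝓘(ℝ, M.model) 𝓘(ℝ, N.model) f x)

/-- The constant function `1`, as a `0`-form. -/
def one : Form M 0 :=
  ⟨fun x => ContinuousAlternatingMap.constOfIsEmpty ℝ (Tan M x) (Fin 0) 1,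
    fun _ => contDiffOn_const (c := ContinuousAlternatingMap.constOfIsEmpty ℝ M.model (Fin 0) 1)⟩

theorem pullback_one (f : SmoothMap M N) : pullback f one = (one : Form M 0) := rfl

end Form

end Forms

section Presheaves

open CategoryTheory Opposite

/-- The category of smooth manifolds and smooth maps. -/
instance : Category Man.{u} where
  Hom M N := SmoothMap M N
  id _ := ContMDiffMap.id
  comp f g := ContMDiffMap.comp g f

/-- A presheaf on manifolds: a contravariant functor from manifolds to sets. -/
abbrev Presheaf := Man.{u}ᵒᵖ ⥤ Type w

/-- The product of two presheaves. -/
def Presheaf.prod (F : Presheaf.{u, v}) (G : Presheaf.{u, w}) : Presheaf.{u, max v w} where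
  obj M := F.obj M × G.obj M
  map f := ↾fun x => (F.map f x.1, G.map f x.2)

/-- The presheaf `Ω^1 ⊗ V`, which sends `M` to the space of `V`-valued `1`-forms on `M`. For
finite-dimensional `V` this space is `Ω^1(M) ⊗ V`. -/
def oneForms (V : Type v) [AddCommGroup V] [Module ℝ V] : Presheaf.{u, max u v} where
  obj M := Form M.unop 1 ⊗[ℝ] V
  map f := ↾fun x => (Form.pullback f.unop).rTensor V x
  map_id M := by
    ext x
    exact LinearMap.congr_fun ((congrArg (LinearMap.rTensor V) Form.pullback_id).trans
      (LinearMap.rTensor_id V _)) x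
  map_comp f g := by
    ext x
    exact LinearMap.congr_fun ((congrArg (LinearMap.rTensor V)
      (Form.pullback_comp f.unop g.unop)).trans (LinearMap.rTensor_comp V _ _)) x

/-- `Ω^r(F)`: the differential `r`-forms on a presheaf `F`, i.e. the maps of presheaves of sets
`F → Ω^r`. Such a map is a family of arbitrary functions `τ_M : F(M) → Ω^r(M)`, one for each
manifold `M`, which is natural for all smooth maps. -/
def FormOn (F : Presheaf.{u, w}) (r : ℕ) :
    Submodule ℝ (∀ M : Man.{u}, F.obj (op M) → Form M r) where
  carrier := {τ | ∀ (M N : Man.{u}) (f : M ⟶ N) (x : F.obj (op N)),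
    τ M (F.map f.op x) = Form.pullback f (τ N x)}
  add_mem' hτ hσ M N f x := by
    simp only [Pi.add_apply, hτ M N f x, hσ M N f x, map_add]
  zero_mem' M N f x := by simp
  smul_mem' c τ hτ M N f x := by
    simp only [Pi.smul_apply, hτ M N f x, map_smul]

namespace FormOn

variable {F : Presheaf.{u, w}}

/-- The exterior derivative of forms on a presheaf. -/
def d (r : ℕ) : FormOn F r →ₗ[ℝ] FormOn F (r + 1) where
  toFun τ := ⟨fun M x => Form.d r (τ.1 M x), fun M N f x => by
    simp only [τ.2 M N f x, Form.pullback_d]⟩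
  map_add' τ σ := Subtype.ext <| by
    ext1 M; ext1 x; exact (Form.d r).map_add (τ.1 M x) (σ.1 M x)
  map_smul' c τ := Subtype.ext <| by
    ext1 M; ext1 x; exact (Form.d r).map_smul c (τ.1 M x)

/-- The wedge product of forms on a presheaf. -/
def wedge {p q : ℕ} (τ : FormOn F p) (σ : FormOn F q) : FormOn F (p + q) :=
  ⟨fun M x => Form.wedge p q (τ.1 M x) (σ.1 M x), fun M N f x => by
    simp only [τ.2 M N f x, σ.2 M N f x, Form.pullback_wedge]⟩

/-- The wedge product defines the multiplication of `⨁ r, Ω^r(F)`. -/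
instance : DirectSum.GNonUnitalNonAssocSemiring (fun r => FormOn F r) where
  mul τ σ := wedge τ σ
  mul_zero τ := Subtype.ext <| by ext1 M; ext1 x; exact map_zero _
  zero_mul σ := Subtype.ext <| by ext1 M; ext1 x; exact LinearMap.map_zero₂ _ _
  mul_add τ σ σ' := Subtype.ext <| by ext1 M; ext1 x; exact map_add _ _ _
  add_mul τ τ' σ := Subtype.ext <| by ext1 M; ext1 x; exact LinearMap.map_add₂ _ _ _ _

/-- The unit of `⨁ r, Ω^r(F)` is the constant function `1`. -/
instance : GradedMonoid.GOne (fun r => FormOn F r) where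
  one := ⟨fun _ _ => Form.one, fun _ _ _ _ => rfl⟩

end FormOn

/-- The de Rham complex `Ω^•(F) = ⨁ r, Ω^r(F)` of a presheaf `F`, with the wedge product. -/
abbrev DeRham (F : Presheaf.{u, w}) : Type _ := ⨁ r : ℕ, FormOn F r

/-- The inclusion of `Ω^r(F)` into `Ω^•(F)`. -/
def DeRham.incl (F : Presheaf.{u, w}) (r : ℕ) : FormOn F r →ₗ[ℝ] DeRham F :=
  DirectSum.lof ℝ ℕ (fun r => FormOn F r) r

/-- The de Rham differential of `Ω^•(F)`. -/
def DeRham.d (F : Presheaf.{u, w}) : DeRham F →ₗ[ℝ] DeRham F :=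
  DirectSum.toModule ℝ ℕ _ fun r =>
    (DeRham.incl F (r + 1)).comp (FormOn.d r)

variable (Y : Man.{u}) (V : Type v) [AddCommGroup V] [Module ℝ V]

/-- The presheaf `Y × (Ω^1 ⊗ V)`; the manifold `Y` stands for the presheaf `M ↦ C^∞(M, Y)`. -/
abbrev prodOneForms : Presheaf.{u, max u v} := Presheaf.prod (yoneda.obj Y) (oneForms.{u} V)

variable {Y} in
/-- The pullback of a form `b` on `Y` to `Y × (Ω^1 ⊗ V)`, i.e. `(φ, α) ↦ φ^* b`. -/
def formOfBase {r : ℕ} (b : Form Y r) : FormOn (prodOneForms Y V) r :=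
  ⟨fun _ x => Form.pullback x.1 b, fun _ _ f x =>
    LinearMap.congr_fun (Form.pullback_comp x.1 f) b⟩

variable {V} in
/-- The `1`-form on `Y × (Ω^1 ⊗ V)` of `l ∈ V^*`, i.e. `(φ, ∑ αᵢ ⊗ vᵢ) ↦ ∑ ⟨vᵢ, l⟩ αᵢ`. -/
def formOfDual (l : Module.Dual ℝ V) : FormOn (prodOneForms Y V) 1 :=
  ⟨fun M x => TensorProduct.rid ℝ (Form M 1) (l.lTensor (Form M 1) x.2), fun M N f x => by
    obtain ⟨φ, α⟩ := x
    change TensorProduct.rid ℝ _ (l.lTensor _ ((Form.pullback f).rTensor V α)) =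
      Form.pullback f (TensorProduct.rid ℝ _ (l.lTensor _ α))
    induction α using TensorProduct.induction_on with
    | zero => simp
    | tmul a v => simp
    | add a b ha hb => simp only [map_add, ha, hb]⟩

end Presheaves

section Koszul

variable (W : Type w) [AddCommGroup W] [Module ℝ W]

/-- The Koszul algebra `⋀ W ⊗ Sym W`. All of `Sym W` is in even degrees, so the product is the
ordinary (unsigned) product of the tensor product of algebras. -/
abbrev Koszul : Type w := ExteriorAlgebra ℝ W ⊗[ℝ] SymmetricAlgebra ℝ W

namespace Koszul

variable {W}

/-- The generator `v ∈ W = ⋀^1 W`. -/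
def gen (v : W) : Koszul W := ExteriorAlgebra.ι ℝ v ⊗ₜ[ℝ] 1
/-- The generator `ṽ ∈ W = Sym^1 W`. -/
def genTilde (v : W) : Koszul W := 1 ⊗ₜ[ℝ] SymmetricAlgebra.ι ℝ W v

variable (W)

/-- The component `⋀^p W ⊗ Sym^q W`. -/
def component (p q : ℕ) : Submodule ℝ (Koszul W) :=
  LinearMap.range (TensorProduct.map (⋀[ℝ]^p W).subtype
    ((LinearMap.range (SymmetricAlgebra.ι ℝ W)) ^ q).subtype)

/-- The homogeneous component of degree `m`, where `⋀^1 W` has degree `1` and `Sym^1 W` has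
degree `2`. -/
def degree (m : ℕ) : Submodule ℝ (Koszul W) :=
  ⨆ (p : ℕ) (q : ℕ) (_ : p + 2 * q = m), component W p q

/-- The automorphism `x ↦ (-1)^{deg x} x`. -/
def parity : Koszul W →ₐ[ℝ] Koszul W :=
  Algebra.TensorProduct.map (CliffordAlgebra.involute (Q := (0 : QuadraticForm ℝ W)))
    (AlgHom.id ℝ (SymmetricAlgebra ℝ W))

/-- The recursion step `d(v ∧ x) = x ⊗ ṽ - v ∧ d x`, as a function of `v`, `x` and `d x`. -/
def step : W →ₗ[ℝ] ExteriorAlgebra ℝ W × Koszul W →ₗ[ℝ] Koszul W :=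
  LinearMap.mk₂ ℝ (fun v z => z.1 ⊗ₜ[ℝ] SymmetricAlgebra.ι ℝ W v - gen v * z.2)
    (fun v v' z => by simp [gen, TensorProduct.tmul_add, TensorProduct.add_tmul, add_mul]; abel)
    (fun c v z => by
      simp only [gen, map_smul, TensorProduct.tmul_smul, ← TensorProduct.smul_tmul', smul_sub,
        smul_mul_assoc])
    (fun v z z' => by simp [TensorProduct.add_tmul, mul_add]; abel)
    (fun c v z => by simp only [Prod.smul_fst, Prod.smul_snd, ← TensorProduct.smul_tmul', smul_sub,
        mul_smul_comm])

/-- The Koszul differential on the exterior algebra. -/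
def dExt : ExteriorAlgebra ℝ W →ₗ[ℝ] Koszul W :=
  CliffordAlgebra.foldr' (0 : QuadraticForm ℝ W) (step W)
    (fun v x n => by
      simp only [step, gen, LinearMap.mk₂_apply, mul_sub, Algebra.TensorProduct.tmul_mul_tmul,
        ← mul_assoc, one_mul]
      erw [CliffordAlgebra.ι_sq_scalar]
      simp) 0

/-- The Koszul differential: the antiderivation with `d v = ṽ` and `d ṽ = 0`, see `d_gen`,
`d_genTilde`, `d_mul`. -/
def d : Koszul W →ₗ[ℝ] Koszul W :=
  TensorProduct.lift ((LinearMap.mul ℝ (Koszul W)).compl₁₂ (dExt W)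
    (Algebra.TensorProduct.includeRight : SymmetricAlgebra ℝ W →ₐ[ℝ] Koszul W).toLinearMap)

variable {W}

theorem dExt_one : dExt W 1 = 0 := by
  have h : dExt W (algebraMap ℝ (CliffordAlgebra (0 : QuadraticForm ℝ W)) 1) = (1 : ℝ) • 0 :=
    CliffordAlgebra.foldr'_algebraMap (0 : QuadraticForm ℝ W) (step W) _ 0 1
  simpa using h

theorem dExt_ι_mul (v : W) (x : ExteriorAlgebra ℝ W) :
    dExt W (ExteriorAlgebra.ι ℝ v * x) =
      x ⊗ₜ[ℝ] SymmetricAlgebra.ι ℝ W v - gen v * dExt W x :=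
  CliffordAlgebra.foldr'_ι_mul (0 : QuadraticForm ℝ W) (step W) _ 0 v x

theorem d_tmul (x : ExteriorAlgebra ℝ W) (s : SymmetricAlgebra ℝ W) :
    d W (x ⊗ₜ s) = dExt W x * 1 ⊗ₜ s := rfl

theorem d_gen (v : W) : d W (gen v) = genTilde v := by
  have h := dExt_ι_mul v 1
  rw [dExt_one, mul_one, mul_zero, sub_zero] at h
  rw [gen, d_tmul, h, genTilde, Algebra.TensorProduct.tmul_mul_tmul, mul_one, mul_one]

theorem d_genTilde (v : W) : d W (genTilde v) = 0 := by
  rw [genTilde, d_tmul, dExt_one, zero_mul]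

theorem dExt_mul (x y : ExteriorAlgebra ℝ W) :
    dExt W (x * y) = dExt W x * y ⊗ₜ 1 + parity W (x ⊗ₜ 1) * dExt W y := by
  induction x using CliffordAlgebra.left_induction with
  | algebraMap r =>
    have h : dExt W (algebraMap ℝ _ r) = 0 := by
      rw [Algebra.algebraMap_eq_smul_one, map_smul, dExt_one, smul_zero]
    rw [h, zero_mul, zero_add, ← Algebra.smul_def, map_smul]
    simp [parity, Algebra.algebraMap_eq_smul_one, ← TensorProduct.smul_tmul',
      ← Algebra.TensorProduct.one_def]
  | add x x' hx hx' => simp only [add_mul, map_add, hx, hx', TensorProduct.add_tmul]; abel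
  | ι_mul x v hx =>
    have e : parity W ((ExteriorAlgebra.ι ℝ v * x) ⊗ₜ 1) =
        (-1 : ℝ) • (gen v * parity W (x ⊗ₜ 1)) := by
      have e1 : (ExteriorAlgebra.ι ℝ v * x) ⊗ₜ[ℝ] (1 : SymmetricAlgebra ℝ W) =
        gen v * x ⊗ₜ[ℝ] 1 := by simp [gen]
      have e2 : parity W (gen v) = (-1 : ℝ) • gen v := by
        simp only [parity, gen, Algebra.TensorProduct.map_tmul, map_one]
        erw [CliffordAlgebra.involute_ι]
        rw [TensorProduct.neg_tmul]
        exact (neg_one_smul ℝ _).symm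
      rw [e1, map_mul, e2, smul_mul_assoc]
    change dExt W (ExteriorAlgebra.ι ℝ v * x * y) = dExt W (ExteriorAlgebra.ι ℝ v * x) * _ +
      parity W ((ExteriorAlgebra.ι ℝ v * x) ⊗ₜ 1) * _
    rw [mul_assoc, dExt_ι_mul, hx, dExt_ι_mul, e, sub_mul, Algebra.TensorProduct.tmul_mul_tmul,
      mul_one, mul_add, smul_mul_assoc, mul_assoc, mul_assoc]
    module

/-- The graded Leibniz rule `d(x y) = (d x) y + (-1)^{deg x} x (d y)`. -/
theorem d_mul (x y : Koszul W) : d W (x * y) = d W x * y + parity W x * d W y := by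
  induction x using TensorProduct.induction_on with
  | zero => simp
  | add x x' hx hx' => simp only [add_mul, map_add, hx, hx']; abel
  | tmul x s =>
    induction y using TensorProduct.induction_on with
    | zero => simp
    | add y y' hy hy' => simp only [mul_add, map_add, hy, hy']; abel
    | tmul y t =>
      have c : ∀ (s : SymmetricAlgebra ℝ W) (z : Koszul W),
          1 ⊗ₜ s * z = z * 1 ⊗ₜ s := fun s z => by
        induction z using TensorProduct.induction_on with
        | zero => simp
        | add z z' hz hz' => simp only [mul_add, add_mul, hz, hz']
        | tmul z t => simp [mul_comm s t]
      have e : ∀ s : SymmetricAlgebra ℝ W, parity W (x ⊗ₜ s) = parity W (x ⊗ₜ 1) * 1 ⊗ₜ s :=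
        fun s => by simp [parity]
      have e1 : (1 : ExteriorAlgebra ℝ W) ⊗ₜ[ℝ] (s * t) = 1 ⊗ₜ s * 1 ⊗ₜ t := by simp
      have e2 : y ⊗ₜ[ℝ] t = y ⊗ₜ[ℝ] 1 * 1 ⊗ₜ t := by simp
      rw [Algebra.TensorProduct.tmul_mul_tmul, d_tmul, d_tmul, d_tmul, dExt_mul, e s, e1, e2]
      simp only [add_mul, mul_assoc]
      rw [← mul_assoc (1 ⊗ₜ[ℝ] s) (y ⊗ₜ[ℝ] 1), c s (y ⊗ₜ[ℝ] 1),
        ← mul_assoc (1 ⊗ₜ[ℝ] s) (dExt W y), c s (dExt W y)]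
      simp only [mul_assoc]

end Koszul
end Koszul

section KoszulForms

variable (Y : Man.{u}) (V : Type v) [AddCommGroup V] [Module ℝ V]

/-- `Ω^r(Y; K)` for the Koszul algebra `K` of `V^*`. The homogeneous components of `K` are
finite-dimensional, so the `K`-valued `r`-forms of a given total degree are `Ω^r(Y) ⊗ K^m`. -/
abbrev KForm (r : ℕ) : Type _ := Form Y r ⊗[ℝ] Koszul (Module.Dual ℝ V)

namespace KForm

variable {Y V}

/-- The product `(b ⊗ k) (c ⊗ l) = (-1)^{deg k deg c} (b ∧ c) ⊗ (k l)`. -/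
def mul (r s : ℕ) : KForm Y V r →ₗ[ℝ] KForm Y V s →ₗ[ℝ] KForm Y V (r + s) :=
  TensorProduct.map₂ (Form.wedge r s)
    ((LinearMap.mul ℝ (Koszul (Module.Dual ℝ V))).comp ((Koszul.parity _) ^ s).toLinearMap)

/-- The multiplication of `⨁ r, Ω^r(Y; K)`. -/
instance : DirectSum.GNonUnitalNonAssocSemiring (fun r => KForm Y V r) where
  mul a b := mul _ _ a b
  mul_zero _ := map_zero _
  zero_mul _ := LinearMap.map_zero₂ _ _
  mul_add _ _ _ := map_add _ _ _
  add_mul _ _ _ := LinearMap.map_add₂ _ _ _ _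

/-- The unit of `⨁ r, Ω^r(Y; K)`. -/
instance : GradedMonoid.GOne (fun r => KForm Y V r) where
  one := Form.one ⊗ₜ 1

end KForm

/-- `Ω(Y; K)`, the differential forms on `Y` with values in the Koszul algebra `K` of `V^*`. -/
abbrev KoszulForms : Type _ := ⨁ r : ℕ, KForm Y V r

namespace KoszulForms

/-- The component `Ω(Y; K)^n = ⨁_{r + m = n} Ω^r(Y; K^m)` of total degree `n`. -/
def degree (n : ℕ) : Submodule ℝ (KoszulForms Y V) :=
  ⨆ (r : ℕ) (m : ℕ) (_ : r + m = n),
    (LinearMap.range (LinearMap.lTensor (Form Y r)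
      (Koszul.degree (Module.Dual ℝ V) m).subtype)).map (DirectSum.lof ℝ ℕ (fun r => KForm Y V r) r)

/-- The de Rham differential of `Y`, `b ⊗ k ↦ d b ⊗ k`. -/
def dBase : KoszulForms Y V →ₗ[ℝ] KoszulForms Y V :=
  DirectSum.toModule ℝ ℕ _ fun r =>
    (DirectSum.lof ℝ ℕ (fun r => KForm Y V r) (r + 1)).comp
      ((Form.d r).rTensor (Koszul (Module.Dual ℝ V)))

/-- The Koszul differential, `b ⊗ k ↦ (-1)^{deg b} b ⊗ d k`. -/
def dKoszul : KoszulForms Y V →ₗ[ℝ] KoszulForms Y V :=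
  DirectSum.toModule ℝ ℕ _ fun r =>
    (-1 : ℝ) ^ r • (DirectSum.lof ℝ ℕ (fun r => KForm Y V r) r).comp
      ((Koszul.d (Module.Dual ℝ V)).lTensor (Form Y r))

variable {Y V}
/-- The element `b ⊗ k`. -/
def of {r : ℕ} (b : Form Y r) (k : Koszul (Module.Dual ℝ V)) : KoszulForms Y V :=
  DirectSum.lof ℝ ℕ (fun r => KForm Y V r) r (b ⊗ₜ k)

end KoszulForms
end KoszulForms

end NatForm

end

open NatForm

/-! A form `τ` on `Y × (Ω^1 ⊗ V)` is an arbitrary natural family of functions; neither linearity nor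
continuity in the section is assumed. Naturality is enough because a single `1`-form controls all
others: the slot form `λ = e^y dx` on the plane. Its pullbacks are the forms `e^h dg`, and every
`1`-form on a vector space is a finite sum of these (`Plane.closure_slots`). Moreover `λ` is
preserved by the maps `(x, y) ↦ (e^{y₀} (x - x₀), y - y₀)`, which move any point to the origin, and
it is killed by `(x, y) ↦ (0, y)`.

Evaluate `τ` at `(φ, α + λ ⊗ v)` on `M × Plane`. The symmetries show that the result is determined
along `M × {0}`, and the projection shows that its part without `dx` is `τ(φ, α)`. Only the
coefficients of `dx` and `dy ∧ dx` remain, so `τ(φ, α + λ ⊗ v) = τ(φ, α) + ∂_v τ(φ, α) λ + ∂'_v τ(φ,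
α) dλ` (`DeRhamAlg.eval_addSlot`). Here `∂_v τ` and `∂'_v τ` (`del`, `del₂`) are again forms on the
presheaf, of degree lower by `1` and `2`. Multiplying such expansions shows that `∂_v` acts as the
contraction with respect to the `η(ℓ)`, and `∂'_v` as the partial derivative with respect to the
`dη(ℓ)`. The same operators exist on the Koszul algebra, and `η` intertwines them.

Let `θᵢ` be the images under `η` of the basis dual to `vᵢ`. The Euler operator `E τ = ∑ (∂ᵢ τ) θᵢ +
(∂'ᵢ τ) dθᵢ`, evaluated at `(φ, t α)`, is `t` times the derivative of `t ↦ τ(φ, t α)`. If `E τ = 0`,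
then `τ(φ, α) = τ(φ, 0) = φ^* τ(id, 0)`, so `τ` comes from `Y` (`mem_range_base_of_euler_eq_zero`).
On the Koszul side `E` counts generators.

Surjectivity of `η` is an induction on the degree of `τ`. The contractions of `τ` lie in the image,
hence so does `E τ`; since every product with a generator is in the image of the Koszul Euler
operator, `E τ = E η(z)` for some `z`, and `τ - η(z)` comes from `Y`. Injectivity is an induction on
the number of generators: if `η(z) = 0`, all contractions of `z` vanish by induction, so `E z = 0`,
which forces `z` into the previous step of the filtration. Compatibility with products and
differentials is checked on generators. -/

noncomputable section

namespace NatForm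

/-! ### Alternating sums over permutations -/

section AlternatingSums

variable {ι κ T : Type*} [Fintype ι] [DecidableEq ι] [Fintype κ] [DecidableEq κ]

/-- The alternating sum `∑_σ sgn σ f(v ∘ σ)`. -/
def altSum (f : (ι → T) → ℝ) (v : ι → T) : ℝ :=
  ∑ σ : Equiv.Perm ι, (Equiv.Perm.sign σ : ℝ) * f (v ∘ σ)

theorem altSum_smul (c : ℝ) (f : (ι → T) → ℝ) (v : ι → T) :
    altSum (fun w => c * f w) v = c * altSum f v := by
  simp only [altSum, Finset.mul_sum]
  exact Finset.sum_congr rfl fun σ _ => by ring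

theorem altSum_sum {α : Type*} (s : Finset α) (f : α → (ι → T) → ℝ) (v : ι → T) :
    altSum (fun w => ∑ i ∈ s, f i w) v = ∑ i ∈ s, altSum (f i) v := by
  simp only [altSum, Finset.mul_sum]
  exact Finset.sum_comm

theorem altSum_reindex (e : ι ≃ κ) (f : (ι → T) → ℝ) (v : κ → T) :
    altSum (fun w : κ → T => f (w ∘ e)) v = altSum f (v ∘ e) := by
  refine (Fintype.sum_equiv e.permCongr _ _ fun σ => ?_).symm
  rw [Equiv.Perm.sign_permCongr]
  congr 2
  funext i
  simp [Equiv.permCongr_apply]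

theorem altSum_comp_perm (π : Equiv.Perm ι) (f : (ι → T) → ℝ) (v : ι → T) :
    altSum (fun w => f (w ∘ π)) v = (Equiv.Perm.sign π : ℝ) * altSum f v := by
  rw [altSum, altSum, Finset.mul_sum]
  refine Fintype.sum_equiv (Equiv.mulRight π) _ _ fun σ => ?_
  have h : ((Equiv.Perm.sign π : ℤ) : ℝ) * ((Equiv.Perm.sign π : ℤ) : ℝ) = 1 := by
    exact_mod_cast Int.units_coe_mul_self _
  simp only [Equiv.coe_mulRight, Equiv.Perm.sign_mul, Units.val_mul, Int.cast_mul,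
    Equiv.Perm.coe_mul, Function.comp_assoc]
  linear_combination (-(Equiv.Perm.sign σ : ℝ) * f (v ∘ σ ∘ π)) * h

theorem altSum_comp_arg (π : Equiv.Perm ι) (f : (ι → T) → ℝ) (v : ι → T) :
    altSum f (v ∘ π) = (Equiv.Perm.sign π : ℝ) * altSum f v := by
  rw [← altSum_comp_perm π, altSum_reindex π f v]

/-- Every `g` contributes the same amount: precomposition with `ρ g` multiplies the alternating sum
by a sign, which cancels the sign in front. It is applied with permutations of one block of indices,
or fixing one index, to absorb an inner alternating sum into an outer one. -/
theorem altSum_average {G : Type*} [Fintype G] (ρ : G → Equiv.Perm ι) (f : (ι → T) → ℝ)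
    (v : ι → T) :
    altSum (fun w => ∑ g, (Equiv.Perm.sign (ρ g) : ℝ) * f (w ∘ ρ g)) v =
      Fintype.card G * altSum f v := by
  rw [altSum_sum]
  have h : ∀ g, altSum (fun w => (Equiv.Perm.sign (ρ g) : ℝ) * f (w ∘ ρ g)) v = altSum f v := by
    intro g
    rw [altSum_smul, altSum_comp_perm, ← mul_assoc]
    have h : ((Equiv.Perm.sign (ρ g) : ℤ) : ℝ) * ((Equiv.Perm.sign (ρ g) : ℤ) : ℝ) = 1 := by
      exact_mod_cast Int.units_coe_mul_self _
    rw [h, one_mul]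
  simp [h]

/-- The tensor product of functions of tuples. -/
def tens {p q : ℕ} (f : (Fin p → T) → ℝ) (g : (Fin q → T) → ℝ) (v : Fin (p + q) → T) : ℝ :=
  f (v ∘ Fin.castAdd q) * g (v ∘ Fin.natAdd p)

/-- A permutation of the first block, extended by the identity, is a permutation of all indices with
the same sign, so the inner sum is an average in the sense of `altSum_average`. -/
theorem altSum_tens_altSum_left {p q : ℕ} (f : (Fin p → T) → ℝ) (g : (Fin q → T) → ℝ)
    (v : Fin (p + q) → T) :
    altSum (tens (altSum f) g) v = p.factorial * altSum (tens f g) v := by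
  have h := altSum_average (fun π : Equiv.Perm (Fin p) =>
    finSumFinEquiv.permCongr (Equiv.Perm.sumCongr π (1 : Equiv.Perm (Fin q)))) (tens f g) v
  rw [Fintype.card_perm, Fintype.card_fin] at h
  rw [← h]
  congr 1
  funext w
  rw [tens, altSum, Finset.sum_mul]
  refine Finset.sum_congr rfl fun π _ => ?_
  rw [Equiv.Perm.sign_permCongr, Equiv.Perm.sign_sumCongr, Equiv.Perm.sign_one, mul_one, mul_assoc,
    tens]
  congr 3
  · funext i; simp
  · funext i; simp

theorem altSum_tens_altSum_right {p q : ℕ} (f : (Fin p → T) → ℝ) (g : (Fin q → T) → ℝ)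
    (v : Fin (p + q) → T) :
    altSum (tens f (altSum g)) v = q.factorial * altSum (tens f g) v := by
  have h := altSum_average (fun π : Equiv.Perm (Fin q) =>
    finSumFinEquiv.permCongr (Equiv.Perm.sumCongr (1 : Equiv.Perm (Fin p)) π)) (tens f g) v
  rw [Fintype.card_perm, Fintype.card_fin] at h
  rw [← h]
  congr 1
  funext w
  rw [tens, altSum, Finset.mul_sum]
  refine Finset.sum_congr rfl fun π _ => ?_
  rw [Equiv.Perm.sign_permCongr, Equiv.Perm.sign_sumCongr, Equiv.Perm.sign_one, one_mul,
    tens, mul_left_comm]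
  congr 3
  · funext i; simp
  · funext i; simp

end AlternatingSums

/-! ### Algebra of the wedge product of alternating forms -/

section WedgeAlt

variable {T T' : Type*} [AddCommGroup T] [Module ℝ T] [TopologicalSpace T]
variable {p q r : ℕ}

theorem wedgeAlt_eq_altSum (a : T [⋀^Fin p]→L[ℝ] ℝ) (b : T [⋀^Fin q]→L[ℝ] ℝ)
    (v : Fin (p + q) → T) :
    wedgeAlt p q a b v = ((p.factorial : ℝ) * q.factorial)⁻¹ * altSum (tens a b) v :=
  wedgeAlt_apply a b v

theorem altSum_alternating (a : T [⋀^Fin p]→L[ℝ] ℝ) (v : Fin p → T) :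
    altSum a v = p.factorial * a v := by
  have h : ∀ σ : Equiv.Perm (Fin p), (Equiv.Perm.sign σ : ℝ) * a (v ∘ σ) = a v := fun σ => by
    have h := a.toAlternatingMap.map_perm v σ
    change a (v ∘ σ) = _ • a v at h
    rw [h, Units.smul_def, zsmul_eq_mul, ← mul_assoc]
    have h : ((Equiv.Perm.sign σ : ℤ) : ℝ) * ((Equiv.Perm.sign σ : ℤ) : ℝ) = 1 := by
      exact_mod_cast Int.units_coe_mul_self _
    rw [h, one_mul]
  simp [altSum, h, Fintype.card_perm]

/-- Both sides are the alternating sum of the triple tensor product divided by `p! q! r!`: absorbing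
the inner alternation produces `(p + q)!` or `(q + r)!`, which cancels against the outer
normalization. -/
theorem wedgeAlt_assoc (a : T [⋀^Fin p]→L[ℝ] ℝ) (b : T [⋀^Fin q]→L[ℝ] ℝ)
    (c : T [⋀^Fin r]→L[ℝ] ℝ) (v : Fin (p + q + r) → T) :
    wedgeAlt (p + q) r (wedgeAlt p q a b) c v =
      wedgeAlt p (q + r) a (wedgeAlt q r b c) (v ∘ finCongr (add_assoc p q r).symm) := by
  have e1 : tens (wedgeAlt p q a b) c = fun w =>
      ((p.factorial : ℝ) * q.factorial)⁻¹ * tens (altSum (tens a b)) c w := by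
    funext w
    simp only [tens, wedgeAlt_eq_altSum, mul_assoc]
  have e2 : tens a (wedgeAlt q r b c) = fun w =>
      ((q.factorial : ℝ) * r.factorial)⁻¹ * tens a (altSum (tens b c)) w := by
    funext w
    simp only [tens, wedgeAlt_eq_altSum]
    ring
  have e3 : tens (tens a b) c = fun w : Fin (p + q + r) → T =>
      tens a (tens b c) (w ∘ finCongr (add_assoc p q r).symm) := by
    funext w
    simp only [tens, mul_assoc]
    refine congrArg₂ _ (congrArg a ?_) (congrArg₂ _ (congrArg b ?_) (congrArg c ?_)) <;> funext i <;>
      exact congrArg w (by ext; simp [Nat.add_assoc])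
  rw [wedgeAlt_eq_altSum, wedgeAlt_eq_altSum, e1, e2, altSum_smul, altSum_smul,
    altSum_tens_altSum_left, altSum_tens_altSum_right, e3, altSum_reindex]
  have h1 : ((p + q).factorial : ℝ) ≠ 0 := by positivity
  have h2 : ((q + r).factorial : ℝ) ≠ 0 := by positivity
  have h3 : (p.factorial : ℝ) ≠ 0 := by positivity
  have h4 : (q.factorial : ℝ) ≠ 0 := by positivity
  have h5 : (r.factorial : ℝ) ≠ 0 := by positivity
  field_simp

/-- Interchanging the two blocks is the `q`-th power of the cyclic rotation of `p + q` indices. The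
case `p = 0` is separate because `q` is then not an element of `Fin (q + p)`. -/
theorem sign_finAddFlip (p q : ℕ) : Equiv.Perm.sign ((finCongr (add_comm q p)).trans
    (finAddFlip (m := p) (n := q))) = (-1) ^ (p * q) := by
  rcases Nat.eq_zero_or_pos p with rfl | hp
  · rw [zero_mul, pow_zero]
    convert Equiv.Perm.sign_one
    ext i
    obtain ⟨i, hi⟩ := i
    simpa using congrArg Fin.val (finAddFlip_apply_mk_right (m := 0) (n := q) (Nat.zero_le i) (by omega))
  · have h : (finCongr (add_comm q p)).trans (finAddFlip (m := p) (n := q)) =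
      (finRotate (q + p)) ^ q := by
      have h := finCycle_eq_finRotate_iterate (k := (⟨q, by omega⟩ : Fin (q + p)))
      ext i
      rw [← Equiv.Perm.iterate_eq_pow, ← h, finCycle_apply, Fin.val_add]
      obtain ⟨i, hi⟩ := i
      rcases lt_or_ge i p with hi' | hi'
      · simp [finAddFlip_apply_mk_left hi']
        rw [Nat.mod_eq_of_lt (by omega)]
        omega
      · simp [finAddFlip_apply_mk_right hi']
        rw [Nat.mod_eq_sub_mod (by omega), Nat.mod_eq_of_lt (by omega)]
        omega
    rw [h, map_pow, sign_finRotate, ← pow_mul]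
    obtain ⟨p, rfl⟩ := Nat.exists_eq_add_of_lt hp
    -- The exponent coming from the rotation differs from the desired product of the two degrees by
    -- the even number `q (q - 1)`.
    have : (q + (0 + p + 1) - 1) * q = (0 + p + 1) * q + q * (q - 1) := by
      cases q with
      | zero => simp
      | succ q => simp; ring
    rw [this, pow_add, Even.neg_one_pow (Nat.even_mul_pred_self q), mul_one]

theorem wedgeAlt_comm (a : T [⋀^Fin p]→L[ℝ] ℝ) (b : T [⋀^Fin q]→L[ℝ] ℝ)
    (v : Fin (q + p) → T) :
    wedgeAlt q p b a v = (-1) ^ (p * q) * wedgeAlt p q a b (v ∘ finCongr (add_comm p q)) := by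
  have e : tens b a = fun w : Fin (q + p) → T =>
      tens a b (w ∘ finAddFlip (m := p) (n := q)) := by
    funext w
    simp only [tens]
    rw [mul_comm]
    congr 2
    · funext i; simp
    · funext i; simp
  have e' : v ∘ finAddFlip (m := p) (n := q) = (v ∘ ((finCongr (add_comm q p)).trans
    (finAddFlip (m := p) (n := q)))) ∘ finCongr (add_comm p q) := by
    funext i; simp
  have e'' : ∀ x : Fin (q + p) → T, altSum (tens a b) (x ∘ finCongr (add_comm p q)) =
      altSum (fun w => tens a b (w ∘ finCongr (add_comm p q))) x :=
    fun x => (altSum_reindex _ _ _).symm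
  rw [wedgeAlt_eq_altSum, wedgeAlt_eq_altSum, e, altSum_reindex, e', e'', altSum_comp_arg, ← e'',
    sign_finAddFlip]
  push_cast
  ring

theorem wedgeAlt_one_left (b : T [⋀^Fin q]→L[ℝ] ℝ) (v : Fin (0 + q) → T) :
    wedgeAlt 0 q (ContinuousAlternatingMap.constOfIsEmpty ℝ T (Fin 0) 1) b v =
      b (v ∘ finCongr (zero_add q).symm) := by
  have e : tens (ContinuousAlternatingMap.constOfIsEmpty ℝ T (Fin 0) 1) b =
      fun w => b (w ∘ finCongr (zero_add q).symm) := by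
    funext w
    simp only [tens, ContinuousAlternatingMap.constOfIsEmpty_apply, one_mul]
    congr 1
    funext i
    exact congrArg w (by ext; simp)
  rw [wedgeAlt_eq_altSum, e, altSum_reindex, altSum_alternating]
  have h4 : (q.factorial : ℝ) ≠ 0 := by positivity
  simp [h4]

theorem wedgeAlt_one_right (a : T [⋀^Fin p]→L[ℝ] ℝ) :
    wedgeAlt p 0 a (ContinuousAlternatingMap.constOfIsEmpty ℝ T (Fin 0) 1) = a := by
  ext v
  have e : tens a (ContinuousAlternatingMap.constOfIsEmpty ℝ T (Fin 0) 1) = a := by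
    funext w
    simp only [tens, ContinuousAlternatingMap.constOfIsEmpty_apply, mul_one]
    rfl
  rw [wedgeAlt_eq_altSum, e]
  change _ * altSum a v = _
  rw [altSum_alternating]
  have h4 : (p.factorial : ℝ) ≠ 0 := by positivity
  simp [h4]

/-- A wedge product vanishes on a tuple in which the number of vectors that are admissible for
the second factor only is different from its degree. -/
theorem wedgeAlt_eq_zero_of_card (a : T [⋀^Fin p]→L[ℝ] ℝ) (b : T [⋀^Fin q]→L[ℝ] ℝ)
    (v : Fin (p + q) → T) (S : Finset (Fin (p + q))) (hS : S.card ≠ q)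
    (ha : ∀ w : Fin p → Fin (p + q), (∃ i, w i ∈ S) → a (v ∘ w) = 0)
    (hb : ∀ w : Fin q → Fin (p + q), (∃ i, w i ∉ S) → b (v ∘ w) = 0) :
    wedgeAlt p q a b v = 0 := by
  rw [wedgeAlt_eq_altSum, altSum, Finset.sum_eq_zero, mul_zero]
  intro σ _
  by_cases h1 : ∃ i : Fin p, σ (Fin.castAdd q i) ∈ S
  · have h := ha (fun i => σ (Fin.castAdd q i)) h1
    rw [tens]
    exact mul_eq_zero_of_right _ (mul_eq_zero_of_left h _)
  by_cases h2 : ∃ i : Fin q, σ (Fin.natAdd p i) ∉ S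
  · have h := hb (fun i => σ (Fin.natAdd p i)) h2
    rw [tens]
    exact mul_eq_zero_of_right _ (mul_eq_zero_of_right _ h)
  -- In the remaining case `σ` maps the second block of indices exactly onto `S`, so `S` has `q`
  -- elements, contrary to `hS`.
  push Not at h1 h2
  refine absurd ?_ hS
  have : S = Finset.univ.image (fun i : Fin q => σ (Fin.natAdd p i)) := by
    ext j
    simp only [Finset.mem_image, Finset.mem_univ, true_and]
    refine ⟨fun hj => ?_, fun ⟨i, hi⟩ => hi ▸ h2 i⟩
    obtain ⟨k, rfl⟩ := σ.surjective j
    induction k using Fin.addCases with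
    | left i => exact absurd hj (h1 i)
    | right i => exact ⟨i, rfl⟩
  rw [this, Finset.card_image_of_injective _ fun i j h => by simpa using σ.injective h]
  simp

/-- If the first factor vanishes as soon as one of its arguments is one of the vectors `e`, then
the wedge product is a plain product on tuples which end in `e`. -/
theorem wedgeAlt_append (a : T [⋀^Fin p]→L[ℝ] ℝ) (b : T [⋀^Fin q]→L[ℝ] ℝ)
    (x : Fin p → T) (e : Fin q → T) (h : ∀ w : Fin p → T, (∃ i j, w i = e j) → a w = 0) :
    wedgeAlt p q a b (Fin.append x e) = a x * b e := by
  have e0 : tens a b = fun w : Fin (p + q) → T =>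
      (fun u : Fin p ⊕ Fin q → T => a (u ∘ Sum.inl) * b (u ∘ Sum.inr)) (w ∘ finSumFinEquiv) := by
    funext w
    simp only [tens, Function.comp_assoc]
    rfl
  have e1 : Fin.append x e ∘ finSumFinEquiv = Sum.elim x e := by
    funext i
    rcases i with i | i <;> simp
  rw [wedgeAlt_eq_altSum, e0, altSum_reindex finSumFinEquiv
    (fun u : Fin p ⊕ Fin q → T => a (u ∘ Sum.inl) * b (u ∘ Sum.inr)), e1, altSum]
  have key : ∑ σ : Equiv.Perm (Fin p ⊕ Fin q), (Equiv.Perm.sign σ : ℝ) *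
      (a ((Sum.elim x e ∘ σ) ∘ Sum.inl) * b ((Sum.elim x e ∘ σ) ∘ Sum.inr)) =
      ∑ στ : Equiv.Perm (Fin p) × Equiv.Perm (Fin q),
        ((Equiv.Perm.sign στ.1 : ℝ) * a (x ∘ στ.1)) * ((Equiv.Perm.sign στ.2 : ℝ) * b (e ∘ στ.2)) := by
    symm
    -- Only the permutations that preserve both blocks contribute: any other one sends an index of
    -- the first block into the second and thus feeds one of the vectors `e` to `a`.
    refine Finset.sum_of_injOn (fun στ => Equiv.Perm.sumCongr στ.1 στ.2) ?_ ?_ ?_ ?_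
    · intro s _ t _ hst
      exact Equiv.Perm.sumCongrHom_injective hst
    · intro _ _; simp
    · intro σ _ hσ
      have : ∃ i j, σ (Sum.inl i) = Sum.inr j := by
        by_contra! hcon
        have hm : Set.MapsTo σ (Set.range Sum.inl) (Set.range Sum.inl) := by
          rintro _ ⟨i, rfl⟩
          rcases hi : σ (Sum.inl i) with j | j
          · exact ⟨j, rfl⟩
          · exact absurd hi (hcon i j)
        obtain ⟨s, hs⟩ := Equiv.Perm.mem_sumCongrHom_range_of_perm_mapsTo_inl hm
        exact hσ ⟨s, by simp, hs⟩
      obtain ⟨i, j, hij⟩ := this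
      rw [h _ ⟨i, j, by simp [hij]⟩, zero_mul, mul_zero]
    · intro s _
      rw [Equiv.Perm.sign_sumCongr]
      push_cast
      have h1 : (Sum.elim x e ∘ s.1.sumCongr s.2) ∘ Sum.inl = x ∘ s.1 := by funext i; simp
      have h2 : (Sum.elim x e ∘ s.1.sumCongr s.2) ∘ Sum.inr = e ∘ s.2 := by funext i; simp
      rw [h1, h2]
      ring
  have key' : ∑ στ : Equiv.Perm (Fin p) × Equiv.Perm (Fin q),
      ((Equiv.Perm.sign στ.1 : ℝ) * a (x ∘ στ.1)) * ((Equiv.Perm.sign στ.2 : ℝ) * b (e ∘ στ.2)) =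
      altSum a x * altSum b e := by
    rw [Fintype.sum_prod_type]
    exact (Finset.sum_mul_sum Finset.univ Finset.univ
      (fun σ : Equiv.Perm (Fin p) => (Equiv.Perm.sign σ : ℝ) * a (x ∘ σ))
      (fun σ : Equiv.Perm (Fin q) => (Equiv.Perm.sign σ : ℝ) * b (e ∘ σ))).symm
  rw [key, key', altSum_alternating, altSum_alternating]
  have h3 : (p.factorial : ℝ) ≠ 0 := by positivity
  have h4 : (q.factorial : ℝ) ≠ 0 := by positivity
  field_simp

end WedgeAlt

/-! ### The Leibniz rule for the exterior derivative -/

section Uncurry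

/-- The inner permutations are those of `Fin (n + 1)` which fix `0`. -/
theorem altSum_altSum_succ {T : Type*} {n : ℕ} (G : T → (Fin n → T) → ℝ) (v : Fin (n + 1) → T) :
    altSum (fun w : Fin (n + 1) → T => altSum (G (w 0)) (w ∘ Fin.succ)) v =
      n.factorial * altSum (fun w : Fin (n + 1) → T => G (w 0) (w ∘ Fin.succ)) v := by
  have h := altSum_average (fun π : Equiv.Perm (Fin n) => Equiv.Perm.decomposeFin.symm (0, π))
    (fun w : Fin (n + 1) → T => G (w 0) (w ∘ Fin.succ)) v
  rw [Fintype.card_perm, Fintype.card_fin] at h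
  rw [← h]
  congr 1
  funext w
  refine Finset.sum_congr rfl fun π _ => ?_
  rw [Equiv.Perm.decomposeFin.symm_sign, if_pos rfl, one_mul]
  congr 2

variable {E : Type*} [NormedAddCommGroup E] [NormedSpace ℝ E] {p q n : ℕ}

/-- The `i`-th term of `alternatizeUncurryFin` is the basic function composed with a cycle of sign
`(-1)^i`, so all `p + 1` terms have the same alternating sum. An alternating form reproduces itself
with factor `(p + 1)!`, which leaves `p!`. -/
theorem altSum_uncurry (A : E →L[ℝ] E [⋀^Fin p]→L[ℝ] ℝ) (v : Fin (p + 1) → E) :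
    altSum (fun w : Fin (p + 1) → E => A (w 0) (w ∘ Fin.succ)) v =
      p.factorial * ContinuousAlternatingMap.alternatizeUncurryFin A v := by
  have h := altSum_alternating (ContinuousAlternatingMap.alternatizeUncurryFin A) v
  have e : (ContinuousAlternatingMap.alternatizeUncurryFin A : (Fin (p + 1) → E) → ℝ) =
      fun w => ∑ i : Fin (p + 1), (-1 : ℝ) ^ (i : ℕ) * (fun w : Fin (p + 1) → E =>
        (fun w : Fin (p + 1) → E => A (w 0) (w ∘ Fin.succ)) (w ∘ i.cycleRange.symm)) w := by
    funext w
    rw [ContinuousAlternatingMap.alternatizeUncurryFin_apply]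
    refine Finset.sum_congr rfl fun i _ => ?_
    rw [zsmul_eq_mul]
    push_cast
    congr 2
    · simp
    · funext j
      simp [Fin.removeNth_apply]
  rw [e, altSum_sum, ← e] at h
  have h' : ∀ i : Fin (p + 1), altSum (fun w : Fin (p + 1) → E => (-1 : ℝ) ^ (i : ℕ) *
      (fun w : Fin (p + 1) → E =>
        (fun w : Fin (p + 1) → E => A (w 0) (w ∘ Fin.succ)) (w ∘ i.cycleRange.symm)) w) v =
      altSum (fun w : Fin (p + 1) → E => A (w 0) (w ∘ Fin.succ)) v := by
    intro i
    rw [altSum_smul, altSum_comp_perm i.cycleRange.symm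
      (fun w : Fin (p + 1) → E => A (w 0) (w ∘ Fin.succ)), Equiv.Perm.sign_symm,
      Fin.sign_cycleRange, ← mul_assoc]
    push_cast
    rw [← mul_pow]
    simp
  rw [Finset.sum_congr rfl fun i _ => h' i] at h
  simp only [Finset.sum_const, Finset.card_univ, Fintype.card_fin, nsmul_eq_mul,
    Nat.factorial_succ] at h
  push_cast at h
  have h0 : (p : ℝ) + 1 ≠ 0 := by positivity
  rw [mul_assoc] at h
  exact mul_left_cancel₀ h0 h

/-- This is the part of the Leibniz rule in which the first factor is differentiated. The constant
`c` and the reindexing in `hB` allow it to be used for the second factor as well, once that factor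
has been moved to the front. -/
theorem alternatizeUncurryFin_wedgeAlt (A : E →L[ℝ] E [⋀^Fin p]→L[ℝ] ℝ) (b : E [⋀^Fin q]→L[ℝ] ℝ)
    (B : E →L[ℝ] E [⋀^Fin n]→L[ℝ] ℝ) (c : ℝ) (hn : n = p + q) (hn' : p + 1 + q = n + 1)
    (hB : ∀ x w, B x w = c * wedgeAlt p q (A x) b (w ∘ finCongr hn.symm)) (v : Fin (n + 1) → E) :
    ContinuousAlternatingMap.alternatizeUncurryFin B v =
      c * wedgeAlt (p + 1) q (ContinuousAlternatingMap.alternatizeUncurryFin A) b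
        (v ∘ finCongr hn') := by
  subst hn
  have h0 : ((p + q).factorial : ℝ) ≠ 0 := by positivity
  have h3 : (p.factorial : ℝ) ≠ 0 := by positivity
  have h4 : (q.factorial : ℝ) ≠ 0 := by positivity
  have h5 : ((p + 1).factorial : ℝ) ≠ 0 := by positivity
  refine mul_left_cancel₀ h0 ?_
  rw [← altSum_uncurry]
  have e1 : (fun w : Fin (p + q + 1) → E => B (w 0) (w ∘ Fin.succ)) = fun w =>
      (c * ((p.factorial : ℝ) * q.factorial)⁻¹) *
        altSum (tens (A (w 0)) b) (w ∘ Fin.succ) := by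
    funext w
    rw [hB, wedgeAlt_eq_altSum, mul_assoc]
    rfl
  have e2 : tens (ContinuousAlternatingMap.alternatizeUncurryFin A) b = fun w =>
      (p.factorial : ℝ)⁻¹ *
        tens (altSum (fun w : Fin (p + 1) → E => A (w 0) (w ∘ Fin.succ))) b w := by
    funext w
    simp only [tens, altSum_uncurry]
    field_simp
  have e3 : (fun w : Fin (p + q + 1) → E => tens (A (w 0)) b (w ∘ Fin.succ)) = fun w =>
      tens (fun w : Fin (p + 1) → E => A (w 0) (w ∘ Fin.succ)) b (w ∘ finCongr hn') := by
    funext w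
    simp only [tens]
    refine congrArg₂ _ (congrArg₂ (fun x y => A x y) ?_ ?_) (congrArg b ?_)
    · exact congrArg w (by ext; simp)
    · funext i; exact congrArg w (by ext; simp)
    · funext i; exact congrArg w (by ext; simp; omega)
  rw [e1, altSum_smul, altSum_altSum_succ (fun x => tens (A x) b), wedgeAlt_eq_altSum, e2,
    altSum_smul, altSum_tens_altSum_left, ← altSum_reindex, ← e3]
  field_simp

variable [FiniteDimensional ℝ E]

theorem extDeriv_wedgeAlt {a : E → E [⋀^Fin p]→L[ℝ] ℝ} {b : E → E [⋀^Fin q]→L[ℝ] ℝ} {x : E}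
    (ha : DifferentiableAt ℝ a x) (hb : DifferentiableAt ℝ b x) (h : p + 1 + q = p + q + 1)
    (v : Fin (p + q + 1) → E) :
    extDeriv (fun y => wedgeAlt p q (a y) (b y)) x v =
      wedgeAlt (p + 1) q (extDeriv a x) (b x) (v ∘ finCongr h) +
        (-1) ^ p * wedgeAlt p (q + 1) (a x) (extDeriv b x) v := by
  have := finiteDimensional_alt (E := E) p
  have := finiteDimensional_alt (E := E) q
  let W := (wedgeAlt (T := E) p q).toContinuousBilinearMap
  have hW : HasFDerivAt (fun y => wedgeAlt p q (a y) (b y)) _ x :=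
    W.hasFDerivAt_of_bilinear ha.hasFDerivAt hb.hasFDerivAt
  rw [extDeriv, hW.fderiv, ContinuousAlternatingMap.alternatizeUncurryFin_add,
    ContinuousAlternatingMap.add_apply, add_comm]
  congr 1
  · rw [alternatizeUncurryFin_wedgeAlt (fderiv ℝ a x) (b x) _ 1 rfl h, one_mul]
    · rfl
    · intro y w
      rw [one_mul]
      rfl
  -- The derivative of `b` is moved to the front with sign `(-1)^(p q)`, and afterwards back with
  -- sign `(-1)^(p (q + 1))`; together they give `(-1)^p`.
  · rw [alternatizeUncurryFin_wedgeAlt (fderiv ℝ b x) (a x) _ ((-1) ^ (p * q)) (add_comm p q)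
      (by omega)]
    · change _ * wedgeAlt (q + 1) p (extDeriv b x) _ _ = _
      rw [wedgeAlt_comm (a x), ← mul_assoc, ← pow_add]
      congr 1
      rw [← mul_add, pow_mul]
      have : Odd (q + (q + 1)) := ⟨q, by ring⟩
      rw [← pow_mul, mul_comm, pow_mul, this.neg_one_pow]
    · intro y w
      change wedgeAlt p q (a x) (fderiv ℝ b x y) w = _
      rw [wedgeAlt_comm, mul_comm q p]

end Uncurry

namespace Form

variable {M : Man.{u}} {p q r : ℕ}

theorem ext_inChart {a b : Form M r} (h : ∀ (x₀ : M.carrier), ∀ y ∈ (chartAt M.model x₀).target,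
    inChart a.1 x₀ y = inChart b.1 x₀ y) : a = b :=
  Subtype.ext (formField_ext h)

theorem d_d (a : Form M r) : d (r + 1) (d r a) = 0 := by
  refine ext_inChart fun x₀ y hy => ?_
  change inChart (extDerivField (extDerivField a.1)) x₀ y = 0
  rw [inChart_extDerivField a.2.extDeriv x₀ hy]
  have h : inChart (extDerivField a.1) x₀ =ᶠ[nhds y] extDeriv (inChart a.1 x₀) := by
    filter_upwards [(chartAt M.model x₀).open_target.mem_nhds hy] with z hz
    exact inChart_extDerivField a.2 x₀ hz
  rw [h.extDeriv_eq]
  exact extDeriv_extDeriv_apply (a.2.contDiffAt x₀ hy) (by simpa using ENat.LEInfty.out)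

/-- The exterior derivative is an antiderivation, stated on tuples of tangent vectors. -/
theorem d_wedge_apply (a : Form M p) (b : Form M q) (h : p + 1 + q = p + q + 1) (x : M.carrier)
    (v : Fin (p + q + 1) → Tan M x) :
    (d (p + q) (wedge p q a b)).1 x v =
      (wedge (p + 1) q (d p a) b).1 x (v ∘ finCongr h) +
        (-1) ^ p * (wedge p (q + 1) a (d q b)).1 x v := by
  have hx := mem_chart_source M.model x
  have hy := (chartAt M.model x).map_source hx
  have e : inChart (wedge p q a b).1 x = fun y =>
      wedgeAlt p q (inChart a.1 x y) (inChart b.1 x y) :=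
    funext fun y => wedgeAlt_comp _ _ _
  have h1 := extDeriv_wedgeAlt ((a.2.contDiffAt x hy).differentiableAt (by simp))
    ((b.2.contDiffAt x hy).differentiableAt (by simp)) h
    (fun i => mfderiv 𝓘(ℝ, M.model) 𝓘(ℝ, M.model) (chartAt M.model x) x (v i))
  rw [← e] at h1
  refine Eq.trans h1 ?_
  have e2 : ∀ {r : ℕ} (c : FormField M r) (w : Fin r → Tan M x), inChart c x (chartAt M.model x x)
    (fun i => mfderiv 𝓘(ℝ, M.model) 𝓘(ℝ, M.model) (chartAt M.model x) x (w i)) = c x w :=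
    fun c w => formField_congr c ((chartAt M.model x).left_inv hx) _ _
      fun i => mfderiv_symm_comp x hx (w i)
  rw [← inChart_extDerivField a.2 x hy, ← inChart_extDerivField b.2 x hy]
  refine congrArg₂ _ ?_ (congrArg _ ?_)
  · have := e2 (wedge (p + 1) q (d p a) b).1 (v ∘ finCongr h)
    rw [← this]
    exact congrArg (fun c : M.model [⋀^Fin (p + 1 + q)]→L[ℝ] ℝ => c _) (wedgeAlt_comp _ _ _).symm
  · have := e2 (wedge p (q + 1) a (d q b)).1 v
    rw [← this]
    exact congrArg (fun c : M.model [⋀^Fin (p + (q + 1))]→L[ℝ] ℝ => c _) (wedgeAlt_comp _ _ _).symm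

end Form

open CategoryTheory Opposite

/-! ### The graded algebra of forms on a manifold -/

namespace Form

variable {M : Man.{u}} {N : Man.{v}} {p q r : ℕ}

scoped instance instAddCommMonoid : AddCommMonoid (Form M r) := Submodule.addCommMonoid _

scoped instance instModule : Module ℝ (Form M r) := Submodule.module _

scoped instance instAddCommGroup : AddCommGroup (Form M r) := Submodule.addCommGroup _

theorem apply_ext {a b : Form M r} (h : ∀ x v, a.1 x v = b.1 x v) : a = b :=
  Subtype.ext <| funext fun x => ContinuousAlternatingMap.ext (h x)

/-- Associativity, units and commutativity relate forms whose degrees are equal only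
propositionally. Comparing them on tuples with reindexed arguments avoids transporting forms between
degrees. -/
theorem sigma_ext {n m : ℕ} (h : n = m) {a : Form M n} {b : Form M m}
    (H : ∀ x v, a.1 x v = b.1 x (v ∘ finCongr h.symm)) :
    GradedMonoid.mk (A := fun r => Form M r) n a = GradedMonoid.mk m b := by
  subst h
  exact congrArg _ (apply_ext H)

theorem wedge_assoc_apply (a : Form M p) (b : Form M q) (c : Form M r) (x : M.carrier)
    (v : Fin (p + q + r) → Tan M x) : (wedge (p + q) r (wedge p q a b) c).1 x v =
      (wedge p (q + r) a (wedge q r b c)).1 x (v ∘ finCongr (add_assoc p q r).symm) :=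
  wedgeAlt_assoc (a.1 x) (b.1 x) (c.1 x) v

theorem wedge_comm_apply (a : Form M p) (b : Form M q) (x : M.carrier)
    (v : Fin (q + p) → Tan M x) : (wedge q p b a).1 x v =
      (-1) ^ (p * q) * (wedge p q a b).1 x (v ∘ finCongr (add_comm p q)) :=
  wedgeAlt_comm (a.1 x) (b.1 x) v

theorem one_wedge_apply (a : Form M r) (x : M.carrier) (v : Fin (0 + r) → Tan M x) :
    (wedge 0 r one a).1 x v = a.1 x (v ∘ finCongr (zero_add r).symm) :=
  wedgeAlt_one_left (a.1 x) v

theorem wedge_one (a : Form M r) : wedge r 0 a one = a :=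
  Subtype.ext <| funext fun x => wedgeAlt_one_right (a.1 x)

scoped instance : DirectSum.GNonUnitalNonAssocSemiring (fun r => Form M r) where
  mul a b := wedge _ _ a b
  mul_zero _ := map_zero _
  zero_mul _ := LinearMap.map_zero₂ _ _
  mul_add _ _ _ := map_add _ _ _
  add_mul _ _ _ := LinearMap.map_add₂ _ _ _ _

scoped instance : GradedMonoid.GOne (fun r => Form M r) where
  one := one

scoped instance : GradedMonoid.GMonoid (fun r => Form M r) where
  one_mul := fun ⟨r, a⟩ => sigma_ext (zero_add r) (one_wedge_apply a)
  mul_one := fun ⟨r, a⟩ => congrArg (GradedMonoid.mk r) (wedge_one a)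
  mul_assoc := fun ⟨p, a⟩ ⟨q, b⟩ ⟨r, c⟩ => sigma_ext (add_assoc p q r) (wedge_assoc_apply a b c)

scoped instance : DirectSum.GSemiring (fun r => Form M r) where
  mul_zero _ := map_zero _
  zero_mul _ := LinearMap.map_zero₂ _ _
  mul_add _ _ _ := map_add _ _ _
  add_mul _ _ _ := LinearMap.map_add₂ _ _ _ _
  natCast n := (n : ℝ) • one
  natCast_zero := by simp
  natCast_succ n := by
    rw [Nat.cast_succ, add_smul, one_smul]
    rfl

/-- The wedge product makes the differential forms on a manifold a graded ring. -/
scoped instance : DirectSum.GRing (fun r => Form M r) where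
  intCast n := (n : ℝ) • one
  intCast_ofNat n := by
    rw [Int.cast_natCast]
    rfl
  intCast_negSucc_ofNat n := by
    rw [Int.cast_negSucc]
    exact neg_smul (M := Form M 0) _ _

theorem smul_one_wedge_apply (c : ℝ) (a : Form M r) (x : M.carrier) (v : Fin (0 + r) → Tan M x) :
    (wedge 0 r (c • one) a).1 x v = c * a.1 x (v ∘ finCongr (zero_add r).symm) := by
  have h : wedge 0 r (c • one) a = c • wedge 0 r one a := LinearMap.map_smul₂ _ _ _ _
  rw [h]
  exact congrArg (c * ·) (one_wedge_apply a x v)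

theorem wedge_smul_one (c : ℝ) (a : Form M r) : wedge r 0 a (c • one) = c • a := by
  rw [map_smul, wedge_one]

scoped instance : DirectSum.GAlgebra ℝ (fun r => Form M r) where
  toFun := (LinearMap.toSpanSingleton ℝ (Form M 0) one).toAddMonoidHom
  map_one := one_smul ℝ (one : Form M 0)
  map_mul r s := congrArg (GradedMonoid.mk 0) <|
    (by rw [wedge_smul_one, smul_smul, mul_comm] :
      (r * s) • (one : Form M 0) = wedge 0 0 (r • one) (s • one))
  commutes c := fun ⟨r, a⟩ => sigma_ext (zero_add r) fun x v =>
    (smul_one_wedge_apply c a x v).trans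
      (congrArg (fun b : Form M r => b.1 x (v ∘ finCongr (zero_add r).symm))
        (wedge_smul_one c a)).symm
  smul_def c := fun ⟨r, a⟩ => Eq.symm (sigma_ext (zero_add r) (smul_one_wedge_apply c a))

end Form

open scoped Form

/-- The algebra `Ω^•(M)` of differential forms on a manifold. -/
def Forms (M : Man.{u}) : Type u := ⨁ r : ℕ, Form M r

/-- The ring structure of `Ω^•(M)`. -/
def Forms.ring (M : Man.{u}) : Ring (Forms M) := DirectSum.ring (fun r => Form M r)

scoped instance (M : Man.{u}) : Ring (Forms M) := Forms.ring M

/-- The algebra structure of `Ω^•(M)`. -/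
def Forms.algebra (M : Man.{u}) : Algebra ℝ (Forms M) :=
  DirectSum.instAlgebra ℝ (fun r => Form M r)

scoped instance (M : Man.{u}) : Algebra ℝ (Forms M) := Forms.algebra M

namespace Forms

variable {M : Man.{u}} {N : Man.{v}} {p q r : ℕ}

/-- The inclusion of `Ω^r(M)` into `Ω^•(M)`. -/
def incl (r : ℕ) : Form M r →ₗ[ℝ] Forms M := DirectSum.lof ℝ ℕ (fun r => Form M r) r

theorem incl_mul_incl (a : Form M p) (b : Form M q) :
    incl p a * incl q b = incl (p + q) (Form.wedge p q a b) :=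
  DirectSum.of_mul_of (A := fun r => Form M r) a b

/-- The linear map with given restrictions to the homogeneous components. -/
def lift {A : Type*} [AddCommMonoid A] [Module ℝ A] (φ : ∀ r, Form M r →ₗ[ℝ] A) :
    Forms M →ₗ[ℝ] A :=
  DirectSum.toModule (M := fun r => Form M r) ℝ ℕ A φ

theorem lift_incl {A : Type*} [AddCommMonoid A] [Module ℝ A] (φ : ∀ r, Form M r →ₗ[ℝ] A)
    (a : Form M r) : lift φ (incl r a) = φ r a :=
  DirectSum.toModule_lof (M := fun r => Form M r) (φ := φ) ℝ r a

/-- The pullback `f^* : Ω^•(N) → Ω^•(M)`. -/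
def pullback (f : SmoothMap M N) : Forms N →ₐ[ℝ] Forms M :=
  DirectSum.toAlgebra (B := Forms M) ℝ (fun r => Form N r) (fun r => (incl r).comp (Form.pullback f))
    (by rfl) fun a b => by
      exact (congrArg (incl _) (Form.pullback_wedge f a b)).trans
        (incl_mul_incl (Form.pullback f a) (Form.pullback f b)).symm

theorem pullback_incl (f : SmoothMap M N) (a : Form N r) :
    pullback f (incl r a) = incl r (Form.pullback f a) :=
  DirectSum.toModule_lof (M := fun r => Form N r) (φ := fun r => (incl r).comp (Form.pullback f))
    ℝ r a

theorem incl_mul_comm (a : Form M p) (b : Form M q) :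
    incl q b * incl p a = (-1 : ℝ) ^ (p * q) • (incl p a * incl q b) := by
  rw [incl_mul_incl, incl_mul_incl, ← map_smul]
  exact DirectSum.of_eq_of_gradedMonoid_eq (A := fun r => Form M r)
    (Form.sigma_ext (a := Form.wedge q p b a) (b := (-1 : ℝ) ^ (p * q) • Form.wedge p q a b)
      (add_comm q p) (Form.wedge_comm_apply a b))

/-- The component of degree `r`. -/
def component (r : ℕ) : Forms M →ₗ[ℝ] Form M r := DirectSum.component ℝ ℕ (fun r => Form M r) r

theorem component_incl (a : Form M r) : component r (incl r a) = a :=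
  DirectSum.of_eq_same (β := fun r => Form M r) r a

theorem component_incl_of_ne (h : p ≠ r) (a : Form M p) : component r (incl p a) = 0 :=
  DirectSum.of_eq_of_ne (β := fun r => Form M r) _ _ _ h.symm

theorem induction {P : Forms M → Prop} (h : ∀ r (a : Form M r), P (incl r a))
    (hadd : ∀ x y, P x → P y → P (x + y)) (x : Forms M) : P x := by
  exact DirectSum.induction_on (β := fun r => Form M r) (motive := P) x
    (by have := h 0 0; rwa [map_zero] at this) h hadd

end Forms

/-! ### The graded algebra of forms on a presheaf -/

namespace FormOn

variable {F : Presheaf.{u, w}} {p q r : ℕ}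

scoped instance instAddCommMonoid : AddCommMonoid (FormOn F r) :=
  Submodule.addCommMonoid (R := ℝ) (M := ∀ M : Man.{u}, F.obj (op M) → Form M r) (FormOn F r)

scoped instance instModule : Module ℝ (FormOn F r) :=
  Submodule.module (R := ℝ) (M := ∀ M : Man.{u}, F.obj (op M) → Form M r) (FormOn F r)

scoped instance instAddCommGroup : AddCommGroup (FormOn F r) :=
  Submodule.addCommGroup (R := ℝ) (M := ∀ M : Man.{u}, F.obj (op M) → Form M r) (FormOn F r)

theorem apply_ext {τ σ : FormOn F r}
    (h : ∀ (M : Man.{u}) (s : F.obj (op M)), τ.1 M s = σ.1 M s) : τ = σ :=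
  Subtype.ext <| by ext1 M; ext1 s; exact h M s

theorem sigma_ext {n m : ℕ} (h : n = m) {τ : FormOn F n} {σ : FormOn F m}
    (H : ∀ (M : Man.{u}) (s : F.obj (op M)) x v,
      (τ.1 M s).1 x v = (σ.1 M s).1 x (v ∘ finCongr h.symm)) :
    GradedMonoid.mk (A := fun r => FormOn F r) n τ = GradedMonoid.mk m σ := by
  subst h
  exact congrArg _ (apply_ext fun M s => Form.apply_ext (H M s))

/-- The constant function `1`, as a `0`-form on a presheaf. -/
def one : FormOn F 0 := GradedMonoid.GOne.one (A := fun r => FormOn F r)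

scoped instance : GradedMonoid.GMonoid (fun r => FormOn F r) where
  one_mul := fun ⟨r, τ⟩ => sigma_ext (zero_add r) fun M s => Form.one_wedge_apply (τ.1 M s)
  mul_one := fun ⟨r, τ⟩ => congrArg (GradedMonoid.mk r) <|
    apply_ext fun M s => Form.wedge_one (τ.1 M s)
  mul_assoc := fun ⟨p, a⟩ ⟨q, b⟩ ⟨r, c⟩ => sigma_ext (add_assoc p q r) fun M s =>
    Form.wedge_assoc_apply (a.1 M s) (b.1 M s) (c.1 M s)

scoped instance : DirectSum.GSemiring (fun r => FormOn F r) where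
  mul_zero := DirectSum.GNonUnitalNonAssocSemiring.mul_zero (A := fun r => FormOn F r)
  zero_mul := DirectSum.GNonUnitalNonAssocSemiring.zero_mul (A := fun r => FormOn F r)
  mul_add := DirectSum.GNonUnitalNonAssocSemiring.mul_add (A := fun r => FormOn F r)
  add_mul := DirectSum.GNonUnitalNonAssocSemiring.add_mul (A := fun r => FormOn F r)
  natCast n := (n : ℝ) • one
  natCast_zero := by rw [Nat.cast_zero, zero_smul]
  natCast_succ n := by
    rw [Nat.cast_succ, add_smul, one_smul]
    rfl

/-- The wedge product makes the differential forms on a presheaf a graded ring. -/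
scoped instance : DirectSum.GRing (fun r => FormOn F r) where
  intCast n := (n : ℝ) • one
  intCast_ofNat n := by
    rw [Int.cast_natCast]
    rfl
  intCast_negSucc_ofNat n := by
    rw [Int.cast_negSucc]
    exact neg_smul (M := FormOn F 0) _ _

scoped instance : DirectSum.GAlgebra ℝ (fun r => FormOn F r) where
  toFun := (LinearMap.toSpanSingleton ℝ (FormOn F 0) one).toAddMonoidHom
  map_one := one_smul ℝ (one : FormOn F 0)
  map_mul r s := congrArg (GradedMonoid.mk 0) <| apply_ext fun M y =>
    (by rw [Form.wedge_smul_one, smul_smul, mul_comm] :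
      (r * s) • (Form.one : Form M 0) = Form.wedge 0 0 (r • Form.one) (s • Form.one))
  commutes c := fun ⟨r, a⟩ => sigma_ext (zero_add r) fun M s x v =>
    (Form.smul_one_wedge_apply c (a.1 M s) x v).trans
      (congrArg (fun b : Form M r => b.1 x (v ∘ finCongr (zero_add r).symm))
        (Form.wedge_smul_one c (a.1 M s))).symm
  smul_def c := fun ⟨r, a⟩ => Eq.symm (sigma_ext (zero_add r) fun M s =>
    Form.smul_one_wedge_apply c (a.1 M s))

/-- Evaluation of forms on a presheaf at a section. -/
def eval (M : Man.{u}) (s : F.obj (op M)) (r : ℕ) : FormOn F r →ₗ[ℝ] Form M r where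
  toFun τ := τ.1 M s
  map_add' _ _ := rfl
  map_smul' _ _ := rfl

theorem d_d (τ : FormOn F r) : d (r + 1) (d r τ) = 0 :=
  apply_ext fun M s => Form.d_d (τ.1 M s)

end FormOn

open scoped FormOn

/-- The de Rham complex of a presheaf, as an algebra. -/
def DeRhamAlg (F : Presheaf.{u, w}) : Type max (u + 1) w := DeRham F

/-- The ring structure of the de Rham algebra. -/
def DeRhamAlg.ring (F : Presheaf.{u, w}) : Ring (DeRhamAlg F) :=
  DirectSum.ring (fun r => FormOn F r)

scoped instance (F : Presheaf.{u, w}) : Ring (DeRhamAlg F) := DeRhamAlg.ring F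

/-- The algebra structure of the de Rham algebra. -/
def DeRhamAlg.algebra (F : Presheaf.{u, w}) : Algebra ℝ (DeRhamAlg F) :=
  DirectSum.instAlgebra ℝ (fun r => FormOn F r)

scoped instance (F : Presheaf.{u, w}) : Algebra ℝ (DeRhamAlg F) := DeRhamAlg.algebra F

namespace DeRhamAlg

variable {F : Presheaf.{u, w}} {p q r : ℕ}

variable (F) in
/-- The identification of the de Rham complex with the de Rham algebra. -/
def ofDeRham : DeRham F ≃ₗ[ℝ] DeRhamAlg F where
  toFun x := x
  invFun x := x
  left_inv _ := rfl
  right_inv _ := rfl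
  map_add' _ _ := rfl
  map_smul' _ _ := rfl

variable (F) in
/-- The inclusion of `Ω^r(F)` into the de Rham algebra. -/
def incl (r : ℕ) : FormOn F r →ₗ[ℝ] DeRhamAlg F :=
  (ofDeRham F).toLinearMap ∘ₗ DeRham.incl F r

theorem incl_mul_incl (a : FormOn F p) (b : FormOn F q) :
    incl F p a * incl F q b = incl F (p + q) (FormOn.wedge a b) :=
  DirectSum.of_mul_of (A := fun r => FormOn F r) a b

/-- The component of degree `r`. -/
def component (r : ℕ) : DeRhamAlg F →ₗ[ℝ] FormOn F r :=
  DirectSum.component ℝ ℕ (fun r => FormOn F r) r ∘ₗ (ofDeRham F).symm.toLinearMap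

theorem component_incl (a : FormOn F r) : component r (incl F r a) = a :=
  DirectSum.of_eq_same (β := fun r => FormOn F r) r a

theorem component_incl_of_ne (h : p ≠ r) (a : FormOn F p) : component r (incl F p a) = 0 :=
  DirectSum.of_eq_of_ne (β := fun r => FormOn F r) _ _ _ h.symm

theorem induction {P : DeRhamAlg F → Prop} (h : ∀ r (a : FormOn F r), P (incl F r a))
    (hadd : ∀ x y, P x → P y → P (x + y)) (x : DeRhamAlg F) : P x :=
  DirectSum.induction_on (β := fun r => FormOn F r) (motive := P) x
    (by have := h 0 0; rwa [map_zero] at this) h hadd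

/-- The linear map with given restrictions to the homogeneous components. -/
def lift {A : Type*} [AddCommMonoid A] [Module ℝ A] (φ : ∀ r, FormOn F r →ₗ[ℝ] A) :
    DeRhamAlg F →ₗ[ℝ] A :=
  DirectSum.toModule (M := fun r => FormOn F r) ℝ ℕ A φ

theorem lift_incl {A : Type*} [AddCommMonoid A] [Module ℝ A] (φ : ∀ r, FormOn F r →ₗ[ℝ] A)
    (a : FormOn F r) : lift φ (incl F r a) = φ r a :=
  DirectSum.toModule_lof (M := fun r => FormOn F r) (φ := φ) ℝ r a

/-- Evaluation of forms on a presheaf at a section, as a homomorphism of algebras. -/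
def eval (M : Man.{u}) (s : F.obj (op M)) : DeRhamAlg F →ₐ[ℝ] Forms M :=
  DirectSum.toAlgebra (B := Forms M) ℝ (fun r => FormOn F r)
    (fun r => (Forms.incl r).comp (FormOn.eval M s r))
    (by rfl) fun a b => by exact (Forms.incl_mul_incl (a.1 M s) (b.1 M s)).symm

theorem eval_incl (M : Man.{u}) (s : F.obj (op M)) (τ : FormOn F r) :
    eval M s (incl F r τ) = Forms.incl r (τ.1 M s) :=
  DirectSum.toModule_lof (M := fun r => FormOn F r)
    (φ := fun r => (Forms.incl r).comp (FormOn.eval M s r)) ℝ r τ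

theorem eval_map {M N : Man.{u}} (f : M ⟶ N) (s : F.obj (op N)) (τ : DeRhamAlg F) :
    eval M (F.map f.op s) τ = Forms.pullback f (eval N s τ) := by
  induction τ using induction with
  | h r τ => rw [eval_incl, eval_incl, Forms.pullback_incl, τ.2 M N f s]
  | hadd x y hx hy => rw [map_add, map_add, map_add, hx, hy]

theorem component_eval (M : Man.{u}) (s : F.obj (op M)) (τ : DeRhamAlg F) (r : ℕ) :
    Forms.component r (eval M s τ) = (component r τ).1 M s := by
  induction τ using induction with
  | h n τ =>
    rw [eval_incl]
    by_cases h : n = r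
    · subst h
      rw [component_incl, Forms.component_incl]
    · rw [component_incl_of_ne h, Forms.component_incl_of_ne h]
      rfl
  | hadd x y hx hy =>
    rw [map_add, map_add, map_add, hx, hy]
    rfl

theorem component_ext {τ σ : DeRhamAlg F} (h : ∀ r, component r τ = component r σ) : τ = σ :=
  DFinsupp.ext (β := fun r => FormOn F r) h

/-- This reduces identities in the de Rham algebra of a presheaf to identities in the algebras
`Forms M`. -/
theorem eval_ext {τ σ : DeRhamAlg F}
    (h : ∀ (M : Man.{u}) (s : F.obj (op M)), eval M s τ = eval M s σ) : τ = σ := by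
  refine component_ext fun r => FormOn.apply_ext fun M s => ?_
  rw [← component_eval, ← component_eval, h]

theorem incl_mul_comm (a : FormOn F p) (b : FormOn F q) :
    incl F q b * incl F p a = (-1 : ℝ) ^ (p * q) • (incl F p a * incl F q b) :=
  eval_ext fun M s => by
    rw [map_mul, map_smul, map_mul, eval_incl, eval_incl, Forms.incl_mul_comm]

variable (F) in
/-- The exterior derivative. -/
def d : DeRhamAlg F →ₗ[ℝ] DeRhamAlg F :=
  (ofDeRham F).toLinearMap ∘ₗ DeRham.d F ∘ₗ (ofDeRham F).symm.toLinearMap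

theorem d_incl (τ : FormOn F r) : d F (incl F r τ) = incl F (r + 1) (FormOn.d r τ) :=
  congrArg (ofDeRham F) (DirectSum.toModule_lof (M := fun r => FormOn F r)
    (φ := fun r => (DeRham.incl F (r + 1)).comp (FormOn.d r)) ℝ r τ)

theorem d_d (τ : DeRhamAlg F) : d F (d F τ) = 0 := by
  induction τ using induction with
  | h r τ => rw [d_incl, d_incl, FormOn.d_d, map_zero]
  | hadd x y hx hy => rw [map_add, map_add, hx, hy, add_zero]

theorem exists_incl_eq {n m : ℕ} (h : n = m) (τ : FormOn F n) :
    ∃ σ : FormOn F m, incl F n τ = incl F m σ ∧ ∀ (M : Man.{u}) (s : F.obj (op M)) x v,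
      (σ.1 M s).1 x v = (τ.1 M s).1 x (v ∘ finCongr h) := by
  subst h
  exact ⟨τ, rfl, fun _ _ _ _ => rfl⟩

/-- The pointwise rule `Form.d_wedge_apply` involves forms of degrees `p + 1 + q`, `p + (q + 1)` and
`p + q + 1`; `exists_incl_eq` provides representatives of the first two in the last degree. -/
theorem d_incl_mul (a : FormOn F p) (y : DeRhamAlg F) :
    d F (incl F p a * y) = d F (incl F p a) * y + (-1 : ℝ) ^ p • (incl F p a * d F y) := by
  induction y using induction with
  | h q b =>
    have h : p + 1 + q = p + q + 1 := by omega
    obtain ⟨σ, hσ, hσ'⟩ := exists_incl_eq h (FormOn.wedge (FormOn.d p a) b)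
    obtain ⟨ρ, hρ, hρ'⟩ := exists_incl_eq (add_assoc p q 1).symm (FormOn.wedge a (FormOn.d q b))
    have e : FormOn.d (p + q) (FormOn.wedge a b) = σ + (-1 : ℝ) ^ p • ρ := by
      refine FormOn.apply_ext fun M s => Form.apply_ext fun x v => ?_
      refine (Form.d_wedge_apply (a.1 M s) (b.1 M s) h x v).trans ?_
      exact congrArg₂ (fun x y => x + (-1) ^ p * y) (hσ' M s x v).symm (hρ' M s x v).symm
    have h1 : d F (incl F p a * incl F q b) =
        incl F (p + q + 1) (FormOn.d (p + q) (FormOn.wedge a b)) :=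
      (congrArg (d F) (incl_mul_incl a b)).trans (d_incl _)
    have h2 : d F (incl F p a) * incl F q b = incl F (p + q + 1) σ := by
      rw [d_incl, incl_mul_incl, hσ]
    have h3 : incl F p a * d F (incl F q b) = incl F (p + q + 1) ρ := by
      rw [d_incl, incl_mul_incl, hρ]
    rw [h1, h2, h3, e]
    exact ((incl F (p + q + 1)).map_add _ _).trans
      (congrArg _ ((incl F (p + q + 1)).map_smul _ _))
  | hadd x y hx hy =>
    rw [mul_add, map_add, hx, hy, map_add, mul_add, mul_add, smul_add]
    exact add_add_add_comm _ _ _ _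

end DeRhamAlg

/-! ### Products of a manifold with a vector space -/

section ProductModel

variable {E F : Type*} [NormedAddCommGroup E] [NormedSpace ℝ E] [NormedAddCommGroup F]
  [NormedSpace ℝ F] {M : Type*} [TopologicalSpace M] [ChartedSpace E M]

/-- The product charted space structure on `M × F` for a normed space `F`. -/
@[reducible] def prodChartedSpaceSelf : ChartedSpace (E × F) (M × F) := prodChartedSpace E M F F

attribute [instance 50] prodChartedSpaceSelf

/-- The identity model with corners of `E × F` is the product of the identity models, so the facts
about product manifolds carry over to the normed model space `E × F`. -/
theorem isManifold_prod_self [IsManifold 𝓘(ℝ, E) ∞ M] : IsManifold 𝓘(ℝ, E × F) ∞ (M × F) := by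
  rw [modelWithCornersSelf_prod]
  exact IsManifold.prod M F

theorem contMDiff_prodMk_self {G : Type*} [NormedAddCommGroup G] [NormedSpace ℝ G] {N : Type*}
    [TopologicalSpace N] [ChartedSpace G N] {f : N → M} {g : N → F}
    (hf : ContMDiff 𝓘(ℝ, G) 𝓘(ℝ, E) ∞ f) (hg : ContMDiff 𝓘(ℝ, G) 𝓘(ℝ, F) ∞ g) :
    ContMDiff 𝓘(ℝ, G) 𝓘(ℝ, E × F) ∞ fun x => (f x, g x) := by
  rw [modelWithCornersSelf_prod]
  exact hf.prodMk hg

theorem contMDiff_fst_self :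
    ContMDiff 𝓘(ℝ, E × F) 𝓘(ℝ, E) ∞ (Prod.fst : M × F → M) := by
  rw [modelWithCornersSelf_prod]
  exact contMDiff_fst

theorem contMDiff_snd_self :
    ContMDiff 𝓘(ℝ, E × F) 𝓘(ℝ, F) ∞ (Prod.snd : M × F → F) := by
  rw [modelWithCornersSelf_prod]
  exact contMDiff_snd

theorem mfderiv_fst_self (x : M × F) (v : E × F) :
    (mfderiv 𝓘(ℝ, E × F) 𝓘(ℝ, E) (Prod.fst : M × F → M) x v : E) = v.1 := by
  -- The model with corners is made a variable, so that the two equal models can be identified by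
  -- substitution, although the type of the derivative depends on them.
  have key : ∀ I : ModelWithCorners ℝ (E × F) (E × F), I = 𝓘(ℝ, E).prod 𝓘(ℝ, F) →
      (mfderiv I 𝓘(ℝ, E) (Prod.fst : M × F → M) x v : E) = v.1 := by
    rintro I rfl
    exact congrArg (fun L : E × F →L[ℝ] E => L v) (mfderiv_fst (I := 𝓘(ℝ, E)) (I' := 𝓘(ℝ, F)))
  exact key _ modelWithCornersSelf_prod

theorem mfderiv_snd_self (x : M × F) (v : E × F) :
    (mfderiv 𝓘(ℝ, E × F) 𝓘(ℝ, F) (Prod.snd : M × F → F) x v : F) = v.2 := by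
  have key : ∀ I : ModelWithCorners ℝ (E × F) (E × F), I = 𝓘(ℝ, E).prod 𝓘(ℝ, F) →
      (mfderiv I 𝓘(ℝ, F) (Prod.snd : M × F → F) x v : F) = v.2 := by
    rintro I rfl
    exact congrArg (fun L : E × F →L[ℝ] F => L v) (mfderiv_snd (I := 𝓘(ℝ, E)) (I' := 𝓘(ℝ, F)))
  exact key _ modelWithCornersSelf_prod

end ProductModel

namespace Man

/-- A finite-dimensional normed space, as a manifold. -/
abbrev ofSpace (E : Type u) [NormedAddCommGroup E] [NormedSpace ℝ E] [FiniteDimensional ℝ E] :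
    Man.{u} where
  carrier := E
  model := E
  t2Space := inferInstance
  secondCountable :=
    have := FiniteDimensional.proper_real E
    inferInstance

/-- The product of a manifold and a finite-dimensional normed space. -/
abbrev prodSpace (M : Man.{u}) (E : Type u) [NormedAddCommGroup E] [NormedSpace ℝ E]
    [FiniteDimensional ℝ E] : Man.{u} where
  carrier := M.carrier × E
  model := M.model × E
  chartedSpace := prodChartedSpaceSelf
  isManifold := isManifold_prod_self (E := M.model) (F := E) (M := M.carrier)
  secondCountable :=
    have := FiniteDimensional.proper_real E
    inferInstance

end Man

namespace SmoothMap

variable {M N : Man.{u}} {L : Man.{v}} {E : Type u} [NormedAddCommGroup E] [NormedSpace ℝ E]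
  [FiniteDimensional ℝ E]

theorem hasMFDerivAt {N : Man.{v}} (f : SmoothMap M N) (x : M.carrier) :
    HasMFDerivAt 𝓘(ℝ, M.model) 𝓘(ℝ, N.model) f x (mfderiv 𝓘(ℝ, M.model) 𝓘(ℝ, N.model) f x) :=
  (f.contMDiff.mdifferentiable (by simp) x).hasMFDerivAt

variable (M E) in
/-- The first projection. -/
def fst : SmoothMap (M.prodSpace E) M := ⟨Prod.fst, contMDiff_fst_self⟩

variable (M E) in
/-- The second projection. -/
def snd : SmoothMap (M.prodSpace E) (Man.ofSpace E) := ⟨Prod.snd, contMDiff_snd_self⟩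

/-- The map to a product with given components. -/
def pair (f : SmoothMap N M) (g : SmoothMap N (Man.ofSpace E)) : SmoothMap N (M.prodSpace E) :=
  ⟨fun x => (f x, g x), contMDiff_prodMk_self f.contMDiff g.contMDiff⟩

/-- The constant map. -/
def const (y : N.carrier) : SmoothMap M N := ContMDiffMap.const y

variable (M) in
/-- The inclusion of the slice `M × {e}`. -/
def slice (e : E) : SmoothMap M (M.prodSpace E) := pair ContMDiffMap.id (const e)

/-- The product of a smooth map with the identity. -/
def prodId (f : SmoothMap N M) (E : Type u) [NormedAddCommGroup E] [NormedSpace ℝ E]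
    [FiniteDimensional ℝ E] : SmoothMap (N.prodSpace E) (M.prodSpace E) :=
  pair (f.comp (fst N E)) (snd N E)

variable (M) in
/-- The product of the identity with a smooth map. -/
def idProd (S : SmoothMap (Man.ofSpace E) (Man.ofSpace E)) :
    SmoothMap (M.prodSpace E) (M.prodSpace E) :=
  pair (fst M E) (S.comp (snd M E))

theorem mfderiv_fst (x : (M.prodSpace E).carrier) (v : M.model × E) :
    (mfderiv 𝓘(ℝ, (M.prodSpace E).model) 𝓘(ℝ, M.model) (fst M E) x v : M.model) = v.1 :=
  mfderiv_fst_self x v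

theorem mfderiv_snd (x : (M.prodSpace E).carrier) (v : M.model × E) :
    (mfderiv 𝓘(ℝ, (M.prodSpace E).model) 𝓘(ℝ, E) (snd M E) x v : E) = v.2 :=
  mfderiv_snd_self x v

theorem mfderiv_comp {L : Man.{u}} (g : SmoothMap M N) (f : SmoothMap L M) (x : L.carrier) (v : L.model) :
    (mfderiv 𝓘(ℝ, L.model) 𝓘(ℝ, N.model) (ContMDiffMap.comp g f) x v : N.model) =
      mfderiv 𝓘(ℝ, M.model) 𝓘(ℝ, N.model) g (f x)
        (mfderiv 𝓘(ℝ, L.model) 𝓘(ℝ, M.model) f x v) :=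
  congrArg (fun T : L.model →L[ℝ] N.model => T v)
    ((hasMFDerivAt g (f x)).comp x (hasMFDerivAt f x)).mfderiv

theorem mfderiv_pair (f : SmoothMap N M) (g : SmoothMap N (Man.ofSpace E)) (x : N.carrier)
    (v : N.model) :
    (mfderiv 𝓘(ℝ, N.model) 𝓘(ℝ, M.model × E) (pair f g) x v : M.model × E) =
      ((mfderiv 𝓘(ℝ, N.model) 𝓘(ℝ, M.model) f x v : M.model),
        (mfderiv 𝓘(ℝ, N.model) 𝓘(ℝ, E) g x v : E)) := by
  have h1 := mfderiv_comp (fst M E) (pair f g) x v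
  have h2 := mfderiv_comp (snd M E) (pair f g) x v
  exact Prod.ext (h1.trans (mfderiv_fst _ _)).symm (h2.trans (mfderiv_snd _ _)).symm

theorem mfderiv_slice (e : E) (x : M.carrier) (v : M.model) :
    (mfderiv 𝓘(ℝ, M.model) 𝓘(ℝ, M.model × E) (slice M e) x v : M.model × E) = (v, 0) := by
  refine (mfderiv_pair _ _ x v).trans (Prod.ext ?_ ?_)
  · exact congrArg (fun T : M.model →L[ℝ] M.model => T v) (mfderiv_id (I := 𝓘(ℝ, M.model)))
  · exact congrArg (fun T : M.model →L[ℝ] E => T v)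
      (mfderiv_const (I := 𝓘(ℝ, M.model)) (I' := 𝓘(ℝ, E)) (c := e))

theorem mfderiv_prodId (f : SmoothMap N M) (x : (N.prodSpace E).carrier) (v : N.model × E) :
    (mfderiv 𝓘(ℝ, N.model × E) 𝓘(ℝ, M.model × E) (prodId f E) x v : M.model × E) =
      ((mfderiv 𝓘(ℝ, N.model) 𝓘(ℝ, M.model) f x.1 v.1 : M.model), v.2) := by
  refine (mfderiv_pair _ _ x v).trans (Prod.ext ?_ (mfderiv_snd x v))
  refine (mfderiv_comp f (fst N E) x v).trans ?_
  exact congrArg (fun w : N.model => (mfderiv 𝓘(ℝ, N.model) 𝓘(ℝ, M.model) f x.1 w : M.model))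
    (mfderiv_fst x v)

theorem mfderiv_idProd (S : SmoothMap (Man.ofSpace E) (Man.ofSpace E))
    (x : (M.prodSpace E).carrier) (v : M.model × E) :
    (mfderiv 𝓘(ℝ, M.model × E) 𝓘(ℝ, M.model × E) (idProd M S) x v : M.model × E) =
      (v.1, (fderiv ℝ S x.2 v.2 : E)) := by
  refine (mfderiv_pair _ _ x v).trans (Prod.ext (mfderiv_fst x v) ?_)
  refine (mfderiv_comp S (snd M E) x v).trans ?_
  refine (congrArg (fun w : E => (mfderiv 𝓘(ℝ, E) 𝓘(ℝ, E) S x.2 w : E))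
    (mfderiv_snd x v)).trans ?_
  exact congrArg (fun T : E →L[ℝ] E => T v.2) mfderiv_eq_fderiv

end SmoothMap

/-! ### Contraction with vertical vector fields -/

namespace Form

variable {M N : Man.{u}} {E : Type u} [NormedAddCommGroup E] [NormedSpace ℝ E]
  [FiniteDimensional ℝ E] {r : ℕ}

/-- A chart of the product is a chart of `M` times the identity of `E`. Constant vertical fields are
therefore constant in coordinates, and contraction with them preserves smoothness
(`inChart_curryLast`). -/
theorem mfderiv_chart_symm_vertical (x₀ : (M.prodSpace E).carrier) {y : M.model × E}
    (hy : y ∈ (chartAt (M.prodSpace E).model x₀).target) (e : E) :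
    (mfderiv 𝓘(ℝ, M.model × E) 𝓘(ℝ, M.model × E) (chartAt (M.prodSpace E).model x₀).symm y (0, e) :
      M.model × E) = (0, e) := by
  have h := (mdiff_chart_symm x₀ hy).hasMFDerivAt
  have hs := mdiff_chart_symm (M := M) x₀.1 (y := y.1) hy.1
  have h1 := (SmoothMap.hasMFDerivAt (SmoothMap.fst M E) _).comp y h
  have h2 := (SmoothMap.hasMFDerivAt (SmoothMap.snd M E) _).comp y h
  have h3 := hs.hasMFDerivAt.comp y
    (hasFDerivAt_fst (𝕜 := ℝ) (E := M.model) (F := E) (p := y)).hasMFDerivAt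
  have h4 := (hasFDerivAt_snd (𝕜 := ℝ) (E := M.model) (F := E) (p := y)).hasMFDerivAt
  have e1 := congrArg (fun T : M.model × E →L[ℝ] M.model => T (0, e)) (hasMFDerivAt_unique h1 h3)
  have e2 := congrArg (fun T : M.model × E →L[ℝ] E => T (0, e)) (hasMFDerivAt_unique h2 h4)
  refine Prod.ext ?_ ?_
  · exact (SmoothMap.mfderiv_fst _ _).symm.trans (e1.trans
      (map_zero (mfderiv 𝓘(ℝ, M.model) 𝓘(ℝ, M.model) (chartAt M.model x₀.1).symm y.1)))
  · exact (SmoothMap.mfderiv_snd _ _).symm.trans e2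

end Form

/-- Insertion of a vector in the last slot of an alternating form. -/
def curryLast {T : Type*} [NormedAddCommGroup T] [NormedSpace ℝ T] (r : ℕ) (e : T) :
    (T [⋀^Fin (r + 1)]→L[ℝ] ℝ) →L[ℝ] T [⋀^Fin r]→L[ℝ] ℝ :=
  (-1 : ℝ) ^ r • (ContinuousLinearMap.apply ℝ (T [⋀^Fin r]→L[ℝ] ℝ) e).comp
    (ContinuousAlternatingMap.curryLeftLI (𝕜 := ℝ) (E := T) (F := ℝ)
      (n := r)).toContinuousLinearMap

theorem map_snoc {T T' : Type*} {r : ℕ} (g : T → T') (v : Fin r → T) {e : T} {e' : T'}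
    (h : g e = e') (i : Fin (r + 1)) : g (Fin.snoc (α := fun _ => T) v e i) =
      Fin.snoc (α := fun _ => T') (fun j => g (v j)) e' i := by
  refine Fin.lastCases ?_ (fun i => ?_) i
  · rw [Fin.snoc_last, Fin.snoc_last, h]
  · rw [Fin.snoc_castSucc, Fin.snoc_castSucc]

/-- The sign `(-1)^r` in the definition is the sign of the rotation which carries the first slot to
the last. -/
theorem curryLast_apply {T : Type*} [NormedAddCommGroup T] [NormedSpace ℝ T] {r : ℕ} (e : T)
    (a : T [⋀^Fin (r + 1)]→L[ℝ] ℝ) (v : Fin r → T) :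
    curryLast r e a v = a (Fin.snoc (α := fun _ => T) v e) := by
  have h := a.map_perm (Fin.cons e v) (finRotate (r + 1))
  rw [Fin.snoc_eq_cons_rotate]
  refine Eq.trans ?_ h.symm
  rw [sign_finRotate, Units.smul_def]
  have hs : ((((-1) ^ r : ℤˣ) : ℤ) : ℝ) = (-1) ^ r := by simp
  change (-1 : ℝ) ^ r * a (Matrix.vecCons e v) = ((((-1) ^ r : ℤˣ) : ℤ)) • a (Fin.cons e v)
  rw [← Int.cast_smul_eq_zsmul ℝ, hs]
  rfl

namespace Form

variable {M N : Man.{u}} {E : Type u} [NormedAddCommGroup E] [NormedSpace ℝ E]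
  [FiniteDimensional ℝ E] {r : ℕ}

theorem inChart_curryLast (a : FormField (M.prodSpace E) (r + 1)) (e : E)
    (x₀ : (M.prodSpace E).carrier) {y : M.model × E}
    (hy : y ∈ (chartAt (M.prodSpace E).model x₀).target) :
    inChart (M := M.prodSpace E) (fun x => curryLast (T := M.model × E) r (0, e) (a x)) x₀ y =
      curryLast (T := M.model × E) r (0, e) (inChart a x₀ y) := by
  ext v
  refine (curryLast_apply (T := M.model × E) _ _ _).trans ?_
  refine Eq.trans ?_ (curryLast_apply (T := M.model × E) _ _ _).symm
  exact formField_congr a rfl _ _ fun i => (map_snoc (T := M.model × E) (T' := M.model × E)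
    (mfderiv 𝓘(ℝ, M.model × E) 𝓘(ℝ, M.model × E) (chartAt (M.prodSpace E).model x₀).symm y) v
    (mfderiv_chart_symm_vertical x₀ hy e) i).symm

/-- Insertion of a constant vector field, tangent to the second factor, in the last slot of a
form on a product. -/
def contr (r : ℕ) (e : E) : Form (M.prodSpace E) (r + 1) →ₗ[ℝ] Form (M.prodSpace E) r where
  toFun a := ⟨fun x => curryLast (T := M.model × E) r (0, e) (a.1 x), fun x₀ =>
    ((curryLast (T := M.model × E) r (0, e)).contDiff.comp_contDiffOn (a.2 x₀)).congr
      fun _ hy => inChart_curryLast a.1 e x₀ hy⟩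
  map_add' a b := Subtype.ext <| funext fun x =>
    map_add (curryLast (T := M.model × E) r (0, e)) (a.1 x) (b.1 x)
  map_smul' c a := Subtype.ext <| funext fun x =>
    map_smul (curryLast (T := M.model × E) r (0, e)) c (a.1 x)

theorem contr_apply (e : E) (a : Form (M.prodSpace E) (r + 1)) (x : (M.prodSpace E).carrier)
    (v : Fin r → M.model × E) : (contr r e a).1 x v =
      a.1 x (Fin.snoc (α := fun _ => M.model × E) v (0, e)) :=
  curryLast_apply _ _ _

/-- The derivative of `f × id` fixes vertical vectors. This is what makes the contractions of forms
on the presheaf natural. -/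
theorem contr_pullback_prodId (f : SmoothMap N M) (e : E) (a : Form (M.prodSpace E) (r + 1)) :
    contr r e (pullback (SmoothMap.prodId f E) a) =
      pullback (SmoothMap.prodId f E) (contr r e a) := by
  refine apply_ext fun x v => ?_
  refine (contr_apply e _ x v).trans (Eq.trans ?_ (contr_apply e a _ _).symm)
  have h : (mfderiv 𝓘(ℝ, N.model × E) 𝓘(ℝ, M.model × E) (SmoothMap.prodId f E) x (0, e) :
      M.model × E) = (0, e) := (SmoothMap.mfderiv_prodId f x (0, e)).trans
    (Prod.ext (map_zero (mfderiv 𝓘(ℝ, N.model) 𝓘(ℝ, M.model) f x.1)) rfl)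
  exact formField_congr a.1 rfl _ _ fun i => map_snoc (T := N.model × E) (T' := M.model × E)
    (mfderiv 𝓘(ℝ, N.model × E) 𝓘(ℝ, M.model × E) (SmoothMap.prodId f E) x) v h i

end Form

/-- Writing each argument as an element of `U` plus a multiple of `e` and expanding, the terms with
`e` in two slots vanish by alternation. Those with `e` in one slot reduce to `h1` by a
transposition, and the one without `e` is `h0`. -/
theorem _root_.AlternatingMap.eq_zero_of_forall_mem_sup {T : Type*} [AddCommGroup T] [Module ℝ T]
    {q : ℕ} (g : T [⋀^Fin (q + 1)]→ₗ[ℝ] ℝ) (U : Submodule ℝ T) (e : T)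
    (h0 : ∀ u : Fin (q + 1) → T, (∀ i, u i ∈ U) → g u = 0)
    (h1 : ∀ u : Fin q → T, (∀ i, u i ∈ U) → g (Fin.snoc (α := fun _ => T) u e) = 0)
    (v : Fin (q + 1) → T) (hv : ∀ i, v i ∈ U ⊔ Submodule.span ℝ {e}) : g v = 0 := by
  have h2 : ∀ u : Fin (q + 1) → T, (∀ i, u i ∈ U) → ∀ j, g (Function.update u j e) = 0 := by
    intro u hu j
    have h := g.map_perm (Function.update u j e) (Equiv.swap j (Fin.last q))
    have h' : Function.update u j e ∘ Equiv.swap j (Fin.last q) = Fin.snoc (α := fun _ => T)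
        (fun i => u (Equiv.swap j (Fin.last q) i.castSucc)) e := by
      funext i
      refine Fin.lastCases ?_ (fun i => ?_) i
      · simp
      · have hi : Equiv.swap j (Fin.last q) i.castSucc ≠ j := fun h =>
          (Fin.castSucc_lt_last i).ne ((Equiv.swap j (Fin.last q)).injective
            (h.trans (Equiv.swap_apply_right j _).symm))
        simp [hi]
    rw [h', h1 _ fun i => hu _] at h
    exact ((smul_eq_zero_iff_eq _).1 h.symm)
  have hv' : ∀ i, ∃ u ∈ U, ∃ c : ℝ, v i = u + c • e := fun i => by
    obtain ⟨u, hu, w, hw, h⟩ := Submodule.mem_sup.1 (hv i)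
    obtain ⟨c, rfl⟩ := Submodule.mem_span_singleton.1 hw
    exact ⟨u, hu, c, h.symm⟩
  choose u hu c hc using hv'
  rw [show v = u + fun i => c i • e from funext hc]
  change g.toMultilinearMap _ = 0
  rw [MultilinearMap.map_add_univ]
  refine Finset.sum_eq_zero fun s _ => ?_
  by_cases hs : ∀ i, i ∈ s
  · exact h0 _ fun i => by simp [Finset.piecewise, hs i, hu i]
  push Not at hs
  obtain ⟨j, hj⟩ := hs
  set w := s.piecewise u fun i => c i • e with hw
  have hwj : w = Function.update w j (c j • e) := by
    rw [eq_comm, Function.update_eq_self_iff]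
    simp [hw, hj]
  have key : g w = c j * g (Function.update w j e) := by
    conv_lhs => rw [hwj]
    exact g.map_update_smul w j (c j) e
  refine key.trans ?_
  -- The slot `j` already contains a multiple of `e`. A further such slot `k` makes two arguments
  -- equal to `e` after the scalars are pulled out; otherwise the term is covered by `h2`.
  by_cases hk : ∃ k, k ≠ j ∧ k ∉ s
  · obtain ⟨k, hkj, hks⟩ := hk
    have hwk : Function.update w j e = Function.update (Function.update w j e) k (c k • e) := by
      rw [eq_comm, Function.update_eq_self_iff]
      simp [hw, hks, hkj]
    rw [hwk, g.map_update_smul, g.map_eq_zero_of_eq (i := j) (j := k) _ _ hkj.symm, smul_zero,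
      mul_zero]
    simp [hkj.symm]
  · push Not at hk
    have h : Function.update w j e = Function.update u j e := by
      funext k
      by_cases hkj : k = j
      · subst hkj
        simp
      · simp [hkj, hw, hk k hkj]
    rw [h, h2 u hu j, mul_zero]

/-! ### Coefficients of products of forms from the two factors -/

namespace Form

variable {M N : Man.{u}} {E : Type u} [NormedAddCommGroup E] [NormedSpace ℝ E]
  [FiniteDimensional ℝ E] {p q r : ℕ}

theorem inChart_ofSpace (a : FormField (Man.ofSpace E) r) (x₀ : E) : inChart a x₀ = a := by
  funext y
  ext v
  refine formField_congr a rfl _ _ fun i => ?_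
  exact congrArg (fun T : E →L[ℝ] E => T (v i)) (mfderiv_id (I := 𝓘(ℝ, E)) (x := y))

/-- The form on a vector space defined by a smooth function with values in alternating forms. -/
def ofFun (a : E → E [⋀^Fin r]→L[ℝ] ℝ) (ha : ContDiff ℝ ∞ a) : Form (Man.ofSpace E) r :=
  ⟨a, fun x₀ => ha.contDiffOn.congr fun y _ => congrFun (inChart_ofSpace a x₀) y⟩

theorem contDiff_ofSpace (a : Form (Man.ofSpace E) r) :
    ContDiff ℝ ∞ (F := E [⋀^Fin r]→L[ℝ] ℝ) (E := E) a.1 := by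
  have h := a.2 (0 : E)
  rw [inChart_ofSpace] at h
  exact contDiffOn_univ.1 h

theorem d_apply_ofSpace (a : Form (Man.ofSpace E) r) (x : E) (v : Fin (r + 1) → E) :
    (d r a).1 x v = extDeriv (fun x : E => (a.1 x : E [⋀^Fin r]→L[ℝ] ℝ)) x v := by
  have h := inChart_extDerivField a.2 x (y := x) (Set.mem_univ x)
  rw [inChart_ofSpace, inChart_ofSpace] at h
  exact DFunLike.congr_fun h v

theorem pullback_fst_apply (a : Form M r) (x : (M.prodSpace E).carrier)
    (v : Fin r → M.model × E) :
    (pullback (SmoothMap.fst M E) a).1 x v = a.1 x.1 fun i => (v i).1 :=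
  formField_congr a.1 rfl _ _ fun i => SmoothMap.mfderiv_fst x (v i)

theorem pullback_snd_apply (a : Form (Man.ofSpace E) r) (x : (M.prodSpace E).carrier)
    (v : Fin r → M.model × E) :
    (pullback (SmoothMap.snd M E) a).1 x v = a.1 x.2 fun i => (v i).2 :=
  formField_congr a.1 rfl _ _ fun i => SmoothMap.mfderiv_snd x (v i)

theorem pullback_slice_apply (e : E) (a : Form (M.prodSpace E) r) (x : M.carrier)
    (v : Fin r → M.model) :
    (pullback (SmoothMap.slice M e) a).1 x v =
      a.1 (x, e) fun i => ((v i, 0) : M.model × E) :=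
  formField_congr a.1 rfl _ _ fun i => SmoothMap.mfderiv_slice e x (v i)

theorem contr_pullback_fst (e : E) (a : Form M (r + 1)) :
    contr r e (pullback (SmoothMap.fst M E) a) = 0 :=
  apply_ext fun x v => (contr_apply e _ x v).trans <| (pullback_fst_apply a x _).trans <|
    (a.1 x.1).map_coord_zero (Fin.last r) (congrArg Prod.fst (Fin.snoc_last (α := fun _ => M.model × E) (0, e) v))

variable (a : Form M p)

/-- The pullback of `a` vanishes on vertical vectors, so `wedgeAlt_append` applies. Since the
vertical vector is inserted in the last slot and `ρ` is the right factor, there is no sign. -/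
theorem contr_wedge_one (ρ : Form (Man.ofSpace E) 1) (e : E) :
    pullback (SmoothMap.slice M 0) (contr p e (wedge p 1 (pullback (SmoothMap.fst M E) a)
      (pullback (SmoothMap.snd M E) ρ))) = ρ.1 (0 : E) (fun _ => e) • a := by
  refine apply_ext fun x v => (pullback_slice_apply 0 _ x v).trans ((contr_apply e _ _ _).trans ?_)
  have h := wedgeAlt_append (T := M.model × E) ((pullback (SmoothMap.fst M E) a).1 (x, 0))
    ((pullback (SmoothMap.snd M E) ρ).1 (x, 0)) (fun i => (v i, 0)) (fun _ => (0, e))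
    (by
      rintro w ⟨i, j, hij⟩
      exact (pullback_fst_apply a _ w).trans ((a.1 x).map_coord_zero i (congrArg Prod.fst hij)))
  rw [Fin.append_right_eq_snoc] at h
  refine h.trans ?_
  rw [mul_comm]
  exact congrArg₂ (· * ·) (pullback_snd_apply ρ (x, 0) _) (pullback_fst_apply a (x, 0) _)

theorem contr_wedge_two (ρ : Form (Man.ofSpace E) 2) (e e' : E) :
    pullback (SmoothMap.slice M 0) (contr p e' (contr (p + 1) e (wedge p 2
      (pullback (SmoothMap.fst M E) a) (pullback (SmoothMap.snd M E) ρ)))) =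
        ρ.1 (0 : E) ![e', e] • a := by
  refine apply_ext fun x v => (pullback_slice_apply 0 _ x v).trans
    ((contr_apply e' _ _ _).trans ((contr_apply e _ _ _).trans ?_))
  have h := wedgeAlt_append (T := M.model × E) ((pullback (SmoothMap.fst M E) a).1 (x, 0))
    ((pullback (SmoothMap.snd M E) ρ).1 (x, 0)) (fun i => (v i, 0)) ![(0, e'), (0, e)]
    (by
      rintro w ⟨i, j, hij⟩
      refine (pullback_fst_apply a _ w).trans ((a.1 x).map_coord_zero i ?_)
      rw [hij]
      fin_cases j <;> rfl)
  have hs : Fin.append (fun i => ((v i, 0) : M.model × E)) ![(0, e'), (0, e)] =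
      Fin.snoc (α := fun _ => M.model × E) (Fin.snoc (α := fun _ => M.model × E)
        (fun i => ((v i, 0) : M.model × E)) (0, e')) (0, e) := by
    have : (![(0, e'), (0, e)] : Fin 2 → M.model × E) =
        Fin.snoc (α := fun _ => M.model × E) ![(0, e')] (0, e) := by
      funext i
      fin_cases i <;> rfl
    rw [this]
    refine (Fin.append_snoc (fun i => ((v i, 0) : M.model × E)) ![(0, e')] (0, e)).trans ?_
    rw [Fin.append_right_eq_snoc]
    rfl
  rw [hs] at h
  refine h.trans ?_
  rw [mul_comm]
  refine congrArg₂ (· * ·) ((pullback_snd_apply ρ (x, 0) _).trans ?_)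
    (pullback_fst_apply a (x, 0) _)
  congr 1
  funext i
  fin_cases i <;> rfl

/-- Along the slice only one argument has a vertical component, whereas `ρ` needs two. -/
theorem contr_wedge_two_single (ρ : Form (Man.ofSpace E) 2) (e : E) :
    pullback (SmoothMap.slice M 0) (contr (p + 1) e (wedge p 2
      (pullback (SmoothMap.fst M E) a) (pullback (SmoothMap.snd M E) ρ))) = 0 := by
  refine apply_ext fun x v => (pullback_slice_apply 0 _ x v).trans ((contr_apply e _ _ _).trans ?_)
  refine wedgeAlt_eq_zero_of_card (T := M.model × E) ((pullback (SmoothMap.fst M E) a).1 (x, 0))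
    ((pullback (SmoothMap.snd M E) ρ).1 (x, 0)) _ {Fin.last (p + 1)} (by simp) ?_ ?_
  · rintro w ⟨i, hi⟩
    refine (pullback_fst_apply a _ _).trans ((a.1 x).map_coord_zero i ?_)
    rw [Function.comp_apply, Finset.mem_singleton.1 hi, Fin.snoc_last]
    rfl
  · rintro w ⟨i, hi⟩
    refine (pullback_snd_apply ρ _ _).trans ((ρ.1 (0 : E)).map_coord_zero i ?_)
    rw [Finset.mem_singleton] at hi
    obtain ⟨j, hj⟩ := Fin.exists_castSucc_eq.2 hi
    rw [Function.comp_apply, ← hj, Fin.snoc_castSucc]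
    rfl

/-- Two arguments are vertical, but `ρ` takes only one of them and `a` vanishes on the other. -/
theorem contr_contr_wedge_one (a : Form M (q + 1)) (ρ : Form (Man.ofSpace E) 1) (e e' : E) :
    pullback (SmoothMap.slice M 0) (contr q e' (contr (q + 1) e (wedge (q + 1) 1
      (pullback (SmoothMap.fst M E) a) (pullback (SmoothMap.snd M E) ρ)))) = 0 := by
  refine apply_ext fun x v => (pullback_slice_apply 0 _ x v).trans
    ((contr_apply e' _ _ _).trans ((contr_apply e _ _ _).trans ?_))
  refine wedgeAlt_eq_zero_of_card (T := M.model × E) ((pullback (SmoothMap.fst M E) a).1 (x, 0))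
    ((pullback (SmoothMap.snd M E) ρ).1 (x, 0)) _
    {Fin.last (q + 1), (Fin.last q).castSucc} ?_ ?_ ?_
  · rw [Finset.card_pair (Fin.castSucc_lt_last _).ne']
    decide
  · rintro w ⟨i, hi⟩
    refine (pullback_fst_apply a _ _).trans ((a.1 x).map_coord_zero i ?_)
    rcases Finset.mem_insert.1 hi with hi | hi
    · rw [Function.comp_apply, hi, Fin.snoc_last]
      rfl
    · rw [Function.comp_apply, Finset.mem_singleton.1 hi, Fin.snoc_castSucc, Fin.snoc_last]
      rfl
  · rintro w ⟨i, hi⟩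
    refine (pullback_snd_apply ρ _ _).trans ((ρ.1 (0 : E)).map_coord_zero i ?_)
    rw [Finset.mem_insert, Finset.mem_singleton, not_or] at hi
    obtain ⟨j, hj⟩ := Fin.exists_castSucc_eq.2 hi.1
    rw [← hj] at hi
    obtain ⟨k, hk⟩ := Fin.exists_castSucc_eq.2 fun h => hi.2 (congrArg Fin.castSucc h)
    rw [Function.comp_apply, ← hj, ← hk, Fin.snoc_castSucc, Fin.snoc_castSucc]
    rfl

theorem eq_zero_of_finrank_lt (h : Module.finrank ℝ E < r) (a : Form (Man.ofSpace E) r) : a = 0 :=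
  apply_ext fun x v => by
    let g : E [⋀^Fin r]→ₗ[ℝ] ℝ := ContinuousAlternatingMap.toAlternatingMap (a.1 x)
    refine g.map_linearDependent v fun hv => ?_
    have h' := hv.fintype_card_le_finrank
    rw [Fintype.card_fin] at h'
    exact absurd h h'.not_gt

end Form

/-- The plane. -/
abbrev Plane : Type u := ULift.{u} ℝ × ULift.{u} ℝ

/-! ### The slot form on the plane and its symmetries -/

namespace Plane

/-- The first coordinate. -/
def X : Plane.{u} →L[ℝ] ℝ :=
  (ContinuousLinearEquiv.ulift (R₁ := ℝ) (M₁ := ℝ)).toContinuousLinearMap.comp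
    (ContinuousLinearMap.fst ℝ _ _)

/-- The second coordinate. -/
def Y : Plane.{u} →L[ℝ] ℝ :=
  (ContinuousLinearEquiv.ulift (R₁ := ℝ) (M₁ := ℝ)).toContinuousLinearMap.comp
    (ContinuousLinearMap.snd ℝ _ _)

theorem X_apply (z : Plane.{u}) : X z = z.1.down := rfl

theorem Y_apply (z : Plane.{u}) : Y z = z.2.down := rfl

/-- The first basis vector. -/
def ex : Plane.{u} := (⟨1⟩, 0)

/-- The second basis vector. -/
def ey : Plane.{u} := (0, ⟨1⟩)

theorem eq_smul_add_smul (z : Plane.{u}) : z = X z • ex + Y z • ey := by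
  refine Prod.ext (ULift.ext _ _ ?_) (ULift.ext _ _ ?_) <;> simp [X_apply, Y_apply, ex, ey]

@[simp] theorem X_ex : X ex.{u} = 1 := rfl
@[simp] theorem X_ey : X ey.{u} = 0 := rfl
@[simp] theorem Y_ex : Y ex.{u} = 0 := rfl
@[simp] theorem Y_ey : Y ey.{u} = 1 := rfl

theorem finrank_plane : Module.finrank ℝ Plane.{u} = 2 := by
  simp

/-- The map to the plane with given coordinates. -/
def mkMap {E : Type u} [NormedAddCommGroup E] [NormedSpace ℝ E] [FiniteDimensional ℝ E]
    (g h : E → ℝ) (hg : ContDiff ℝ ∞ g) (hh : ContDiff ℝ ∞ h) :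
    SmoothMap (Man.ofSpace E) (Man.ofSpace Plane.{u}) :=
  ⟨fun x => (⟨g x⟩, ⟨h x⟩), ContDiff.contMDiff (E := E) (E' := Plane.{u}) <|
    ((ContinuousLinearEquiv.ulift (R₁ := ℝ) (M₁ := ℝ)).symm.contDiff.comp hg).prodMk
      ((ContinuousLinearEquiv.ulift (R₁ := ℝ) (M₁ := ℝ)).symm.contDiff.comp hh)⟩

/-- The `1`-form `e^y dx` on the plane. -/
def slotForm : Form (Man.ofSpace Plane.{u}) 1 :=
  Form.ofFun (fun z => Real.exp (Y z) • ContinuousAlternatingMap.ofSubsingleton ℝ Plane.{u} ℝ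
    (0 : Fin 1) X) ((Real.contDiff_exp.comp Y.contDiff).smul contDiff_const)

theorem slotForm_apply (z : Plane.{u}) (v : Fin 1 → Plane.{u}) :
    slotForm.1 z v = Real.exp (Y z) * X (v 0) := rfl

theorem d_slotForm_apply (z : Plane.{u}) (v : Fin 2 → Plane.{u}) :
    (Form.d 1 slotForm).1 z v = Real.exp (Y z) * (Y (v 0) * X (v 1) - Y (v 1) * X (v 0)) := by
  refine (Form.d_apply_ofSpace slotForm z v).trans ?_
  have h : HasFDerivAt (fun z : Plane.{u} => Real.exp (Y z) •
      ContinuousAlternatingMap.ofSubsingleton ℝ Plane.{u} ℝ (0 : Fin 1) X) _ z :=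
    (Y.hasFDerivAt.exp).smul_const _
  change extDeriv (fun z : Plane.{u} => Real.exp (Y z) •
      ContinuousAlternatingMap.ofSubsingleton ℝ Plane.{u} ℝ (0 : Fin 1) X) z v = _
  rw [extDeriv, h.fderiv, ContinuousAlternatingMap.alternatizeUncurryFin_apply]
  simp [Fin.sum_univ_two, Fin.removeNth]
  ring

theorem slotForm_ex : slotForm.1 (0 : Plane.{u}) (fun _ => ex) = 1 := by
  refine (slotForm_apply _ _).trans ?_
  simp

/-- As `dλ = e^y dy ∧ dx`, this order of the basis vectors gives `+1`, and it fixes the order of the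
two contractions in `Forms.coeffYX`. -/
theorem d_slotForm_ey_ex : (Form.d 1 slotForm).1 (0 : Plane.{u}) ![ey, ex] = 1 := by
  refine (d_slotForm_apply _ _).trans ?_
  simp

/-- The linear automorphism `(x, y) ↦ (c x, y)`. -/
def scale (c : ℝ) : Plane.{u} →L[ℝ] Plane.{u} :=
  (c • ContinuousLinearMap.fst ℝ _ _).prod (ContinuousLinearMap.snd ℝ _ _)

/-- The symmetry of the slot form which sends a given point to the origin. -/
def symm (z₀ : Plane.{u}) : SmoothMap (Man.ofSpace Plane.{u}) (Man.ofSpace Plane.{u}) :=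
  ⟨fun z => scale (Real.exp (Y z₀)) (z - z₀), ContDiff.contMDiff (E := Plane.{u}) (E' := Plane.{u})
    ((scale (Real.exp (Y z₀))).contDiff.comp (contDiff_id.sub contDiff_const))⟩

theorem fderiv_symm (z₀ z : Plane.{u}) :
    fderiv ℝ (symm z₀ : Plane.{u} → Plane.{u}) z = scale (Real.exp (Y z₀)) :=
  ((scale (Real.exp (Y z₀))).hasFDerivAt.comp z ((hasFDerivAt_id z).sub_const z₀)).fderiv

theorem symm_self (z₀ : Plane.{u}) : symm z₀ z₀ = (0 : Plane.{u}) :=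
  (congrArg (scale (Real.exp (Y z₀))) (sub_self z₀)).trans (map_zero _)

theorem pullback_ofSpace_apply {E F : Type u} [NormedAddCommGroup E] [NormedSpace ℝ E]
    [FiniteDimensional ℝ E] [NormedAddCommGroup F] [NormedSpace ℝ F] [FiniteDimensional ℝ F]
    {r : ℕ} (f : SmoothMap (Man.ofSpace E) (Man.ofSpace F)) (a : Form (Man.ofSpace F) r) (x : E)
    (v : Fin r → E) : (Form.pullback f a).1 x v =
      a.1 (f x) fun i => (fderiv ℝ (f : E → F) x (v i) : F) :=
  formField_congr a.1 rfl _ _ fun i => congrArg (fun T : E →L[ℝ] F => T (v i)) mfderiv_eq_fderiv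

/-- Translating `y` by `-y₀` divides `e^y` by `e^{y₀}`, and the scaling of `x` restores this factor
in `dx`. -/
theorem pullback_symm_slotForm (z₀ : Plane.{u}) : Form.pullback (symm z₀) slotForm = slotForm := by
  refine Form.apply_ext fun z v => (pullback_ofSpace_apply _ _ _ _).trans ?_
  refine (slotForm_apply _ _).trans (Eq.trans ?_ (slotForm_apply _ _).symm)
  rw [fderiv_symm]
  change Real.exp (z.2.down - z₀.2.down) * (Real.exp (z₀.2.down) * (v 0).1.down) =
    Real.exp (z.2.down) * (v 0).1.down
  rw [← mul_assoc, ← Real.exp_add, sub_add_cancel]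

/-- The projection `(x, y) ↦ (0, y)`. -/
def proj : SmoothMap (Man.ofSpace Plane.{u}) (Man.ofSpace Plane.{u}) :=
  ⟨scale 0, ContDiff.contMDiff (E := Plane.{u}) (E' := Plane.{u}) (scale 0).contDiff⟩

theorem fderiv_proj (z : Plane.{u}) : fderiv ℝ (proj : Plane.{u} → Plane.{u}) z = scale 0 :=
  (scale 0).fderiv

/-- The pullback along `(g, h)` is `e^h dg`, so every product of a positive smooth function with an
exact form `dg` is a pullback of the slot form. -/
theorem pullback_mkMap_slotForm_apply {E : Type u} [NormedAddCommGroup E] [NormedSpace ℝ E]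
    [FiniteDimensional ℝ E] (g h : E → ℝ) (hg : ContDiff ℝ ∞ g) (hh : ContDiff ℝ ∞ h) (x : E)
    (v : Fin 1 → E) : (Form.pullback (mkMap g h hg hh) slotForm).1 x v =
      Real.exp (h x) * fderiv ℝ g x (v 0) := by
  refine (pullback_ofSpace_apply _ _ _ _).trans ((slotForm_apply _ _).trans ?_)
  refine congrArg (fun t => Real.exp (h x) * t) ?_
  have e : fderiv ℝ (X ∘ (mkMap g h hg hh : E → Plane.{u})) x = _ := fderiv_comp x
    X.differentiableAt (((mkMap g h hg hh).contMDiff.contDiff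
      (E := E) (E' := Plane.{u})).differentiable (by simp) x)
  rw [X.fderiv] at e
  exact (congrArg (fun T : E →L[ℝ] ℝ => T (v 0)) e).symm

theorem pullback_proj_slotForm : Form.pullback proj slotForm.{u} = 0 := by
  refine Form.apply_ext fun z v => (pullback_ofSpace_apply _ _ _ _).trans ?_
  refine (slotForm_apply _ _).trans ?_
  rw [fderiv_proj]
  change _ * ((0 : ℝ) * _) = 0
  rw [zero_mul, mul_zero]

end Plane

/-! ### Invariant forms on a product with the plane -/

namespace Form

variable {M : Man.{u}} {r : ℕ}

open Plane

/-- The symmetry attached to the plane component of a point moves that point to the slice over the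
origin. -/
theorem eq_zero_of_slice {a : Form (M.prodSpace Plane) r}
    (hS : ∀ z, pullback (SmoothMap.idProd M (Plane.symm z)) a = a)
    (h : ∀ (x : M.carrier) (v : Fin r → M.model × Plane), a.1 (x, (0 : Plane)) v = 0) : a = 0 := by
  refine apply_ext fun x v => ?_
  rw [← hS x.2]
  refine Eq.trans (b := a.1 (x.1, (0 : Plane.{u})) fun i => (mfderiv 𝓘(ℝ, M.model × Plane.{u})
    𝓘(ℝ, M.model × Plane.{u}) (SmoothMap.idProd M (Plane.symm x.2)) x (v i) :
      M.model × Plane.{u})) ?_ (h x.1 _)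
  have hx : SmoothMap.idProd M (Plane.symm x.2) x = (x.1, (0 : Plane.{u})) :=
    Prod.ext rfl (symm_self x.2)
  exact formField_congr a.1 hx _ _ fun i => rfl

/-- By `hS` it suffices to work at points `(x, 0)`. The tangent space there is the sum of the
horizontal vectors `U'` and the lines of `ey` and `ex`. The hypothesis `h0` removes all components
without `ex`, and `h1` and `h2` remove those with `ex` alone and with `ey` and `ex`. The equations
`r = q + 1` and `r = q + 2` with heterogeneous equalities allow an arbitrary degree `r`. -/
theorem eq_zero_of_contr {a : Form (M.prodSpace Plane) r}
    (hS : ∀ z, pullback (SmoothMap.idProd M (Plane.symm z)) a = a)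
    (h0 : pullback (SmoothMap.idProd M Plane.proj) a = 0)
    (h1 : ∀ q (b : Form (M.prodSpace Plane) (q + 1)), r = q + 1 → a ≍ b →
      pullback (SmoothMap.slice M (0 : Plane)) (contr q ex b) = 0)
    (h2 : ∀ q (b : Form (M.prodSpace Plane) (q + 2)), r = q + 2 → a ≍ b →
      pullback (SmoothMap.slice M (0 : Plane)) (contr q ey (contr (q + 1) ex b)) = 0) :
    a = 0 := by
  refine eq_zero_of_slice hS fun x v => ?_
  let U : Submodule ℝ (M.model × Plane.{u}) :=
    LinearMap.ker (X.toLinearMap ∘ₗ LinearMap.snd ℝ M.model Plane.{u})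
  let U' : Submodule ℝ (M.model × Plane.{u}) := LinearMap.ker (LinearMap.snd ℝ M.model Plane.{u})
  -- The projection fixes `(x, 0)`, and its derivative is the identity on vectors whose
  -- `ex`-component vanishes, so on such tuples `a` agrees with its pullback.
  have hU : ∀ u : Fin r → M.model × Plane.{u}, (∀ i, u i ∈ U) → a.1 (x, (0 : Plane)) u = 0 := by
    intro u hu
    have h := DFunLike.congr_fun (congrFun (congrArg Subtype.val h0) (x, (0 : Plane.{u}))) u
    refine Eq.trans (b := (pullback (SmoothMap.idProd M Plane.proj) a).1 (x, (0 : Plane.{u})) u)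
      ?_ h
    have hx : SmoothMap.idProd M Plane.proj (x, (0 : Plane.{u})) = (x, (0 : Plane.{u})) :=
      Prod.ext rfl (map_zero (scale 0))
    refine formField_congr a.1 hx.symm _ _ fun i => ?_
    refine Eq.trans ?_ (SmoothMap.mfderiv_idProd Plane.proj (x, (0 : Plane.{u})) (u i)).symm
    refine Prod.ext rfl ?_
    rw [fderiv_proj]
    have hX : (u i).2.1.down = 0 := hu i
    refine Prod.ext (ULift.ext _ _ ?_) rfl
    change _ = (0 : ℝ) * _
    rw [hX, zero_mul]
  rcases r with _ | r
  · exact hU v fun i => i.elim0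
  have hU1 : ∀ u : Fin r → M.model × Plane.{u}, (∀ i, u i ∈ U') →
      a.1 (x, (0 : Plane)) (Fin.snoc (α := fun _ => M.model × Plane.{u}) u (0, ex)) = 0 := by
    intro u hu
    have h := DFunLike.congr_fun (congrFun (congrArg Subtype.val (h1 r a rfl HEq.rfl)) x) fun i => (u i).1
    refine Eq.trans ?_ h
    refine Eq.trans ?_ ((pullback_slice_apply 0 _ x _).trans (contr_apply ex a _ _)).symm
    exact congrArg (fun u => a.1 (x, (0 : Plane.{u}))
      (Fin.snoc (α := fun _ => M.model × Plane.{u}) u (0, ex)))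
      (funext fun i => Prod.ext rfl (hu i))
  refine AlternatingMap.eq_zero_of_forall_mem_sup
    (ContinuousAlternatingMap.toAlternatingMap (a.1 (x, (0 : Plane.{u}))) :
      (M.model × Plane.{u}) [⋀^Fin (r + 1)]→ₗ[ℝ] ℝ) U (0, ex) hU ?_ v fun i => ?_
  · intro u hu
    rcases r with _ | r
    · exact hU1 u fun i => i.elim0
    refine (contr_apply ex a (x, 0) u).symm.trans ?_
    refine AlternatingMap.eq_zero_of_forall_mem_sup
      (ContinuousAlternatingMap.toAlternatingMap ((contr (r + 1) ex a).1 (x, (0 : Plane.{u}))) :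
        (M.model × Plane.{u}) [⋀^Fin (r + 1)]→ₗ[ℝ] ℝ) U' (0, ey) ?_ ?_ u fun i => ?_
    · exact fun u hu => (contr_apply ex a (x, 0) u).trans (hU1 u hu)
    · intro u hu
      have h := DFunLike.congr_fun (congrFun (congrArg Subtype.val (h2 r a rfl HEq.rfl)) x) fun i => (u i).1
      refine Eq.trans ?_ h
      refine Eq.trans ?_ ((pullback_slice_apply 0 _ x _).trans (contr_apply ey _ _ _)).symm
      exact congrArg (fun u => (contr (r + 1) ex a).1 (x, (0 : Plane.{u}))
        (Fin.snoc (α := fun _ => M.model × Plane.{u}) u (0, ey)))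
        (funext fun i => Prod.ext rfl (hu i))
    · have hX : X (u i).2 = 0 := hu i
      refine Submodule.mem_sup.2 ⟨((u i).1, 0), rfl, Y (u i).2 • (0, ey),
        Submodule.smul_mem _ _ (Submodule.mem_span_singleton_self _), Prod.ext ?_ ?_⟩
      · simp
      · rw [eq_smul_add_smul (u i).2, hX]
        simp
  · refine Submodule.mem_sup.2 ⟨((v i).1, Y (v i).2 • ey), ?_, X (v i).2 • (0, ex),
      Submodule.smul_mem _ _ (Submodule.mem_span_singleton_self _), Prod.ext ?_ ?_⟩
    · change X.{u} (Y (v i).2 • ey) = 0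
      simp
    · simp
    · conv_rhs => rw [eq_smul_add_smul (v i).2]
      simp [add_comm]

end Form

namespace Forms

open Plane

variable {M N : Man.{u}} {E : Type u} [NormedAddCommGroup E] [NormedSpace ℝ E]
  [FiniteDimensional ℝ E] {p q r : ℕ}

theorem pullback_comp_apply {L : Man.{u}} (f : SmoothMap M N) (g : SmoothMap L M) (a : Forms N) :
    pullback (ContMDiffMap.comp f g) a = pullback g (pullback f a) := by
  induction a using induction with
  | h r a =>
    rw [pullback_incl, pullback_incl, pullback_incl, Form.pullback_comp]
    rfl
  | hadd x y hx hy => simp only [map_add, hx, hy]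

theorem pullback_id_apply (a : Forms M) : pullback ContMDiffMap.id a = a := by
  induction a using induction with
  | h r a =>
    rw [pullback_incl, Form.pullback_id]
    rfl
  | hadd x y hx hy => simp only [map_add, hx, hy]

theorem component_ext {a b : Forms M} (h : ∀ r, component r a = component r b) : a = b :=
  DFinsupp.ext (β := fun r => Form M r) h

theorem component_pullback (f : SmoothMap M N) (a : Forms N) :
    component r (pullback f a) = Form.pullback f (component r a) := by
  induction a using induction with
  | h q a =>
    rw [pullback_incl]
    by_cases h : q = r
    · subst h
      rw [component_incl, component_incl]
    · rw [component_incl_of_ne h, component_incl_of_ne h, map_zero]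
  | hadd x y hx hy => simp only [map_add, hx, hy]

/-- Insertion of a constant vector field in the last slot of a form on a product. -/
def contr (e : E) : Forms (M.prodSpace E) →ₗ[ℝ] Forms (M.prodSpace E) :=
  lift fun n => match n with
    | 0 => 0
    | q + 1 => incl q ∘ₗ Form.contr q e

theorem contr_incl_zero (e : E) (a : Form (M.prodSpace E) 0) : contr e (incl 0 a) = 0 :=
  lift_incl _ a

theorem contr_incl_succ (e : E) (a : Form (M.prodSpace E) (q + 1)) :
    contr e (incl (q + 1) a) = incl q (Form.contr q e a) :=
  lift_incl _ a

theorem component_contr (e : E) (a : Forms (M.prodSpace E)) :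
    component q (contr e a) = Form.contr q e (component (q + 1) a) := by
  induction a using induction with
  | h r a =>
    rcases r with _ | r
    · rw [contr_incl_zero, component_incl_of_ne (Nat.succ_ne_zero q).symm, map_zero, map_zero]
    · rw [contr_incl_succ]
      by_cases h : r = q
      · subst h
        rw [component_incl, component_incl]
      · rw [component_incl_of_ne h, component_incl_of_ne fun h' => h (Nat.succ_injective h'),
          map_zero]
  | hadd x y hx hy => simp only [map_add, hx, hy]

theorem contr_pullback_fst (e : E) (a : Forms M) : contr e (pullback (SmoothMap.fst M E) a) = 0 := by
  induction a using induction with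
  | h r a =>
    rw [pullback_incl]
    rcases r with _ | r
    · rw [contr_incl_zero]
    · rw [contr_incl_succ, Form.contr_pullback_fst, map_zero]
  | hadd x y hx hy => simp only [map_add, hx, hy, add_zero]

/-- The coefficient of `dx` at the origin of the plane. -/
def coeffX : Forms (M.prodSpace Plane) →ₗ[ℝ] Forms M :=
  (pullback (SmoothMap.slice M (0 : Plane))).toLinearMap ∘ₗ contr ex

/-- The coefficient of `dy ∧ dx` at the origin of the plane. -/
def coeffYX : Forms (M.prodSpace Plane) →ₗ[ℝ] Forms M :=
  (pullback (SmoothMap.slice M (0 : Plane))).toLinearMap ∘ₗ contr ey ∘ₗ contr ex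

theorem coeffX_pullback_fst (a : Forms M) : coeffX (pullback (SmoothMap.fst M Plane) a) = 0 := by
  change pullback _ (contr ex _) = 0
  rw [contr_pullback_fst, map_zero]

theorem coeffYX_pullback_fst (a : Forms M) : coeffYX (pullback (SmoothMap.fst M Plane) a) = 0 := by
  change pullback _ (contr ey (contr ex _)) = 0
  rw [contr_pullback_fst, map_zero, map_zero]

variable (M) in
/-- The slot form on the plane, as a form on `M × Plane`. -/
def slot : Forms (M.prodSpace Plane) := incl 1 (Form.pullback (SmoothMap.snd M Plane) slotForm)

variable (M) in
/-- The derivative of the slot form. -/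
def dSlot : Forms (M.prodSpace Plane) :=
  incl 2 (Form.pullback (SmoothMap.snd M Plane) (Form.d 1 slotForm))

theorem coeffX_mul_slot (a : Forms M) :
    coeffX (pullback (SmoothMap.fst M Plane) a * slot M) = a := by
  induction a using induction with
  | h r a =>
    rw [pullback_incl, slot, incl_mul_incl]
    change pullback _ (contr ex (incl (r + 1) _)) = _
    rw [contr_incl_succ, pullback_incl]
    refine congrArg (incl r) ((Form.contr_wedge_one a slotForm ex).trans ?_)
    exact (congrArg (· • a) slotForm_ex.{u}).trans (one_smul ℝ a)
  | hadd x y hx hy => rw [map_add, add_mul, map_add, hx, hy]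

theorem coeffX_mul_dSlot (a : Forms M) :
    coeffX (pullback (SmoothMap.fst M Plane) a * dSlot M) = 0 := by
  induction a using induction with
  | h r a =>
    rw [pullback_incl, dSlot, incl_mul_incl]
    change pullback _ (contr ex (incl (r + 1 + 1) _)) = _
    rw [contr_incl_succ, pullback_incl]
    exact (congrArg (incl (r + 1)) (Form.contr_wedge_two_single a (Form.d 1 slotForm) ex)).trans
      (map_zero _)
  | hadd x y hx hy => rw [map_add, add_mul, map_add, hx, hy, add_zero]

theorem coeffYX_mul_slot (a : Forms M) :
    coeffYX (pullback (SmoothMap.fst M Plane) a * slot M) = 0 := by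
  induction a using induction with
  | h r a =>
    rw [pullback_incl, slot, incl_mul_incl]
    change pullback _ (contr ey (contr ex (incl (r + 1) _))) = _
    rw [contr_incl_succ]
    rcases r with _ | r
    · rw [contr_incl_zero, map_zero]
    · rw [contr_incl_succ, pullback_incl]
      exact (congrArg (incl r) (Form.contr_contr_wedge_one a slotForm ex ey)).trans (map_zero _)
  | hadd x y hx hy => rw [map_add, add_mul, map_add, hx, hy, add_zero]

theorem coeffYX_mul_dSlot (a : Forms M) :
    coeffYX (pullback (SmoothMap.fst M Plane) a * dSlot M) = a := by
  induction a using induction with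
  | h r a =>
    rw [pullback_incl, dSlot, incl_mul_incl]
    change pullback _ (contr ey (contr ex (incl (r + 1 + 1) _))) = _
    rw [contr_incl_succ, contr_incl_succ, pullback_incl]
    refine congrArg (incl r) ((Form.contr_wedge_two a (Form.d 1 slotForm) ex ey).trans ?_)
    exact (congrArg (· • a) d_slotForm_ey_ex.{u}).trans (one_smul ℝ a)
  | hadd x y hx hy => rw [map_add, add_mul, map_add, hx, hy]

set_option maxHeartbeats 1000000 in
theorem eq_zero_of_coeff {a : Forms (M.prodSpace Plane)}
    (hS : ∀ z, pullback (SmoothMap.idProd M (Plane.symm z)) a = a)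
    (h0 : pullback (SmoothMap.idProd M Plane.proj) a = 0) (h1 : coeffX a = 0)
    (h2 : coeffYX a = 0) : a = 0 := by
  refine component_ext fun r => ?_
  rw [map_zero]
  refine Form.eq_zero_of_contr (fun z => ?_) ?_ ?_ ?_
  · rw [← component_pullback, hS]
  · rw [← component_pullback, h0, map_zero]
  · intro q b hq hb
    subst hq
    obtain rfl := eq_of_heq hb
    have h := congrArg (component q) h1
    change component q (pullback _ (contr ex a)) = _ at h
    rwa [component_pullback, component_contr, map_zero] at h
  · intro q b hq hb
    subst hq
    obtain rfl := eq_of_heq hb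
    have h := congrArg (component q) h2
    change component q (pullback _ (contr ey (contr ex a))) = _ at h
    rwa [component_pullback, component_contr, component_contr, map_zero] at h

theorem slot_mul_slot : slot M * slot M = 0 := by
  have h := incl_mul_comm (Form.pullback (SmoothMap.snd M Plane) slotForm)
    (Form.pullback (SmoothMap.snd M Plane) slotForm)
  have h' : slot M * slot M = (-1 : ℝ) ^ (1 * 1) • (slot M * slot M) := h
  rw [mul_one, pow_one] at h'
  have h2 : (2 : ℝ) • (slot M * slot M) = 0 := by
    rw [two_smul]
    nth_rewrite 1 [h']
    rw [neg_one_smul, neg_add_cancel]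
  exact (smul_eq_zero_iff_right two_ne_zero).1 h2

/-- The product is the pullback of a form of degree greater than `2` on the plane, hence zero. -/
theorem pullback_snd_mul {s : ℕ} (h : 2 < r + s) (a : Form (Man.ofSpace Plane.{u}) r)
    (b : Form (Man.ofSpace Plane.{u}) s) :
    incl r (Form.pullback (SmoothMap.snd M Plane) a) *
      incl s (Form.pullback (SmoothMap.snd M Plane) b) = 0 := by
  rw [incl_mul_incl, ← Form.pullback_wedge,
    Form.eq_zero_of_finrank_lt (by rw [finrank_plane]; exact h) (Form.wedge r s a b), map_zero,
    map_zero]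

theorem slot_mul_dSlot : slot M * dSlot M = 0 := pullback_snd_mul (by norm_num) _ _

theorem dSlot_mul_dSlot : dSlot M * dSlot M = 0 := pullback_snd_mul (by norm_num) _ _

theorem slot_mul_incl_one (a : Form (M.prodSpace Plane) 1) :
    slot M * incl 1 a = -(incl 1 a * slot M) := by
  refine (incl_mul_comm a _).trans ?_
  rw [mul_one, pow_one]
  exact neg_one_smul ℝ (incl 1 a * slot M)

theorem dSlot_mul_comm (a : Forms (M.prodSpace Plane)) : dSlot M * a = a * dSlot M := by
  induction a using induction with
  | h r a =>
    refine (incl_mul_comm a _).trans ?_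
    rw [mul_comm r 2, pow_mul, neg_one_sq, one_pow, one_smul]
    rfl
  | hadd x y hx hy => rw [mul_add, add_mul, hx, hy]

theorem slot_mul_comm_of_even (a : Form (M.prodSpace Plane) 2) :
    slot M * incl 2 a = incl 2 a * slot M := by
  refine (incl_mul_comm a _).trans ?_
  rw [mul_one, neg_one_sq, one_smul]
  rfl

end Forms

/-! ### First-order expansion of forms on `Y × (Ω^1 ⊗ V)` -/

section Sections

variable {Y : Man.{u}} {V : Type v} [AddCommGroup V] [Module ℝ V] {M N : Man.{u}}

/-- The section `(φ, α + β)` of `Y × (Ω^1 ⊗ V)` for a section `(φ, α)`. -/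
def addForm (s : (prodOneForms Y V).obj (op M)) (β : Form M 1 ⊗[ℝ] V) :
    (prodOneForms Y V).obj (op M) := 
  (s.1, HAdd.hAdd (α := Form M 1 ⊗[ℝ] V) (β := Form M 1 ⊗[ℝ] V) s.2 β)

theorem addForm_zero (s : (prodOneForms Y V).obj (op M)) : addForm s 0 = s :=
  Prod.ext rfl (add_zero (M := Form M 1 ⊗[ℝ] V) s.2)

theorem addForm_add (s : (prodOneForms Y V).obj (op M)) (β γ : Form M 1 ⊗[ℝ] V) :
    addForm (addForm s β) γ = addForm s (β + γ) :=
  Prod.ext rfl (add_assoc (G := Form M 1 ⊗[ℝ] V) s.2 β γ)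

theorem map_addForm (f : M ⟶ N) (s : (prodOneForms Y V).obj (op N)) (β : Form N 1 ⊗[ℝ] V) :
    (prodOneForms Y V).map f.op (addForm s β) =
      addForm ((prodOneForms Y V).map f.op s) ((Form.pullback f).rTensor V β) :=
  Prod.ext rfl (LinearMap.map_add (M := Form N 1 ⊗[ℝ] V) ((Form.pullback f).rTensor V) s.2 β)

theorem map_map {L : Man.{u}} (f : M ⟶ N) (g : L ⟶ M) (s : (prodOneForms Y V).obj (op N)) :
    (prodOneForms Y V).map g.op ((prodOneForms Y V).map f.op s) =
      (prodOneForms Y V).map (g ≫ f).op s := by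
  rw [op_comp, Functor.map_comp]
  rfl

open Plane SmoothMap

/-- The section on `M × Plane` which is `s + λ ⊗ v` for the slot form `λ`. -/
def addSlot (s : (prodOneForms Y V).obj (op M)) (v : V) :
    (prodOneForms Y V).obj (op (M.prodSpace Plane)) :=
  addForm ((prodOneForms Y V).map (Quiver.Hom.op (fst M Plane : M.prodSpace Plane ⟶ M)) s)
    (Form.pullback (snd M Plane) slotForm ⊗ₜ v)

/-- The section `addSlot s v` is universal: every section `s + g^* λ ⊗ v` on `M` is its pullback
along `(id, g)`. Taking for `g` the symmetries or the projection gives the invariance properties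
used in `eval_addSlot`. -/
theorem map_pair_addSlot (f : N ⟶ M) (g : SmoothMap N (Man.ofSpace Plane))
    (s : (prodOneForms Y V).obj (op M)) (v : V) :
    (prodOneForms Y V).map (Quiver.Hom.op (pair f g : N ⟶ M.prodSpace Plane)) (addSlot s v) =
      addForm ((prodOneForms Y V).map f.op s) (Form.pullback g slotForm ⊗ₜ v) := by
  rw [addSlot, map_addForm, map_map, LinearMap.rTensor_tmul]
  exact congrArg (fun a : Form N 1 => addForm ((prodOneForms Y V).map f.op s) (a ⊗ₜ v))
    (LinearMap.congr_fun (Form.pullback_comp (snd M Plane) (pair f g)) slotForm).symm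

theorem addSlot_map (f : M ⟶ N) (s : (prodOneForms Y V).obj (op N)) (v : V) :
    addSlot ((prodOneForms Y V).map f.op s) v =
      (prodOneForms Y V).map (Quiver.Hom.op (prodId f Plane : M.prodSpace Plane ⟶ N.prodSpace Plane))
        (addSlot s v) := by
  rw [addSlot, map_map]
  exact (map_pair_addSlot (fst M Plane ≫ f : M.prodSpace Plane ⟶ N) (snd M Plane) s v).symm

theorem map_symm_addSlot (z : Plane) (s : (prodOneForms Y V).obj (op M)) (v : V) :
    (prodOneForms Y V).map (Quiver.Hom.op
      (idProd M (Plane.symm z) : M.prodSpace Plane ⟶ M.prodSpace Plane)) (addSlot s v) =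
        addSlot s v := by
  refine (map_pair_addSlot _ _ s v).trans ?_
  rw [Form.pullback_comp, LinearMap.comp_apply, pullback_symm_slotForm]
  rfl

theorem map_proj_addSlot (s : (prodOneForms Y V).obj (op M)) (v : V) :
    (prodOneForms Y V).map (Quiver.Hom.op
      (idProd M Plane.proj : M.prodSpace Plane ⟶ M.prodSpace Plane)) (addSlot s v) =
        (prodOneForms Y V).map (Quiver.Hom.op (fst M Plane : M.prodSpace Plane ⟶ M)) s := by
  refine (map_pair_addSlot _ _ s v).trans ?_
  rw [Form.pullback_comp, LinearMap.comp_apply, pullback_proj_slotForm, map_zero,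
    TensorProduct.zero_tmul, addForm_zero]

namespace FormOn

variable {q : ℕ}

theorem pullback_slice_contr (f : M ⟶ N) (a : Form (N.prodSpace Plane.{u}) q) :
    Form.pullback (slice M (0 : Plane.{u})) (Form.pullback (prodId f Plane) a) =
      Form.pullback f (Form.pullback (slice N (0 : Plane.{u})) a) :=
  (LinearMap.congr_fun (Form.pullback_comp (prodId f Plane) (slice M (0 : Plane.{u}))) a).symm.trans
    (LinearMap.congr_fun (Form.pullback_comp (slice N (0 : Plane.{u})) f) a)

/-- The operation on forms on `Y × (Ω^1 ⊗ V)` which evaluates at `s + λ ⊗ v` for the slot form `λ`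
and applies a natural operation from forms on `M × Plane` to forms on `M`. -/
def lower (v : V) {n : ℕ} (T : ∀ M : Man.{u}, Form (M.prodSpace Plane) n →ₗ[ℝ] Form M q)
    (hT : ∀ (M N : Man.{u}) (f : M ⟶ N) (a : Form (N.prodSpace Plane) n),
      T M (Form.pullback (prodId f Plane) a) = Form.pullback f (T N a)) :
    FormOn (prodOneForms Y V) n →ₗ[ℝ] FormOn (prodOneForms Y V) q where
  toFun τ := ⟨fun M s => T M (τ.1 (M.prodSpace Plane) (addSlot s v)), fun M N f s =>
    (congrArg (fun s => T M (τ.1 (M.prodSpace Plane) s)) (addSlot_map f s v)).trans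
      ((congrArg (T M) (τ.2 _ _ _ _)).trans (hT M N f _))⟩
  map_add' τ σ := apply_ext fun M s => map_add (T M) (τ.1 _ (addSlot s v)) (σ.1 _ (addSlot s v))
  map_smul' c τ := apply_ext fun M s => LinearMap.map_smul (T M) c (τ.1 _ (addSlot s v))

/-- The contraction of forms on `Y × (Ω^1 ⊗ V)` with a vector, the coefficient of `dx`. -/
def del (v : V) (q : ℕ) : FormOn (prodOneForms Y V) (q + 1) →ₗ[ℝ] FormOn (prodOneForms Y V) q :=
  lower v (fun M => Form.pullback (slice M (0 : Plane)) ∘ₗ Form.contr q ex) fun _ _ f a =>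
    (congrArg _ (Form.contr_pullback_prodId f ex a)).trans (pullback_slice_contr f _)

/-- The second contraction of forms on `Y × (Ω^1 ⊗ V)` with a vector, the coefficient of
`dy ∧ dx`. -/
def del₂ (v : V) (q : ℕ) :
    FormOn (prodOneForms Y V) (q + 2) →ₗ[ℝ] FormOn (prodOneForms Y V) q :=
  lower v (fun M => Form.pullback (slice M (0 : Plane)) ∘ₗ Form.contr q ey ∘ₗ
    Form.contr (q + 1) ex) fun M _ f a =>
      (congrArg (fun b => Form.pullback (slice M (0 : Plane)) (Form.contr q ey b))
        (Form.contr_pullback_prodId f ex a)).trans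
          ((congrArg _ (Form.contr_pullback_prodId f ey _)).trans (pullback_slice_contr f _))

end FormOn

namespace DeRhamAlg

/-- The contraction of forms on `Y × (Ω^1 ⊗ V)` with a vector, the coefficient of `dx`. -/
def del (v : V) : DeRhamAlg (prodOneForms Y V) →ₗ[ℝ] DeRhamAlg (prodOneForms Y V) :=
  lift fun n => match n with
    | 0 => 0
    | q + 1 => incl _ q ∘ₗ FormOn.del v q

/-- The second contraction of forms on `Y × (Ω^1 ⊗ V)` with a vector, the coefficient of
`dy ∧ dx`. -/
def del₂ (v : V) : DeRhamAlg (prodOneForms Y V) →ₗ[ℝ] DeRhamAlg (prodOneForms Y V) :=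
  lift fun n => match n with
    | 0 => 0
    | 1 => 0
    | q + 2 => incl _ q ∘ₗ FormOn.del₂ v q

variable (v : V) {q : ℕ}

theorem del_incl_zero (τ : FormOn (prodOneForms Y V) 0) : del v (incl _ 0 τ) = 0 :=
  lift_incl _ τ

theorem del_incl_succ (τ : FormOn (prodOneForms Y V) (q + 1)) :
    del v (incl _ (q + 1) τ) = incl _ q (FormOn.del v q τ) :=
  lift_incl _ τ

theorem del₂_incl_zero (τ : FormOn (prodOneForms Y V) 0) : del₂ v (incl _ 0 τ) = 0 :=
  lift_incl _ τ

theorem del₂_incl_one (τ : FormOn (prodOneForms Y V) 1) : del₂ v (incl _ 1 τ) = 0 :=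
  lift_incl _ τ

theorem del₂_incl_add_two (τ : FormOn (prodOneForms Y V) (q + 2)) :
    del₂ v (incl _ (q + 2) τ) = incl _ q (FormOn.del₂ v q τ) :=
  lift_incl _ τ

theorem eval_del (s : (prodOneForms Y V).obj (op M)) (τ : DeRhamAlg (prodOneForms Y V)) :
    eval M s (del v τ) = Forms.coeffX (eval (M.prodSpace Plane) (addSlot s v) τ) := by
  induction τ using induction with
  | h r τ =>
    rw [eval_incl]
    change _ = Forms.pullback _ (Forms.contr ex _)
    rcases r with _ | r
    · rw [del_incl_zero, Forms.contr_incl_zero, map_zero, map_zero]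
    · rw [del_incl_succ, Forms.contr_incl_succ, Forms.pullback_incl, eval_incl]
      rfl
  | hadd x y hx hy => simp only [map_add, hx, hy]

theorem eval_del₂ (s : (prodOneForms Y V).obj (op M)) (τ : DeRhamAlg (prodOneForms Y V)) :
    eval M s (del₂ v τ) = Forms.coeffYX (eval (M.prodSpace Plane) (addSlot s v) τ) := by
  induction τ using induction with
  | h r τ =>
    rw [eval_incl]
    change _ = Forms.pullback _ (Forms.contr ey (Forms.contr ex _))
    rcases r with _ | _ | r
    · rw [del₂_incl_zero, Forms.contr_incl_zero, map_zero, map_zero, map_zero]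
    · rw [del₂_incl_one, Forms.contr_incl_succ, Forms.contr_incl_zero, map_zero, map_zero]
    · rw [del₂_incl_add_two, Forms.contr_incl_succ, Forms.contr_incl_succ, Forms.pullback_incl,
        eval_incl]
      rfl
  | hadd x y hx hy => simp only [map_add, hx, hy]

set_option maxHeartbeats 1000000 in
/-- A form on `Y × (Ω^1 ⊗ V)` at `s + λ ⊗ v`, for the slot form `λ`, is of first order in `λ`
and `dλ`. -/
theorem eval_addSlot (s : (prodOneForms Y V).obj (op M)) (τ : DeRhamAlg (prodOneForms Y V)) :
    eval (M.prodSpace Plane) (addSlot s v) τ =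
      Forms.pullback (fst M Plane) (eval M s τ) +
        Forms.pullback (fst M Plane) (eval M s (del v τ)) * Forms.slot M +
        Forms.pullback (fst M Plane) (eval M s (del₂ v τ)) * Forms.dSlot M := by
  rw [← sub_eq_zero]
  have hf : ∀ (S : SmoothMap (Man.ofSpace Plane.{u}) (Man.ofSpace Plane.{u})) (a : Forms M),
      Forms.pullback (idProd M S) (Forms.pullback (fst M Plane) a) =
        Forms.pullback (fst M Plane) a := fun S a =>
    (Forms.pullback_comp_apply (fst M Plane) (idProd M S) a).symm
  have hs : ∀ (S : SmoothMap (Man.ofSpace Plane.{u}) (Man.ofSpace Plane.{u})) {r : ℕ}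
      (a : Form (Man.ofSpace Plane.{u}) r),
      Form.pullback (idProd M S) (Form.pullback (snd M Plane) a) =
        Form.pullback (snd M Plane) (Form.pullback S a) := fun S r a =>
    (LinearMap.congr_fun (Form.pullback_comp (snd M Plane) (idProd M S)) a).symm.trans
      (LinearMap.congr_fun (Form.pullback_comp S (snd M Plane)) a)
  -- Both sides are invariant under the symmetries of the slot form and agree after projecting the
  -- plane to the `y`-axis, where `λ` and `dλ` become zero. Their two coefficients agree by the
  -- definition of `del` and `del₂`.
  refine Forms.eq_zero_of_coeff (fun z => ?_) ?_ ?_ ?_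
  · have h1 : Forms.pullback (idProd M (Plane.symm z)) (Forms.slot M) = Forms.slot M := by
      rw [Forms.slot, Forms.pullback_incl, hs, pullback_symm_slotForm]
    have h2 : Forms.pullback (idProd M (Plane.symm z)) (Forms.dSlot M) = Forms.dSlot M := by
      rw [Forms.dSlot, Forms.pullback_incl, hs, Form.pullback_d, pullback_symm_slotForm]
    rw [map_sub, map_add, map_add, map_mul, map_mul, hf, hf, hf, h1, h2]
    rw [← eval_map (idProd M (Plane.symm z) : M.prodSpace Plane ⟶ M.prodSpace Plane),
      map_symm_addSlot]
  · have h1 : Forms.pullback (idProd M Plane.proj) (Forms.slot M) = 0 := by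
      rw [Forms.slot, Forms.pullback_incl, hs, pullback_proj_slotForm, map_zero, map_zero]
    have h2 : Forms.pullback (idProd M Plane.proj) (Forms.dSlot M) = 0 := by
      rw [Forms.dSlot, Forms.pullback_incl, hs, Form.pullback_d, pullback_proj_slotForm, map_zero,
        map_zero, map_zero]
    rw [map_sub, map_add, map_add, map_mul, map_mul, hf, h1, h2, mul_zero, mul_zero, add_zero,
      add_zero]
    rw [← eval_map (idProd M Plane.proj : M.prodSpace Plane ⟶ M.prodSpace Plane),
      map_proj_addSlot, eval_map, sub_self]
  · rw [map_sub, map_add, map_add, Forms.coeffX_pullback_fst, Forms.coeffX_mul_slot,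
      Forms.coeffX_mul_dSlot, ← eval_del, zero_add, add_zero, sub_self]
  · rw [map_sub, map_add, map_add, Forms.coeffYX_pullback_fst, Forms.coeffYX_mul_slot,
      Forms.coeffYX_mul_dSlot, ← eval_del₂, zero_add, zero_add, sub_self]

-- The expansion for the universal section `addSlot s v` is pulled back along `(id, m)` to `M`.
set_option maxHeartbeats 1000000 in
theorem eval_addForm (m : SmoothMap M (Man.ofSpace Plane.{u}))
    (s : (prodOneForms Y V).obj (op M)) (τ : DeRhamAlg (prodOneForms Y V)) :
    eval M (addForm s (Form.pullback m slotForm ⊗ₜ v)) τ = eval M s τ +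
      eval M s (del v τ) * Forms.incl 1 (Form.pullback m slotForm) +
      eval M s (del₂ v τ) * Forms.incl 2 (Form.d 1 (Form.pullback m slotForm)) := by
  have h := congrArg (Forms.pullback (pair ContMDiffMap.id m)) (eval_addSlot v s τ)
  have hf : ∀ a : Forms M, Forms.pullback (pair ContMDiffMap.id m)
      (Forms.pullback (fst M Plane) a) = a := fun a =>
    (Forms.pullback_comp_apply (fst M Plane) (pair ContMDiffMap.id m) a).symm.trans
      (Forms.pullback_id_apply a)
  have hs : ∀ {r : ℕ} (a : Form (Man.ofSpace Plane.{u}) r),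
      Form.pullback (pair ContMDiffMap.id m) (Form.pullback (snd M Plane) a) =
        Form.pullback m a := fun a =>
    (LinearMap.congr_fun (Form.pullback_comp (snd M Plane) (pair ContMDiffMap.id m)) a).symm
  rw [← eval_map (pair ContMDiffMap.id m : M ⟶ M.prodSpace Plane)] at h
  have h' := map_pair_addSlot (𝟙 M) m s v
  have hid : (prodOneForms Y V).map (𝟙 M).op s = s := by
    rw [op_id, CategoryTheory.Functor.map_id]
    rfl
  rw [hid] at h'
  refine (congrArg (fun s => eval M s τ) h').symm.trans (h.trans ?_)
  rw [map_add, map_add, map_mul, map_mul, hf, hf, hf, Forms.slot, Forms.dSlot, Forms.pullback_incl, Forms.pullback_incl, hs, hs, Form.pullback_d]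

end DeRhamAlg

end Sections

theorem Forms.incl_smul {M : Man.{u}} {r : ℕ} (c : ℝ) (a : Form M r) :
    Forms.incl r (c • a) = c • Forms.incl r a := map_smul _ _ _

theorem Form.d_smul {M : Man.{u}} {r : ℕ} (c : ℝ) (a : Form M r) :
    Form.d r (c • a) = c • Form.d r a := map_smul _ _ _

/-! ### Contraction rules for products with `η(ℓ)` and `dη(ℓ)` -/

namespace DeRhamAlg

open Plane SmoothMap

variable {Y : Man.{u}} {V : Type v} [AddCommGroup V] [Module ℝ V] {M N : Man.{u}}

/-- The evaluation of the second factor of a `V`-valued form at an element of the dual. -/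
def pairing (M : Man.{u}) (l : Module.Dual ℝ V) : Form M 1 ⊗[ℝ] V →ₗ[ℝ] Form M 1 :=
  (TensorProduct.rid ℝ (Form M 1)).toLinearMap ∘ₗ l.lTensor (Form M 1)

theorem pairing_tmul (l : Module.Dual ℝ V) (a : Form M 1) (v : V) :
    pairing M l (a ⊗ₜ v) = l v • a := by
  simp [pairing]

variable (Y) in
/-- The `1`-form `η(ℓ)`. -/
def theta (l : Module.Dual ℝ V) : DeRhamAlg (prodOneForms Y V) := incl _ 1 (formOfDual Y l)

variable (Y) in
/-- The `2`-form `d η(ℓ)`. -/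
def dTheta (l : Module.Dual ℝ V) : DeRhamAlg (prodOneForms Y V) :=
  incl _ 2 (FormOn.d 1 (formOfDual Y l))

theorem formOfDual_addForm (l : Module.Dual ℝ V) (s : (prodOneForms Y V).obj (op M))
    (β : Form M 1 ⊗[ℝ] V) :
    (formOfDual Y l).1 M (addForm s β) = (formOfDual Y l).1 M s + pairing M l β :=
  LinearMap.map_add (M := Form M 1 ⊗[ℝ] V) (pairing M l) s.2 β

theorem eval_theta_addForm (l : Module.Dual ℝ V) (s : (prodOneForms Y V).obj (op M))
    (β : Form M 1 ⊗[ℝ] V) :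
    eval M (addForm s β) (theta Y l) = eval M s (theta Y l) + Forms.incl 1 (pairing M l β) := by
  rw [theta, eval_incl, eval_incl, formOfDual_addForm, map_add]

theorem eval_dTheta_addForm (l : Module.Dual ℝ V) (s : (prodOneForms Y V).obj (op M))
    (β : Form M 1 ⊗[ℝ] V) :
    eval M (addForm s β) (dTheta Y l) =
      eval M s (dTheta Y l) + Forms.incl 2 (Form.d 1 (pairing M l β)) := by
  rw [dTheta, eval_incl, eval_incl, ← map_add]
  refine congrArg (Forms.incl 2) ?_
  exact (congrArg (Form.d 1) (formOfDual_addForm l s β)).trans (map_add _ _ _)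

theorem eval_theta_addSlot (l : Module.Dual ℝ V) (s : (prodOneForms Y V).obj (op M)) (v : V) :
    eval (M.prodSpace Plane) (addSlot s v) (theta Y l) =
      Forms.pullback (fst M Plane) (eval M s (theta Y l)) + l v • Forms.slot M := by
  rw [addSlot, eval_theta_addForm, eval_map, pairing_tmul, Forms.incl_smul]
  rfl

theorem eval_dTheta_addSlot (l : Module.Dual ℝ V) (s : (prodOneForms Y V).obj (op M)) (v : V) :
    eval (M.prodSpace Plane) (addSlot s v) (dTheta Y l) =
      Forms.pullback (fst M Plane) (eval M s (dTheta Y l)) + l v • Forms.dSlot M := by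
  rw [addSlot, eval_dTheta_addForm, eval_map, pairing_tmul, Form.d_smul, Forms.incl_smul,
    ← Form.pullback_d]
  rfl

/-- Multiply the expansion of `τ` by `η(ℓ) + ℓ(v) λ`. The terms with `λ λ` and `dλ λ` vanish, and
moving `λ` past the `1`-form `η(ℓ)` produces the minus sign of a right antiderivation. -/
theorem eval_addSlot_mul_theta (l : Module.Dual ℝ V) (s : (prodOneForms Y V).obj (op M)) (v : V)
    (τ : DeRhamAlg (prodOneForms Y V)) :
    eval (M.prodSpace Plane) (addSlot s v) (τ * theta Y l) =
      Forms.pullback (fst M Plane) (eval M s (τ * theta Y l)) +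
        Forms.pullback (fst M Plane) (eval M s (l v • τ - del v τ * theta Y l)) * Forms.slot M +
        Forms.pullback (fst M Plane) (eval M s (del₂ v τ * theta Y l)) * Forms.dSlot M := by
  have h : Forms.slot M * Forms.pullback (fst M Plane) (eval M s (theta Y l)) =
      -(Forms.pullback (fst M Plane) (eval M s (theta Y l)) * Forms.slot M) := by
    rw [theta, eval_incl, Forms.pullback_incl, Forms.slot_mul_incl_one]
  rw [map_mul, eval_addSlot, eval_theta_addSlot]
  simp only [map_mul, map_sub, map_smul, add_mul, mul_add, mul_assoc, h, Forms.dSlot_mul_comm,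
    mul_smul_comm, Forms.slot_mul_slot, Forms.slot_mul_dSlot, mul_zero, mul_neg, add_zero,
    sub_mul, smul_mul_assoc]
  abel

/-- As for `η(ℓ)`, but `dη(ℓ)` has even degree, so no sign occurs, and its increment is a multiple
of `dλ` instead of `λ`. -/
theorem eval_addSlot_mul_dTheta (l : Module.Dual ℝ V) (s : (prodOneForms Y V).obj (op M)) (v : V)
    (τ : DeRhamAlg (prodOneForms Y V)) :
    eval (M.prodSpace Plane) (addSlot s v) (τ * dTheta Y l) =
      Forms.pullback (fst M Plane) (eval M s (τ * dTheta Y l)) +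
        Forms.pullback (fst M Plane) (eval M s (del v τ * dTheta Y l)) * Forms.slot M +
        Forms.pullback (fst M Plane) (eval M s (l v • τ + del₂ v τ * dTheta Y l)) *
          Forms.dSlot M := by
  have h : Forms.slot M * Forms.pullback (fst M Plane) (eval M s (dTheta Y l)) =
      Forms.pullback (fst M Plane) (eval M s (dTheta Y l)) * Forms.slot M := by
    rw [dTheta, eval_incl, Forms.pullback_incl, Forms.slot_mul_comm_of_even]
  rw [map_mul, eval_addSlot, eval_dTheta_addSlot]
  simp only [map_mul, map_add, map_smul, add_mul, mul_add, mul_assoc, h, Forms.dSlot_mul_comm,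
    mul_smul_comm, Forms.slot_mul_dSlot, Forms.dSlot_mul_dSlot, mul_zero, add_zero,
    smul_mul_assoc]
  abel

theorem coeffX_expansion (a b c : Forms M) :
    Forms.coeffX (Forms.pullback (fst M Plane) a + Forms.pullback (fst M Plane) b * Forms.slot M +
      Forms.pullback (fst M Plane) c * Forms.dSlot M) = b := by
  rw [map_add, map_add, Forms.coeffX_pullback_fst, Forms.coeffX_mul_slot, Forms.coeffX_mul_dSlot,
    zero_add, add_zero]

theorem coeffYX_expansion (a b c : Forms M) :
    Forms.coeffYX (Forms.pullback (fst M Plane) a + Forms.pullback (fst M Plane) b * Forms.slot M +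
      Forms.pullback (fst M Plane) c * Forms.dSlot M) = c := by
  rw [map_add, map_add, Forms.coeffYX_pullback_fst, Forms.coeffYX_mul_slot,
    Forms.coeffYX_mul_dSlot, zero_add, zero_add]

variable (v : V) (τ : DeRhamAlg (prodOneForms Y V)) (l : Module.Dual ℝ V)

/-- The coefficients of an expansion in `λ` and `dλ` are unique (`coeffX_expansion`,
`coeffYX_expansion`), so this rule and the next three can be read off from the expansions of the
products. -/
theorem del_mul_theta : del v (τ * theta Y l) = l v • τ - del v τ * theta Y l :=
  eval_ext fun M s => by rw [eval_del, eval_addSlot_mul_theta, coeffX_expansion]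

theorem del₂_mul_theta : del₂ v (τ * theta Y l) = del₂ v τ * theta Y l :=
  eval_ext fun M s => by rw [eval_del₂, eval_addSlot_mul_theta, coeffYX_expansion]

theorem del_mul_dTheta : del v (τ * dTheta Y l) = del v τ * dTheta Y l :=
  eval_ext fun M s => by rw [eval_del, eval_addSlot_mul_dTheta, coeffX_expansion]

theorem del₂_mul_dTheta : del₂ v (τ * dTheta Y l) = l v • τ + del₂ v τ * dTheta Y l :=
  eval_ext fun M s => by rw [eval_del₂, eval_addSlot_mul_dTheta, coeffYX_expansion]

variable (Y V) in
/-- The pullback of forms on `Y` to `Y × (Ω^1 ⊗ V)`, as a linear map. -/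
def baseLinear : Forms Y →ₗ[ℝ] DeRhamAlg (prodOneForms Y V) :=
  Forms.lift fun r => incl _ r ∘ₗ
    { toFun := formOfBase V
      map_add' := fun a b => FormOn.apply_ext fun _ s => map_add (Form.pullback s.1) a b
      map_smul' := fun c a => FormOn.apply_ext fun _ s => LinearMap.map_smul (Form.pullback s.1) c a }

theorem baseLinear_incl {r : ℕ} (b : Form Y r) :
    baseLinear Y V (Forms.incl r b) = incl _ r (formOfBase V b) :=
  Forms.lift_incl _ b

theorem eval_baseLinear (s : (prodOneForms Y V).obj (op M)) (b : Forms Y) :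
    eval M s (baseLinear Y V b) = Forms.pullback s.1 b := by
  induction b using Forms.induction with
  | h r b =>
    rw [baseLinear_incl, eval_incl, Forms.pullback_incl]
    rfl
  | hadd x y hx hy => rw [map_add, map_add, map_add, hx, hy]

variable (Y V) in
/-- The pullback of forms on `Y` to `Y × (Ω^1 ⊗ V)`. -/
def base : Forms Y →ₐ[ℝ] DeRhamAlg (prodOneForms Y V) :=
  AlgHom.ofLinearMap (baseLinear Y V)
    (eval_ext fun M s => by rw [eval_baseLinear, map_one, map_one])
    fun a b => eval_ext fun M s => by
      rw [eval_baseLinear, map_mul, map_mul, eval_baseLinear, eval_baseLinear]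

theorem base_incl {r : ℕ} (b : Form Y r) :
    base Y V (Forms.incl r b) = incl _ r (formOfBase V b) := baseLinear_incl b

theorem eval_base (s : (prodOneForms Y V).obj (op M)) (b : Forms Y) :
    eval M s (base Y V b) = Forms.pullback s.1 b := eval_baseLinear s b

theorem eval_addSlot_base_mul (s : (prodOneForms Y V).obj (op M)) (b : Forms Y) :
    eval (M.prodSpace Plane) (addSlot s v) (base Y V b * τ) =
      Forms.pullback (fst M Plane) (eval M s (base Y V b * τ)) +
        Forms.pullback (fst M Plane) (eval M s (base Y V b * del v τ)) * Forms.slot M +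
        Forms.pullback (fst M Plane) (eval M s (base Y V b * del₂ v τ)) * Forms.dSlot M := by
  have h : eval (M.prodSpace Plane) (addSlot s v) (base Y V b) =
      Forms.pullback (fst M Plane) (eval M s (base Y V b)) := by
    rw [eval_base, eval_base]
    exact Forms.pullback_comp_apply s.1 (fst M Plane) b
  rw [map_mul, h, eval_addSlot]
  simp only [map_mul, mul_add, mul_assoc]

/-- Forms from `Y` do not depend on the `1`-form of the section, so they are constants for the
contractions. They stand on the left because the contractions act from the right. -/
theorem del_base_mul (b : Forms Y) : del v (base Y V b * τ) = base Y V b * del v τ :=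
  eval_ext fun M s => by rw [eval_del, eval_addSlot_base_mul, coeffX_expansion]

theorem del₂_base_mul (b : Forms Y) : del₂ v (base Y V b * τ) = base Y V b * del₂ v τ :=
  eval_ext fun M s => by rw [eval_del₂, eval_addSlot_base_mul, coeffYX_expansion]

theorem del_one : del v (1 : DeRhamAlg (prodOneForms Y V)) = 0 :=
  del_incl_zero v FormOn.one

theorem del₂_one : del₂ v (1 : DeRhamAlg (prodOneForms Y V)) = 0 :=
  del₂_incl_zero v FormOn.one

end DeRhamAlg

/-! ### One-forms on a vector space as sums of pulled back slot forms -/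

namespace Plane

variable {E : Type u} [NormedAddCommGroup E] [NormedSpace ℝ E] [FiniteDimensional ℝ E]

/-- The absolute value of `t` goes into the exponent as `log |t|`, and its sign into `g`. For `t =
0` the sign is `0`, so the value assigned to `log 0` is irrelevant. -/
theorem smul_pullback_mkMap (t : ℝ) (g h : E → ℝ) (hg : ContDiff ℝ ∞ g) (hh : ContDiff ℝ ∞ h) :
    t • Form.pullback (mkMap g h hg hh) slotForm =
      Form.pullback (mkMap (fun x => SignType.sign t * g x) (fun x => h x + Real.log |t|)
        (contDiff_const.mul hg) (hh.add contDiff_const)) slotForm := by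
  refine Form.apply_ext fun x v => ?_
  refine (congrArg (t * ·) (pullback_mkMap_slotForm_apply g h hg hh x v)).trans ?_
  refine Eq.trans ?_ (pullback_mkMap_slotForm_apply _ _ _ _ x v).symm
  have h1 : fderiv ℝ (fun x => (SignType.sign t : ℝ) * g x) x = (SignType.sign t : ℝ) • fderiv ℝ g x :=
    fderiv_const_mul (hg.differentiable (by simp) x) _
  rw [h1]
  change t * (Real.exp (h x) * fderiv ℝ g x (v 0)) =
    Real.exp (h x + Real.log |t|) * ((SignType.sign t : ℝ) * fderiv ℝ g x (v 0))
  rcases eq_or_ne t 0 with rfl | ht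
  · simp
  · rw [Real.exp_add, Real.exp_log (abs_pos.2 ht)]
    have h2 : |t| * (SignType.sign t : ℝ) = t := by rw [mul_comm, sign_mul_abs]
    linear_combination (-(Real.exp (h x) * fderiv ℝ g x (v 0))) * h2

/-- Write `f dl = (f² + f + 1) dl + (f² + 1) d(-l)`. Both coefficients are positive, hence
exponentials of smooth functions. -/
theorem smul_linear_mem_closure (f : E → ℝ) (hf : ContDiff ℝ ∞ f) (l : E →L[ℝ] ℝ)
    (a : Form (Man.ofSpace E) 1) (ha : ∀ x v, a.1 x v = f x * l (v 0)) :
    a ∈ AddSubmonoid.closure {a : Form (Man.ofSpace E) 1 | ∃ (g h : E → ℝ) (hg : ContDiff ℝ ∞ g)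
      (hh : ContDiff ℝ ∞ h), a = Form.pullback (mkMap g h hg hh) slotForm} := by
  have h1 : ∀ x, f x ^ 2 + f x + 1 ≠ 0 := fun x => by nlinarith [sq_nonneg (f x + 1 / 2)]
  have h1' : ∀ x, 0 < f x ^ 2 + f x + 1 := fun x => by nlinarith [sq_nonneg (f x + 1 / 2)]
  have h2 : ∀ x, 0 < f x ^ 2 + 1 := fun x => by positivity
  have c1 : ContDiff ℝ ∞ fun x => Real.log (f x ^ 2 + f x + 1) :=
    (((hf.pow 2).add hf).add contDiff_const).log h1
  have c2 : ContDiff ℝ ∞ fun x => Real.log (f x ^ 2 + 1) :=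
    ((hf.pow 2).add contDiff_const).log fun x => (h2 x).ne'
  have e : a = Form.pullback (mkMap l _ l.contDiff c1) slotForm +
      Form.pullback (mkMap (-l) _ (-l).contDiff c2) slotForm := by
    refine Form.apply_ext fun x v => (ha x v).trans ?_
    refine Eq.trans ?_ (congrArg₂ (· + ·) (pullback_mkMap_slotForm_apply _ _ l.contDiff c1 x v)
      (pullback_mkMap_slotForm_apply _ _ (-l).contDiff c2 x v)).symm
    have e1 : fderiv ℝ (l : E → ℝ) x = l := l.fderiv
    have e2 : fderiv ℝ (-l : E →L[ℝ] ℝ) x = -l := (-l).fderiv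
    rw [Real.exp_log (h1' x), Real.exp_log (h2 x), e1]
    change _ = _ + (f x ^ 2 + 1) * fderiv ℝ (-l : E →L[ℝ] ℝ) x (v 0)
    rw [e2]
    change _ = _ + (f x ^ 2 + 1) * -(l (v 0))
    ring
  rw [e]
  exact add_mem (AddSubmonoid.subset_closure ⟨_, _, _, _, rfl⟩)
    (AddSubmonoid.subset_closure ⟨_, _, _, _, rfl⟩)

/-- A `1`-form is the sum of its coordinate terms `f dl`. No scalars are needed, which permits an
induction that adds one slot form at a time. -/
theorem closure_slots : AddSubmonoid.closure {a : Form (Man.ofSpace E) 1 | ∃ (g h : E → ℝ)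
    (hg : ContDiff ℝ ∞ g) (hh : ContDiff ℝ ∞ h),
      a = Form.pullback (mkMap g h hg hh) slotForm} = ⊤ := by
  refine eq_top_iff.2 fun a _ => ?_
  let b := Module.finBasis ℝ E
  have hf : ∀ j, ContDiff ℝ ∞ fun x : E => a.1 x fun _ => b j := fun j =>
    (ContinuousAlternatingMap.apply ℝ E ℝ (fun _ : Fin 1 => b j)).contDiff.comp
      (Form.contDiff_ofSpace a)
  let l : Fin (Module.finrank ℝ E) → E →L[ℝ] ℝ := fun j => (b.coord j).toContinuousLinearMap
  let c : Fin (Module.finrank ℝ E) → Form (Man.ofSpace E) 1 := fun j =>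
    Form.ofFun (fun x => (a.1 x fun _ => b j) •
      ContinuousAlternatingMap.ofSubsingleton ℝ E ℝ (0 : Fin 1) (l j))
      ((hf j).smul contDiff_const)
  have e : a = ∑ j, c j := by
    refine Form.apply_ext fun x v => ?_
    have h1 : ((∑ j, c j : Form (Man.ofSpace E) 1).1 x : E [⋀^Fin 1]→L[ℝ] ℝ) v =
        ∑ j, (a.1 x fun _ => b j) * l j (v 0) := by
      have : ∀ s : Finset (Fin (Module.finrank ℝ E)),
          ((∑ j ∈ s, c j : Form (Man.ofSpace E) 1).1 x : E [⋀^Fin 1]→L[ℝ] ℝ) v =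
            ∑ j ∈ s, (a.1 x fun _ => b j) * l j (v 0) := fun s => by
        induction s using Finset.induction_on with
        | empty => rfl
        | insert j s hj ih =>
          rw [Finset.sum_insert hj, Finset.sum_insert hj, ← ih]
          rfl
      exact this _
    refine Eq.trans ?_ h1.symm
    let A : E →ₗ[ℝ] ℝ := ((ContinuousAlternatingMap.ofSubsingleton ℝ E ℝ (0 : Fin 1)).symm
      (a.1 x)).toLinearMap
    have hA : ∀ w : Fin 1 → E, a.1 x w = A (w 0) := fun w => by
      refine congrArg (a.1 x) (funext fun i => ?_)
      rw [Subsingleton.elim i 0]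
    refine (hA v).trans ?_
    have hv : A (v 0) = A (∑ j, b.repr (v 0) j • b j) := congrArg A (b.sum_repr (v 0)).symm
    rw [hv, map_sum]
    refine Finset.sum_congr rfl fun j _ => ?_
    rw [map_smul, smul_eq_mul, mul_comm]
    rfl
  rw [e]
  exact sum_mem fun j _ => smul_linear_mem_closure _ (hf j) (l j) _ fun x v => rfl

end Plane

/-! ### The Euler operator on forms and its kernel -/

namespace DeRhamAlg

open Plane SmoothMap

variable {Y : Man.{u}} {V : Type v} [AddCommGroup V] [Module ℝ V] {M N : Man.{u}}
  {ι : Type*} [Fintype ι] (b : Module.Basis ι ℝ V)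

/-- The Euler operator `τ ↦ ∑ᵢ (∂ᵢ τ) θᵢ + (∂'ᵢ τ) dθᵢ`. -/
def euler (τ : DeRhamAlg (prodOneForms Y V)) : DeRhamAlg (prodOneForms Y V) :=
  ∑ i, (del (b i) τ * theta Y (b.coord i) + del₂ (b i) τ * dTheta Y (b.coord i))

/-- The derivative of a form on `Y × (Ω^1 ⊗ V)` at a section in the direction of a `V`-valued
form. -/
def variation (s : (prodOneForms Y V).obj (op M)) (τ : DeRhamAlg (prodOneForms Y V)) :
    Form M 1 ⊗[ℝ] V →ₗ[ℝ] Forms M :=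
  ∑ i, (LinearMap.mulLeft ℝ (eval M s (del (b i) τ)) ∘ₗ Forms.incl 1 ∘ₗ pairing M (b.coord i) +
    LinearMap.mulLeft ℝ (eval M s (del₂ (b i) τ)) ∘ₗ Forms.incl 2 ∘ₗ Form.d 1 ∘ₗ
      pairing M (b.coord i))

theorem variation_apply (s : (prodOneForms Y V).obj (op M)) (τ : DeRhamAlg (prodOneForms Y V))
    (β : Form M 1 ⊗[ℝ] V) : variation b s τ β =
      ∑ i, (eval M s (del (b i) τ) * Forms.incl 1 (pairing M (b.coord i) β) +
        eval M s (del₂ (b i) τ) * Forms.incl 2 (Form.d 1 (pairing M (b.coord i) β))) := by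
  rw [variation, LinearMap.sum_apply]
  rfl

theorem variation_tmul (s : (prodOneForms Y V).obj (op M)) (τ : DeRhamAlg (prodOneForms Y V))
    (a : Form M 1) (j : ι) : variation b s τ (a ⊗ₜ b j) =
      eval M s (del (b j) τ) * Forms.incl 1 a + eval M s (del₂ (b j) τ) * Forms.incl 2 (Form.d 1 a) := by
  classical
  rw [variation_apply, Finset.sum_eq_single j]
  · rw [pairing_tmul, Module.Basis.coord_apply, Module.Basis.repr_self, Finsupp.single_eq_same,
      one_smul]
  · intro i _ hij
    rw [pairing_tmul, Module.Basis.coord_apply, Module.Basis.repr_self,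
      Finsupp.single_eq_of_ne hij, zero_smul, map_zero, map_zero, map_zero, mul_zero, mul_zero,
      add_zero]
  · exact fun h => absurd (Finset.mem_univ j) h

/-- Since `s` has vanishing `1`-form, at `s + t β` the forms `θᵢ` and `dθᵢ` take the values `t βᵢ`
and `t dβᵢ`, from which one factor `t` comes out. -/
theorem eval_euler (β : Form M 1 ⊗[ℝ] V) (t : ℝ) (s : (prodOneForms Y V).obj (op M))
    (hs : ∀ l : Module.Dual ℝ V, (formOfDual Y l).1 M s = 0)
    (τ : DeRhamAlg (prodOneForms Y V)) :
    eval M (addForm s (t • β)) (euler b τ) = t • variation b (addForm s (t • β)) τ β := by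
  rw [variation_apply, euler, map_sum, Finset.smul_sum]
  refine Finset.sum_congr rfl fun i _ => ?_
  have h1 : eval M (addForm s (t • β)) (theta Y (b.coord i)) =
      t • Forms.incl 1 (pairing M (b.coord i) β) := by
    rw [eval_theta_addForm, theta, eval_incl, hs, map_zero, zero_add, map_smul, Forms.incl_smul]
  have h2 : eval M (addForm s (t • β)) (dTheta Y (b.coord i)) =
      t • Forms.incl 2 (Form.d 1 (pairing M (b.coord i) β)) := by
    have h3 : (FormOn.d 1 (formOfDual Y (b.coord i))).1 M s = 0 :=
      (congrArg (Form.d 1) (hs (b.coord i))).trans (map_zero _)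
    rw [eval_dTheta_addForm, dTheta, eval_incl, h3, map_zero, zero_add, map_smul, Form.d_smul,
      Forms.incl_smul]
  rw [map_add, map_mul, map_mul, h1, h2, mul_smul_comm, mul_smul_comm, smul_add]

variable {E : Type u} [NormedAddCommGroup E] [NormedSpace ℝ E] [FiniteDimensional ℝ E]

variable (E) in
/-- The `V`-valued `1`-forms `g^* λ ⊗ v` for the slot form `λ` and basis vectors `v`. -/
def slotTensors : Set (Form (Man.ofSpace E) 1 ⊗[ℝ] V) :=
  {β | ∃ (g h : E → ℝ) (hg : ContDiff ℝ ∞ g) (hh : ContDiff ℝ ∞ h) (j : ι),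
    β = Form.pullback (mkMap g h hg hh) slotForm ⊗ₜ b j}

theorem smul_mem_slotTensors (t : ℝ) {β : Form (Man.ofSpace E) 1 ⊗[ℝ] V}
    (hβ : β ∈ slotTensors b E) : t • β ∈ slotTensors b E := by
  obtain ⟨g, h, hg, hh, j, rfl⟩ := hβ
  rw [TensorProduct.smul_tmul', smul_pullback_mkMap]
  exact ⟨_, _, _, _, j, rfl⟩

theorem closure_slotTensors : AddSubmonoid.closure (slotTensors b E) = ⊤ := by
  refine eq_top_iff.2 fun β _ => ?_
  induction β using TensorProduct.induction_on with
  | zero => exact zero_mem _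
  | add x y hx hy => exact add_mem (hx trivial) (hy trivial)
  | tmul a v =>
    rw [← b.sum_repr v, TensorProduct.tmul_sum]
    refine sum_mem fun j _ => ?_
    rw [← TensorProduct.smul_tmul]
    have h : ∀ a ∈ AddSubmonoid.closure {a : Form (Man.ofSpace E) 1 | ∃ (g h : E → ℝ)
        (hg : ContDiff ℝ ∞ g) (hh : ContDiff ℝ ∞ h),
          a = Form.pullback (mkMap g h hg hh) slotForm},
        a ⊗ₜ[ℝ] b j ∈ AddSubmonoid.closure (slotTensors b E) := fun a ha => by
      induction ha using AddSubmonoid.closure_induction with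
      | zero =>
        rw [TensorProduct.zero_tmul]
        exact zero_mem _
      | add x y _ _ hx hy =>
        rw [TensorProduct.add_tmul]
        exact add_mem hx hy
      | mem x hx =>
        obtain ⟨g, h, hg, hh, rfl⟩ := hx
        exact AddSubmonoid.subset_closure ⟨g, h, hg, hh, j, rfl⟩
    refine h _ ?_
    rw [closure_slots]
    trivial

theorem eval_addForm_slot {β : Form (Man.ofSpace E) 1 ⊗[ℝ] V} (hβ : β ∈ slotTensors b E)
    (s : (prodOneForms Y V).obj (op (Man.ofSpace E))) (τ : DeRhamAlg (prodOneForms Y V)) :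
    eval (Man.ofSpace E) (addForm s β) τ = eval (Man.ofSpace E) s τ + variation b s τ β := by
  obtain ⟨g, h, hg, hh, j, rfl⟩ := hβ
  rw [eval_addForm, variation_tmul, add_assoc]

theorem eval_addForm_smul_slot {β : Form (Man.ofSpace E) 1 ⊗[ℝ] V} (hβ : β ∈ slotTensors b E)
    (s : (prodOneForms Y V).obj (op (Man.ofSpace E))) (τ : DeRhamAlg (prodOneForms Y V)) (t : ℝ) :
    eval (Man.ofSpace E) (addForm s (t • β)) τ =
      eval (Man.ofSpace E) s τ + t • variation b s τ β := by
  rw [eval_addForm_slot b (smul_mem_slotTensors b t hβ), map_smul]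

/-- As multiples of a slot tensor are slot tensors, `t ↦ τ(s + t β)` is affine. Computing `τ(s + (t
+ 1) β)` from `s` and from `s + t β` shows that its slope is constant along the line. -/
theorem variation_addForm_smul_slot {β : Form (Man.ofSpace E) 1 ⊗[ℝ] V}
    (hβ : β ∈ slotTensors b E) (s : (prodOneForms Y V).obj (op (Man.ofSpace E)))
    (τ : DeRhamAlg (prodOneForms Y V)) (t : ℝ) :
    variation b (addForm s (t • β)) τ β = variation b s τ β := by
  have h1 := eval_addForm_smul_slot b hβ s τ (t + 1)
  rw [add_smul, one_smul, ← addForm_add, eval_addForm_slot b hβ, eval_addForm_smul_slot b hβ,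
    add_smul, one_smul, ← add_assoc] at h1
  exact add_left_cancel h1

/-- An arbitrary `β` is a sum of slot tensors, and `τ` is affine in the direction of each one. The
functional `L` turns the statement into one about real functions, so no topology on the space of
forms is required. -/
theorem hasDerivAt_eval_addForm (β : Form (Man.ofSpace E) 1 ⊗[ℝ] V)
    (L : Forms (Man.ofSpace E) →ₗ[ℝ] ℝ) (τ : DeRhamAlg (prodOneForms Y V))
    (s : (prodOneForms Y V).obj (op (Man.ofSpace E))) (t : ℝ) :
    HasDerivAt (fun t : ℝ => L (eval (Man.ofSpace E) (addForm s (t • β)) τ))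
      (L (variation b (addForm s (t • β)) τ β)) t := by
  have hβ : β ∈ AddSubmonoid.closure (slotTensors b E) := by
    rw [closure_slotTensors]
    trivial
  -- The base point stays free, because the induction hypothesis for `y` is applied at the sections
  -- `s + c x` with `x` a slot tensor.
  induction hβ using AddSubmonoid.closure_induction_left generalizing s t with
  | zero =>
    simp only [smul_zero, map_zero]
    exact hasDerivAt_const t _
  | add_left x hx y _ ih =>
    let A : ℝ → ℝ := fun t => L (eval (Man.ofSpace E) (addForm s (t • y)) τ)
    let B : ℝ → ℝ := fun t => L (variation b (addForm s (t • y)) τ x)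
    let G : ℝ → ℝ := fun c => L (variation b (addForm (addForm s (c • x)) (t • y)) τ y)
    have hAB : ∀ c t, L (eval (Man.ofSpace E) (addForm (addForm s (c • x)) (t • y)) τ) =
        A t + c * B t := fun c t => by
      rw [addForm_add, add_comm, ← addForm_add, eval_addForm_smul_slot b hx, map_add, map_smul,
        smul_eq_mul]
    -- Along `y` the function `A + c B` is differentiable for each fixed `c`. The values `c = 0` and
    -- `c = 1` give the derivatives of `A` and `B` separately.
    have hG : ∀ c, HasDerivAt (fun t => A t + c * B t) (G c) t := fun c => by
      have h := ih (addForm s (c • x)) t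
      simp only [hAB] at h
      exact h
    have hA : HasDerivAt A (G 0) t := by simpa using hG 0
    have hB : HasDerivAt B (G 1 - G 0) t := by
      refine ((hG 1).sub hA).congr_of_eventuallyEq (Filter.Eventually.of_forall fun t => ?_)
      simp only [Pi.sub_apply, one_mul, add_sub_cancel_left]
    -- Uniqueness of the derivative, for `c` equal to the point `t` itself, shows that `G` is
    -- affine; this matches the product rule for `A + t B` on the diagonal.
    have hGt : G t = G 0 + t * (G 1 - G 0) :=
      (hG t).unique (hA.add (hB.const_mul t))
    have hfun : (fun t : ℝ => L (eval (Man.ofSpace E) (addForm s (t • (x + y))) τ)) =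
        fun t => A t + t * B t := funext fun t => by
      rw [← hAB, addForm_add, smul_add]
    have hval : L (variation b (addForm s (t • (x + y))) τ (x + y)) =
        G 0 + (1 * B t + t * (G 1 - G 0)) := by
      have h1 : variation b (addForm s (t • (x + y))) τ x = variation b (addForm s (t • y)) τ x := by
        rw [smul_add, add_comm, ← addForm_add, variation_addForm_smul_slot b hx]
      have h2 : L (variation b (addForm s (t • (x + y))) τ y) = G t := by
        rw [smul_add, ← addForm_add]
      rw [map_add, map_add, h1, h2, hGt]
      ring
    rw [hfun, hval]
    exact hA.add ((hasDerivAt_id t).mul hB)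

/-- The section `(φ, 0)`. -/
def zeroSection (φ : M ⟶ Y) : (prodOneForms Y V).obj (op M) := (φ, (0 : Form M 1 ⊗[ℝ] V))

theorem map_zeroSection (f : M ⟶ N) (φ : N ⟶ Y) :
    (prodOneForms Y V).map f.op (zeroSection (V := V) φ) = zeroSection (f ≫ φ) :=
  Prod.ext rfl (map_zero ((Form.pullback f).rTensor V))

theorem formOfDual_zeroSection (φ : M ⟶ Y) (l : Module.Dual ℝ V) :
    (formOfDual Y l).1 M (zeroSection φ) = 0 :=
  map_zero (pairing M l)

theorem addForm_zeroSection (s : (prodOneForms Y V).obj (op M)) :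
    addForm (zeroSection s.1) (s.2 : Form M 1 ⊗[ℝ] V) = s :=
  Prod.ext rfl (zero_add (M := Form M 1 ⊗[ℝ] V) s.2)

/-- Along the segment from `(φ, 0)` to `(φ, α)` the derivative of `τ` is the Euler operator divided
by `t`, so the mean value theorem shows that the end values agree. -/
theorem eval_ofSpace_of_euler_eq_zero {τ : DeRhamAlg (prodOneForms Y V)} (hτ : euler b τ = 0)
    (s : (prodOneForms Y V).obj (op (Man.ofSpace E))) :
    eval (Man.ofSpace E) s τ = eval (Man.ofSpace E) (zeroSection s.1) τ := by
  rw [← sub_eq_zero, ← Module.forall_dual_apply_eq_zero_iff ℝ]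
  intro L
  let β : Form (Man.ofSpace E) 1 ⊗[ℝ] V := s.2
  let h : ℝ → ℝ := fun t => L (eval (Man.ofSpace E) (addForm (zeroSection s.1) (t • β)) τ)
  have hd := hasDerivAt_eval_addForm b β L τ (zeroSection s.1)
  -- The intermediate point `c` lies in the open interval, so one may divide by it in `eval_euler`.
  obtain ⟨c, hc, hc'⟩ := exists_hasDerivAt_eq_slope h _ (zero_lt_one' ℝ)
    (fun t _ => (hd t).continuousAt.continuousWithinAt) fun t _ => hd t
  have h0 : L (variation b (addForm (zeroSection s.1) (c • β)) τ β) = 0 := by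
    have e := congrArg L (eval_euler b β c (zeroSection s.1) (formOfDual_zeroSection s.1) τ)
    rw [hτ, map_zero, map_zero, map_smul, smul_eq_mul, eq_comm] at e
    exact (mul_eq_zero.1 e).resolve_left hc.1.ne'
  rw [h0, sub_zero, div_one] at hc'
  have e1 : h 1 = L (eval (Man.ofSpace E) s τ) := by
    change L (eval (Man.ofSpace E) (addForm (zeroSection s.1) ((1 : ℝ) • β)) τ) = _
    rw [one_smul, addForm_zeroSection]
  have e0 : h 0 = L (eval (Man.ofSpace E) (zeroSection s.1) τ) := by
    change L (eval (Man.ofSpace E) (addForm (zeroSection s.1) ((0 : ℝ) • β)) τ) = _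
    rw [zero_smul, addForm_zero]
  rw [map_sub, ← e1, ← e0, ← hc']

end DeRhamAlg

/-- Every point of a manifold is in the image of a smooth map from the model space which is a
local diffeomorphism there. -/
theorem exists_smoothMap_model (M : Man.{u}) (x : M.carrier) :
    ∃ (f : SmoothMap (Man.ofSpace M.model) M) (y : M.model), f y = x ∧
      ∀ w : M.model, ∃ w' : M.model,
        (mfderiv 𝓘(ℝ, M.model) 𝓘(ℝ, M.model) f y w' : M.model) = w := by
  let c := chartAt M.model x
  have hx : c x ∈ c.target := c.map_source (mem_chart_source M.model x)
  obtain ⟨ε, hε, hball⟩ := Metric.isOpen_iff.1 c.open_target (c x) hx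
  let b : ContDiffBump (0 : M.model) := ⟨ε / 2, ε, by positivity, by linarith⟩
  -- This map is the identity near `c x` and is damped so that all its values stay in the ball of
  -- radius `ε` inside the chart target. Hence `c.symm ∘ g` is smooth on the whole model space and
  -- coincides with `c.symm` near `c x`.
  let g : M.model → M.model := fun y => c x + b (y - c x) • (y - c x)
  have hg : ContDiff ℝ ∞ g := contDiff_const.add
    ((b.contDiff.comp (contDiff_id.sub contDiff_const)).smul (contDiff_id.sub contDiff_const))
  have hgt : ∀ y, g y ∈ c.target := fun y => by
    refine hball ?_
    rw [mem_ball_iff_norm, add_sub_cancel_left, norm_smul, Real.norm_of_nonneg b.nonneg]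
    by_cases hy : ‖y - c x‖ < ε
    · exact (mul_le_of_le_one_left (norm_nonneg _) b.le_one).trans_lt hy
    · rw [b.zero_of_le_dist (by rw [dist_zero_right]; exact not_lt.1 hy), zero_mul]
      exact hε
  have hf : ContMDiff 𝓘(ℝ, M.model) 𝓘(ℝ, M.model) ∞ fun y => c.symm (g y) :=
    ContMDiffOn.comp_contMDiff (contMDiffOn_chart_symm (n := ∞) (x := x)) hg.contMDiff hgt
  have hev : (fun y => c.symm (g y)) =ᶠ[nhds (c x)] c.symm := by
    filter_upwards [Metric.ball_mem_nhds (c x) (half_pos hε)] with y hy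
    have : b (y - c x) = 1 := b.one_of_mem_closedBall (by
      rw [mem_closedBall_zero_iff]
      exact (mem_ball_iff_norm.1 hy).le)
    simp only [g, this, one_smul, add_sub_cancel]
  refine ⟨⟨_, hf⟩, c x, ?_, fun w => ?_⟩
  · exact hev.self_of_nhds.trans (c.left_inv (mem_chart_source M.model x))
  · refine ⟨mfderiv 𝓘(ℝ, M.model) 𝓘(ℝ, M.model) c x w, ?_⟩
    refine Eq.trans ?_ (mfderiv_symm_comp x (mem_chart_source M.model x) w)
    exact congrArg (fun T : M.model →L[ℝ] M.model => T (mfderiv 𝓘(ℝ, M.model) 𝓘(ℝ, M.model) c x w))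
      hev.mfderiv_eq

theorem Form.eq_zero_of_pullback {M : Man.{u}} {r : ℕ} (a : Form M r)
    (h : ∀ f : SmoothMap (Man.ofSpace M.model) M, Form.pullback f a = 0) : a = 0 := by
  refine Form.apply_ext fun x v => ?_
  obtain ⟨f, y, rfl, hf⟩ := exists_smoothMap_model M x
  choose w hw using fun i => hf (v i)
  have e := DFunLike.congr_fun (congrFun (congrArg Subtype.val (h f)) y) w
  refine Eq.trans ?_ e
  exact formField_congr a.1 rfl _ _ fun i => (hw i).symm

theorem Forms.eq_zero_of_pullback {M : Man.{u}} (a : Forms M)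
    (h : ∀ f : SmoothMap (Man.ofSpace M.model) M, Forms.pullback f a = 0) : a = 0 :=
  Forms.component_ext fun r => by
    rw [map_zero]
    refine Form.eq_zero_of_pullback _ fun f => ?_
    rw [← Forms.component_pullback, h, map_zero]

namespace DeRhamAlg

variable {Y : Man.{u}} {V : Type v} [AddCommGroup V] [Module ℝ V] {M N : Man.{u}}
  {ι : Type*} [Fintype ι] (b : Module.Basis ι ℝ V)

/-- Smooth maps from the model space detect forms on `M`, so `τ(φ, α) = τ(φ, 0)` holds on every
manifold. Since `(φ, 0)` is the pullback of `(id, 0)` along `φ`, the form on `Y` is the value of `τ`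
at `(id, 0)`. -/
theorem mem_range_base_of_euler_eq_zero {τ : DeRhamAlg (prodOneForms Y V)}
    (hτ : euler b τ = 0) : τ ∈ (base Y V).range := by
  refine ⟨eval Y (zeroSection (𝟙 Y)) τ, eval_ext fun M s => ?_⟩
  change eval M s (base Y V _) = _
  have h1 : eval M s τ = eval M (zeroSection s.1) τ := by
    rw [← sub_eq_zero]
    refine Forms.eq_zero_of_pullback _ fun f => ?_
    have e := eval_ofSpace_of_euler_eq_zero b hτ
      ((prodOneForms Y V).map (Quiver.Hom.op (f : Man.ofSpace M.model ⟶ M)) s)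
    have e2 := map_zeroSection (V := V) (f : Man.ofSpace M.model ⟶ M) s.1
    rw [eval_map] at e
    rw [map_sub, e, ← eval_map (f : Man.ofSpace M.model ⟶ M), e2]
    exact sub_self _
  have h2 := map_zeroSection (V := V) s.1 (𝟙 Y)
  rw [Category.comp_id] at h2
  rw [eval_base, h1, ← h2]
  exact (eval_map (s.1 : M ⟶ Y) (zeroSection (𝟙 Y)) τ).symm

end DeRhamAlg

end NatForm
end

noncomputable section

/-! ### Derivations of the symmetric algebra -/

namespace SymmetricAlgebra

variable {W : Type*} [AddCommGroup W] [Module ℝ W]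

/-- The algebra map `x ↦ x + (∂_f x) ε` to the dual numbers. -/
def toDualNumber (f : Module.Dual ℝ W) :
    SymmetricAlgebra ℝ W →ₐ[ℝ] DualNumber (SymmetricAlgebra ℝ W) :=
  lift ((TrivSqZeroExt.inlAlgHom ℝ (SymmetricAlgebra ℝ W) (SymmetricAlgebra ℝ W)).toLinearMap ∘ₗ
      ι ℝ W + (TrivSqZeroExt.inrHom (SymmetricAlgebra ℝ W) (SymmetricAlgebra ℝ W)).restrictScalars ℝ
        ∘ₗ (Algebra.linearMap ℝ (SymmetricAlgebra ℝ W)) ∘ₗ f)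

/-- The directional derivative, the derivation with `∂_f w = f w` for `w ∈ W`. -/
def partialDeriv (f : Module.Dual ℝ W) : SymmetricAlgebra ℝ W →ₗ[ℝ] SymmetricAlgebra ℝ W :=
  (TrivSqZeroExt.sndHom (SymmetricAlgebra ℝ W) (SymmetricAlgebra ℝ W)).restrictScalars ℝ ∘ₗ
    (toDualNumber f).toLinearMap

variable (f : Module.Dual ℝ W)

theorem toDualNumber_ι (w : W) : toDualNumber f (ι ℝ W w) =
    TrivSqZeroExt.inl (ι ℝ W w) + TrivSqZeroExt.inr (algebraMap ℝ _ (f w)) :=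
  lift_ι_apply _ w

theorem fst_toDualNumber (x : SymmetricAlgebra ℝ W) : (toDualNumber f x).fst = x := by
  have h : (TrivSqZeroExt.fstHom ℝ (SymmetricAlgebra ℝ W) (SymmetricAlgebra ℝ W)).comp
      (toDualNumber f) = AlgHom.id ℝ (SymmetricAlgebra ℝ W) := by
    refine algHom_ext (LinearMap.ext fun w => ?_)
    change (toDualNumber f (ι ℝ W w)).fst = ι ℝ W w
    rw [toDualNumber_ι, TrivSqZeroExt.fst_add, TrivSqZeroExt.fst_inl, TrivSqZeroExt.fst_inr,
      add_zero]
  exact DFunLike.congr_fun h x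

theorem partialDeriv_one : partialDeriv f 1 = 0 := by
  change (toDualNumber f 1).snd = 0
  rw [map_one, TrivSqZeroExt.snd_one]

theorem partialDeriv_mul_ι (x : SymmetricAlgebra ℝ W) (w : W) :
    partialDeriv f (x * ι ℝ W w) = f w • x + partialDeriv f x * ι ℝ W w := by
  change (toDualNumber f (x * ι ℝ W w)).snd = f w • x + (toDualNumber f x).snd * ι ℝ W w
  rw [map_mul, TrivSqZeroExt.snd_mul, fst_toDualNumber, fst_toDualNumber, toDualNumber_ι,
    TrivSqZeroExt.snd_add, TrivSqZeroExt.snd_inl, TrivSqZeroExt.snd_inr, zero_add, smul_eq_mul,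
    mul_comm x, ← Algebra.smul_def, op_smul_eq_mul]

end SymmetricAlgebra

namespace NatForm

open scoped Form FormOn

/-! ### Contractions on the Koszul algebra -/

namespace Koszul

variable {W : Type w} [AddCommGroup W] [Module ℝ W]

/-- The contraction of the exterior factor, a right antiderivation. -/
def delGen (f : Module.Dual ℝ W) : Koszul W →ₗ[ℝ] Koszul W :=
  LinearMap.rTensor (SymmetricAlgebra ℝ W)
    ((CliffordAlgebra.contractRight (Q := (0 : QuadraticForm ℝ W))).flip f)

/-- The directional derivative of the symmetric factor. -/
def delGenTilde (f : Module.Dual ℝ W) : Koszul W →ₗ[ℝ] Koszul W :=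
  LinearMap.lTensor (ExteriorAlgebra ℝ W) (SymmetricAlgebra.partialDeriv f)

variable (f : Module.Dual ℝ W) (k : Koszul W) (x : W)

theorem delGen_one : delGen f 1 = 0 := by
  rw [Algebra.TensorProduct.one_def, delGen, LinearMap.rTensor_tmul]
  erw [CliffordAlgebra.contractRight_one]
  exact TensorProduct.zero_tmul _ _

theorem delGenTilde_one : delGenTilde f 1 = 0 := by
  rw [Algebra.TensorProduct.one_def, delGenTilde, LinearMap.lTensor_tmul,
    SymmetricAlgebra.partialDeriv_one, TensorProduct.tmul_zero]

/-- The same right antiderivation rule as `DeRhamAlg.del_mul_theta`; it is the reason for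
contracting from the right. -/
theorem delGen_mul_gen : delGen f (k * gen x) = f x • k - delGen f k * gen x := by
  induction k using TensorProduct.induction_on with
  | zero => simp
  | add k k' h h' => rw [add_mul, map_add, h, h', map_add, add_mul, smul_add]; abel
  | tmul a s =>
    have h : CliffordAlgebra.contractRight (Q := (0 : QuadraticForm ℝ W))
        (a * ExteriorAlgebra.ι ℝ x) f = f x • a -
          CliffordAlgebra.contractRight (Q := (0 : QuadraticForm ℝ W)) a f *
            ExteriorAlgebra.ι ℝ x := CliffordAlgebra.contractRight_mul_ι f x a
    rw [gen, Algebra.TensorProduct.tmul_mul_tmul, mul_one, delGen, LinearMap.rTensor_tmul,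
      LinearMap.rTensor_tmul, LinearMap.flip_apply, LinearMap.flip_apply, h,
      Algebra.TensorProduct.tmul_mul_tmul, mul_one, TensorProduct.sub_tmul,
      TensorProduct.smul_tmul']

theorem delGenTilde_mul_gen : delGenTilde f (k * gen x) = delGenTilde f k * gen x := by
  induction k using TensorProduct.induction_on with
  | zero => simp
  | add k k' h h' => rw [add_mul, map_add, h, h', map_add, add_mul]
  | tmul a s =>
    rw [gen, Algebra.TensorProduct.tmul_mul_tmul, mul_one, delGenTilde, LinearMap.lTensor_tmul,
      LinearMap.lTensor_tmul, Algebra.TensorProduct.tmul_mul_tmul, mul_one]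

theorem delGen_mul_genTilde : delGen f (k * genTilde x) = delGen f k * genTilde x := by
  induction k using TensorProduct.induction_on with
  | zero => simp
  | add k k' h h' => rw [add_mul, map_add, h, h', map_add, add_mul]
  | tmul a s =>
    rw [genTilde, Algebra.TensorProduct.tmul_mul_tmul, mul_one, delGen, LinearMap.rTensor_tmul,
      LinearMap.rTensor_tmul, Algebra.TensorProduct.tmul_mul_tmul, mul_one]

theorem delGenTilde_mul_genTilde :
    delGenTilde f (k * genTilde x) = f x • k + delGenTilde f k * genTilde x := by
  induction k using TensorProduct.induction_on with
  | zero => simp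
  | add k k' h h' => rw [add_mul, map_add, h, h', map_add, add_mul, smul_add]; abel
  | tmul a s =>
    rw [genTilde, Algebra.TensorProduct.tmul_mul_tmul, mul_one, delGenTilde,
      LinearMap.lTensor_tmul, LinearMap.lTensor_tmul, SymmetricAlgebra.partialDeriv_mul_ι,
      Algebra.TensorProduct.tmul_mul_tmul, mul_one, TensorProduct.tmul_add,
      TensorProduct.tmul_smul]

variable {f k x}

theorem tmul_eq_mul (a : ExteriorAlgebra ℝ W) (s : SymmetricAlgebra ℝ W) :
    a ⊗ₜ[ℝ] s = (a ⊗ₜ 1 * 1 ⊗ₜ s : Koszul W) := by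
  rw [Algebra.TensorProduct.tmul_mul_tmul, mul_one, one_mul]

theorem adjoin_gens :
    Algebra.adjoin ℝ (Set.range (gen : W → Koszul W) ∪ Set.range genTilde) = ⊤ := by
  refine eq_top_iff.2 fun k _ => ?_
  induction k using TensorProduct.induction_on with
  | zero => exact zero_mem _
  | add k k' h h' => exact add_mem (h trivial) (h' trivial)
  | tmul a s =>
    rw [tmul_eq_mul]
    clear * -
    refine mul_mem ?_ ?_
    · change a ∈ (Algebra.adjoin ℝ (Set.range (gen : W → Koszul W) ∪ Set.range genTilde)).comap
        (Algebra.TensorProduct.includeLeft : ExteriorAlgebra ℝ W →ₐ[ℝ] Koszul W)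
      induction a using ExteriorAlgebra.induction with
      | algebraMap r => exact Subalgebra.algebraMap_mem _ r
      | ι x => exact Algebra.subset_adjoin (Or.inl ⟨x, rfl⟩)
      | mul a b ha hb => exact mul_mem ha hb
      | add a b ha hb => exact add_mem ha hb
    · change s ∈ (Algebra.adjoin ℝ (Set.range (gen : W → Koszul W) ∪ Set.range genTilde)).comap
        (Algebra.TensorProduct.includeRight : SymmetricAlgebra ℝ W →ₐ[ℝ] Koszul W)
      induction s using SymmetricAlgebra.induction with
      | algebraMap r => exact Subalgebra.algebraMap_mem _ r
      | ι x => exact Algebra.subset_adjoin (Or.inr ⟨x, rfl⟩)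
      | mul a b ha hb => exact mul_mem ha hb
      | add a b ha hb => exact add_mem ha hb

/-- The contractions obey rules for multiplication by a generator on the right, so their properties
are proved by this induction. The left version below serves the differential. -/
theorem right_induction (p : Submodule ℝ (Koszul W)) (h1 : 1 ∈ p)
    (hg : ∀ k ∈ p, ∀ x, k * gen x ∈ p) (hg' : ∀ k ∈ p, ∀ x, k * genTilde x ∈ p)
    (k : Koszul W) : k ∈ p := by
  have h : ∀ k ∈ Algebra.adjoin ℝ (Set.range (gen : W → Koszul W) ∪ Set.range genTilde),
      ∀ y ∈ p, y * k ∈ p := fun k hk => by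
    induction hk using Algebra.adjoin_induction with
    | mem k hk =>
      rcases hk with ⟨x, rfl⟩ | ⟨x, rfl⟩
      · exact fun y hy => hg y hy x
      · exact fun y hy => hg' y hy x
    | algebraMap r =>
      intro y hy
      rw [← Algebra.commutes, ← Algebra.smul_def]
      exact p.smul_mem r hy
    | add k k' _ _ h h' =>
      intro y hy
      rw [mul_add]
      exact add_mem (h y hy) (h' y hy)
    | mul k k' _ _ h h' =>
      intro y hy
      rw [← mul_assoc]
      exact h' _ (h y hy)
  rw [← one_mul k]
  exact h k (by rw [adjoin_gens]; trivial) 1 h1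

theorem left_induction (p : Submodule ℝ (Koszul W)) (h1 : 1 ∈ p)
    (hg : ∀ k ∈ p, ∀ x, gen x * k ∈ p) (hg' : ∀ k ∈ p, ∀ x, genTilde x * k ∈ p)
    (k : Koszul W) : k ∈ p := by
  have h : ∀ k ∈ Algebra.adjoin ℝ (Set.range (gen : W → Koszul W) ∪ Set.range genTilde),
      ∀ y ∈ p, k * y ∈ p := fun k hk => by
    induction hk using Algebra.adjoin_induction with
    | mem k hk =>
      rcases hk with ⟨x, rfl⟩ | ⟨x, rfl⟩
      · exact fun y hy => hg y hy x
      · exact fun y hy => hg' y hy x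
    | algebraMap r =>
      intro y hy
      rw [← Algebra.smul_def]
      exact p.smul_mem r hy
    | add k k' _ _ h h' =>
      intro y hy
      rw [add_mul]
      exact add_mem (h y hy) (h' y hy)
    | mul k k' _ _ h h' =>
      intro y hy
      rw [mul_assoc]
      exact h _ (h' y hy)
  rw [← mul_one k]
  exact h k (by rw [adjoin_gens]; trivial) 1 h1

/-! ### The Euler operator -/

variable {ι : Type*} [Fintype ι] (b : Module.Basis ι ℝ W)

/-- The Euler operator, which multiplies a product of `n` generators by `n`. -/
def euler : Koszul W →ₗ[ℝ] Koszul W :=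
  ∑ i, (LinearMap.mulRight ℝ (gen (b i)) ∘ₗ delGen (b.coord i) +
    LinearMap.mulRight ℝ (genTilde (b i)) ∘ₗ delGenTilde (b.coord i))

theorem euler_apply (k : Koszul W) : euler b k =
    ∑ i, (delGen (b.coord i) k * gen (b i) + delGenTilde (b.coord i) k * genTilde (b i)) := by
  rw [euler, LinearMap.sum_apply]
  rfl

theorem euler_one : euler b 1 = 0 := by
  rw [euler_apply]
  refine Finset.sum_eq_zero fun i _ => ?_
  rw [delGen_one, delGenTilde_one, zero_mul, zero_mul, add_zero]

theorem gen_smul (c : ℝ) (x : W) : gen (c • x) = c • gen x := by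
  rw [gen, map_smul, ← TensorProduct.smul_tmul', gen]

theorem genTilde_smul (c : ℝ) (x : W) : genTilde (c • x) = c • genTilde x := by
  rw [genTilde, map_smul, TensorProduct.tmul_smul, genTilde]

theorem sum_coord_gen (x : W) : ∑ i, b.coord i x • gen (b i) = gen x := by
  conv_rhs => rw [← b.sum_repr x]
  rw [gen, map_sum, TensorProduct.sum_tmul]
  exact Finset.sum_congr rfl fun i _ => (gen_smul _ _).symm

theorem sum_coord_genTilde (x : W) : ∑ i, b.coord i x • genTilde (b i) = genTilde x := by
  conv_rhs => rw [← b.sum_repr x]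
  rw [genTilde, map_sum, TensorProduct.tmul_sum]
  exact Finset.sum_congr rfl fun i _ => (genTilde_smul _ _).symm

theorem gen_mul_gen (x y : W) : gen x * gen y = (-1 : ℝ) • (gen y * gen x) := by
  rw [gen, gen, Algebra.TensorProduct.tmul_mul_tmul, Algebra.TensorProduct.tmul_mul_tmul,
    TensorProduct.smul_tmul', neg_one_smul]
  congr 1
  exact eq_neg_of_add_eq_zero_left (ExteriorAlgebra.ι_add_mul_swap x y)

theorem genTilde_mul_comm (k : Koszul W) (x : W) : genTilde x * k = k * genTilde x := by
  induction k using TensorProduct.induction_on with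
  | zero => simp
  | add k k' h h' => rw [mul_add, h, h', add_mul]
  | tmul a s =>
    rw [genTilde, Algebra.TensorProduct.tmul_mul_tmul, Algebra.TensorProduct.tmul_mul_tmul,
      one_mul, mul_one, mul_comm s]

/-- The contraction of the new factor gives `∑ xᵢ k eᵢ = k x`. In the remaining terms, moving `x`
past `eᵢ` cancels the sign of the antiderivation. -/
theorem euler_mul_gen (k : Koszul W) (x : W) :
    euler b (k * gen x) = k * gen x + euler b k * gen x := by
  rw [euler_apply, euler_apply, Finset.sum_mul]
  conv_rhs => rw [← sum_coord_gen b x, Finset.mul_sum]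
  rw [sum_coord_gen, ← Finset.sum_add_distrib]
  refine Finset.sum_congr rfl fun i _ => ?_
  rw [delGen_mul_gen, delGenTilde_mul_gen, sub_mul, mul_assoc, gen_mul_gen x, mul_assoc _ (gen x),
    ← genTilde_mul_comm (gen x), add_mul, mul_assoc, mul_assoc, smul_mul_assoc, mul_smul_comm,
    mul_smul_comm]
  module

theorem euler_mul_genTilde (k : Koszul W) (x : W) :
    euler b (k * genTilde x) = k * genTilde x + euler b k * genTilde x := by
  rw [euler_apply, euler_apply, Finset.sum_mul]
  conv_rhs => rw [← sum_coord_genTilde b x, Finset.mul_sum]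
  rw [sum_coord_genTilde, ← Finset.sum_add_distrib]
  refine Finset.sum_congr rfl fun i _ => ?_
  rw [delGen_mul_genTilde, delGenTilde_mul_genTilde, add_mul, mul_assoc, genTilde_mul_comm,
    mul_assoc _ (genTilde x), genTilde_mul_comm (genTilde (b i)), add_mul, mul_assoc, mul_assoc,
    smul_mul_assoc, mul_smul_comm]
  abel

/-- The operators `E + (m + 1)` are surjective because `E` counts generators. All `m` are treated at
once: multiplication by a generator turns `E + (m + 2)` into `E + (m + 1)`. -/
theorem mem_range_euler_add (k : Koszul W) (m : ℕ) :
    k ∈ LinearMap.range (euler b + ((m : ℝ) + 1) • LinearMap.id) := by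
  have key : ∀ m : ℕ, ∀ g : Koszul W, (∀ k, euler b (k * g) = k * g + euler b k * g) →
      ∀ k ∈ LinearMap.range (euler b + (((m + 1 : ℕ) : ℝ) + 1) • LinearMap.id),
        k * g ∈ LinearMap.range (euler b + ((m : ℝ) + 1) • LinearMap.id) := by
    rintro m g hg _ ⟨k, rfl⟩
    refine ⟨k * g, ?_⟩
    simp only [LinearMap.add_apply, LinearMap.smul_apply, LinearMap.id_apply, hg, add_mul,
      smul_mul_assoc]
    push_cast
    module
  have h := right_induction
    (⨅ m : ℕ, LinearMap.range (euler b + ((m : ℝ) + 1) • LinearMap.id)) ?_ ?_ ?_ k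
  · exact Submodule.mem_iInf _ |>.1 h m
  · refine (Submodule.mem_iInf _).2 fun m => ⟨((m : ℝ) + 1)⁻¹ • 1, ?_⟩
    have hm : (m : ℝ) + 1 ≠ 0 := by positivity
    rw [map_smul, LinearMap.add_apply, euler_one, zero_add, LinearMap.smul_apply,
      LinearMap.id_apply, inv_smul_smul₀ hm]
  · exact fun k hk x => (Submodule.mem_iInf _).2 fun m =>
      key m _ (fun k => euler_mul_gen b k x) k ((Submodule.mem_iInf _).1 hk (m + 1))
  · exact fun k hk x => (Submodule.mem_iInf _).2 fun m =>
      key m _ (fun k => euler_mul_genTilde b k x) k ((Submodule.mem_iInf _).1 hk (m + 1))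

/-- If `k = E k' + k'`, then `E (k' g) = k g`. In general `E` itself is not surjective, as it kills
the constants. -/
theorem mul_mem_range_euler (k : Koszul W) {g : Koszul W}
    (hg : ∀ k, euler b (k * g) = k * g + euler b k * g) :
    k * g ∈ LinearMap.range (euler b) := by
  obtain ⟨k, rfl⟩ := mem_range_euler_add b k 0
  refine ⟨k * g, ?_⟩
  simp only [LinearMap.add_apply, LinearMap.smul_apply, LinearMap.id_apply, hg, add_mul,
    smul_mul_assoc]
  simp only [Nat.cast_zero, zero_add, one_smul]
  abel

/-! ### The filtration by the number of generators -/

variable (W) in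
/-- The span of the products of at most `n` generators. -/
def filtration : ℕ → Submodule ℝ (Koszul W)
  | 0 => Submodule.span ℝ {1}
  | n + 1 => filtration n ⊔ ⨆ x : W, ((filtration n).map (LinearMap.mulRight ℝ (gen x)) ⊔
      (filtration n).map (LinearMap.mulRight ℝ (genTilde x)))

theorem filtration_le_succ (n : ℕ) : filtration W n ≤ filtration W (n + 1) := le_sup_left

theorem filtration_mono : Monotone (filtration W) := monotone_nat_of_le_succ filtration_le_succ

theorem mul_gen_mem_filtration {n : ℕ} {k : Koszul W} (hk : k ∈ filtration W n) (x : W) :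
    k * gen x ∈ filtration W (n + 1) :=
  le_sup_right (a := filtration W n) (Submodule.mem_iSup_of_mem x
    (le_sup_left (a := (filtration W n).map (LinearMap.mulRight ℝ (gen x))) ⟨k, hk, rfl⟩))

theorem mul_genTilde_mem_filtration {n : ℕ} {k : Koszul W} (hk : k ∈ filtration W n) (x : W) :
    k * genTilde x ∈ filtration W (n + 1) :=
  le_sup_right (a := filtration W n) (Submodule.mem_iSup_of_mem x
    (le_sup_right (a := (filtration W n).map (LinearMap.mulRight ℝ (gen x))) ⟨k, hk, rfl⟩))

theorem filtration_succ_le {n : ℕ} {p : Submodule ℝ (Koszul W)} (h : filtration W n ≤ p)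
    (hg : ∀ k ∈ filtration W n, ∀ x, k * gen x ∈ p)
    (hg' : ∀ k ∈ filtration W n, ∀ x, k * genTilde x ∈ p) : filtration W (n + 1) ≤ p := by
  refine sup_le h (iSup_le fun x => sup_le ?_ ?_)
  · rintro _ ⟨k, hk, rfl⟩
    exact hg k hk x
  · rintro _ ⟨k, hk, rfl⟩
    exact hg' k hk x

theorem exists_mem_filtration (k : Koszul W) : ∃ n, k ∈ filtration W n := by
  rw [← Submodule.mem_iSup_of_directed _ filtration_mono.directed_le]
  refine right_induction _ ?_ (fun k hk x => ?_) (fun k hk x => ?_) k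
  · exact Submodule.mem_iSup_of_mem 0 (Submodule.mem_span_singleton_self 1)
  · obtain ⟨n, hn⟩ := (Submodule.mem_iSup_of_directed _ filtration_mono.directed_le).1 hk
    exact Submodule.mem_iSup_of_mem (n + 1) (mul_gen_mem_filtration hn x)
  · obtain ⟨n, hn⟩ := (Submodule.mem_iSup_of_directed _ filtration_mono.directed_le).1 hk
    exact Submodule.mem_iSup_of_mem (n + 1) (mul_genTilde_mem_filtration hn x)

theorem filtration_zero_le_ker {f : Koszul W →ₗ[ℝ] Koszul W} (h : f 1 = 0) :
    filtration W 0 ≤ LinearMap.ker f :=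
  (Submodule.span_singleton_le_iff_mem _ _).2 h

theorem filtration_le_comap_delGen (f : Module.Dual ℝ W) (n : ℕ) :
    filtration W (n + 1) ≤ (filtration W n).comap (delGen f) := by
  have h0 := filtration_zero_le_ker (delGen_one f)
  induction n with
  | zero =>
    refine filtration_succ_le (fun k hk => ?_) (fun k hk x => ?_) (fun k hk x => ?_)
    · rw [Submodule.mem_comap, LinearMap.mem_ker.1 (h0 hk)]
      exact zero_mem _
    · rw [Submodule.mem_comap, delGen_mul_gen, LinearMap.mem_ker.1 (h0 hk), zero_mul, sub_zero]
      exact Submodule.smul_mem _ _ hk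
    · rw [Submodule.mem_comap, delGen_mul_genTilde, LinearMap.mem_ker.1 (h0 hk), zero_mul]
      exact zero_mem _
  | succ n ih =>
    refine filtration_succ_le (fun k hk => ?_) (fun k hk x => ?_) (fun k hk x => ?_)
    · exact filtration_le_succ n (ih hk)
    · rw [Submodule.mem_comap, delGen_mul_gen]
      exact sub_mem (Submodule.smul_mem _ _ hk) (mul_gen_mem_filtration (ih hk) x)
    · rw [Submodule.mem_comap, delGen_mul_genTilde]
      exact mul_genTilde_mem_filtration (ih hk) x

theorem filtration_le_comap_delGenTilde (f : Module.Dual ℝ W) (n : ℕ) :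
    filtration W (n + 1) ≤ (filtration W n).comap (delGenTilde f) := by
  have h0 := filtration_zero_le_ker (delGenTilde_one f)
  induction n with
  | zero =>
    refine filtration_succ_le (fun k hk => ?_) (fun k hk x => ?_) (fun k hk x => ?_)
    · rw [Submodule.mem_comap, LinearMap.mem_ker.1 (h0 hk)]
      exact zero_mem _
    · rw [Submodule.mem_comap, delGenTilde_mul_gen, LinearMap.mem_ker.1 (h0 hk), zero_mul]
      exact zero_mem _
    · rw [Submodule.mem_comap, delGenTilde_mul_genTilde, LinearMap.mem_ker.1 (h0 hk), zero_mul,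
        add_zero]
      exact Submodule.smul_mem _ _ hk
  | succ n ih =>
    refine filtration_succ_le (fun k hk => ?_) (fun k hk x => ?_) (fun k hk x => ?_)
    · exact filtration_le_succ n (ih hk)
    · rw [Submodule.mem_comap, delGenTilde_mul_gen]
      exact mul_gen_mem_filtration (ih hk) x
    · rw [Submodule.mem_comap, delGenTilde_mul_genTilde]
      exact add_mem (Submodule.smul_mem _ _ hk) (mul_genTilde_mem_filtration (ih hk) x)

/-- On a product of exactly `n + 1` generators `E` is multiplication by `n + 1`; the shorter
products remain in the previous step. -/
theorem filtration_le_comap_euler (n : ℕ) :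
    filtration W (n + 1) ≤
      (filtration W n).comap (euler b - ((n : ℝ) + 1) • LinearMap.id) := by
  -- Subtracting `n + 1` after multiplication by a generator amounts to subtracting `n` before it,
  -- which links consecutive steps of the filtration.
  have key : ∀ (n : ℕ) (k g : Koszul W), (∀ k, euler b (k * g) = k * g + euler b k * g) →
      (euler b - ((n : ℝ) + 1) • LinearMap.id : Koszul W →ₗ[ℝ] Koszul W) (k * g) = (euler b k - (n : ℝ) • k) * g := by
    intro n k g hg
    simp only [LinearMap.sub_apply, LinearMap.smul_apply, LinearMap.id_apply, hg, sub_mul,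
      smul_mul_assoc]
    module
  have h0 := filtration_zero_le_ker (euler_one b)
  induction n with
  | zero =>
    refine filtration_succ_le (fun k hk => ?_) (fun k hk x => ?_) (fun k hk x => ?_)
    · rw [Submodule.mem_comap, LinearMap.sub_apply, LinearMap.mem_ker.1 (h0 hk), zero_sub]
      exact neg_mem (Submodule.smul_mem _ _ hk)
    all_goals rw [Submodule.mem_comap, key 0]
    · rw [LinearMap.mem_ker.1 (h0 hk), Nat.cast_zero, zero_smul, sub_zero, zero_mul]
      exact zero_mem _
    · exact fun k => euler_mul_gen b k x
    · rw [LinearMap.mem_ker.1 (h0 hk), Nat.cast_zero, zero_smul, sub_zero, zero_mul]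
      exact zero_mem _
    · exact fun k => euler_mul_genTilde b k x
  | succ n ih =>
    have h : ∀ k ∈ filtration W (n + 1), euler b k - ((n + 1 : ℕ) : ℝ) • k ∈ filtration W n :=
      fun k hk => by
        have := ih hk
        rw [Nat.cast_add, Nat.cast_one]
        exact this
    refine filtration_succ_le (fun k hk => ?_) (fun k hk x => ?_) (fun k hk x => ?_)
    · have e : (euler b - (((n + 1 : ℕ) : ℝ) + 1) • LinearMap.id : Koszul W →ₗ[ℝ] Koszul W) k =
          euler b k - ((n + 1 : ℕ) : ℝ) • k - k := by
        simp only [LinearMap.sub_apply, LinearMap.smul_apply, LinearMap.id_apply]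
        module
      rw [Submodule.mem_comap, e]
      exact sub_mem (filtration_le_succ n (h k hk)) hk
    · rw [Submodule.mem_comap, key (n + 1) k _ fun k => euler_mul_gen b k x]
      exact mul_gen_mem_filtration (h k hk) x
    · rw [Submodule.mem_comap, key (n + 1) k _ fun k => euler_mul_genTilde b k x]
      exact mul_genTilde_mem_filtration (h k hk) x

/-! ### Degrees and parity -/

theorem tmul_mem_degree {p q : ℕ} {a : ExteriorAlgebra ℝ W} {s : SymmetricAlgebra ℝ W}
    (ha : a ∈ ⋀[ℝ]^p W) (hs : s ∈ (LinearMap.range (SymmetricAlgebra.ι ℝ W)) ^ q) :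
    a ⊗ₜ s ∈ degree W (p + 2 * q) :=
  Submodule.mem_iSup_of_mem p <| Submodule.mem_iSup_of_mem q <|
    Submodule.mem_iSup_of_mem rfl ⟨(⟨a, ha⟩ : ⋀[ℝ]^p W) ⊗ₜ ⟨s, hs⟩, rfl⟩

theorem degree_le {m : ℕ} {P : Submodule ℝ (Koszul W)}
    (h : ∀ (p q : ℕ) (_ : p + 2 * q = m), ∀ a ∈ ⋀[ℝ]^p W,
      ∀ s ∈ (LinearMap.range (SymmetricAlgebra.ι ℝ W)) ^ q, a ⊗ₜ s ∈ P) : degree W m ≤ P := by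
  refine iSup_le fun p => iSup_le fun q => iSup_le fun hpq => ?_
  rintro _ ⟨z, rfl⟩
  induction z using TensorProduct.induction_on with
  | zero => rw [map_zero]; exact zero_mem _
  | add z z' hz hz' => rw [map_add]; exact add_mem hz hz'
  | tmul a s => exact h p q hpq a.1 a.2 s.1 s.2

theorem one_mem_pow_zero {A : Type*} [Semiring A] [Algebra ℝ A] (P : Submodule ℝ A) :
    1 ∈ P ^ 0 := by
  rw [Submodule.pow_zero]
  exact Submodule.one_le.1 le_rfl

theorem iSup_degree : ⨆ m, degree W m = ⊤ := by
  have key : ∀ g : Koszul W, (∀ m, degree W m ≤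
      (⨆ m, degree W m).comap (LinearMap.mulRight ℝ g)) → ∀ k ∈ ⨆ m, degree W m,
        k * g ∈ ⨆ m, degree W m := fun g h k hk => iSup_le h hk
  refine eq_top_iff.2 fun k _ => right_induction _ ?_ (fun k hk x => key _ ?_ k hk)
    (fun k hk x => key _ ?_ k hk) k
  · refine Submodule.mem_iSup_of_mem 0 ?_
    have h := tmul_mem_degree (W := W) (p := 0) (q := 0) (a := 1) (s := 1)
      (one_mem_pow_zero _) (one_mem_pow_zero _)
    exact h
  · refine fun m => degree_le fun p q _ a ha s hs => ?_
    refine Submodule.mem_iSup_of_mem (p + 1 + 2 * q) ?_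
    have h := tmul_mem_degree (p := p + 1) (q := q) (a := a * ExteriorAlgebra.ι ℝ x) (s := s)
      (by rw [ExteriorAlgebra.exteriorPower, Submodule.pow_succ]; exact Submodule.mul_mem_mul ha ⟨x, rfl⟩) hs
    rwa [LinearMap.mulRight_apply, gen, Algebra.TensorProduct.tmul_mul_tmul, mul_one]
  · refine fun m => degree_le fun p q _ a ha s hs => ?_
    refine Submodule.mem_iSup_of_mem (p + 2 * (q + 1)) ?_
    have h := tmul_mem_degree (p := p) (q := q + 1) (a := a) (s := s * SymmetricAlgebra.ι ℝ W x)
      ha (by rw [Submodule.pow_succ]; exact Submodule.mul_mem_mul hs ⟨x, rfl⟩)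
    rwa [LinearMap.mulRight_apply, genTilde, Algebra.TensorProduct.tmul_mul_tmul, mul_one]

theorem parity_gen (x : W) : parity W (gen x) = -gen x := by
  simp only [parity, gen, Algebra.TensorProduct.map_tmul, map_one]
  erw [CliffordAlgebra.involute_ι]
  exact TensorProduct.neg_tmul _ _

theorem parity_genTilde (x : W) : parity W (genTilde x) = genTilde x := by
  simp only [parity, genTilde, Algebra.TensorProduct.map_tmul, map_one, AlgHom.id_apply]

theorem parity_pow_gen (s : ℕ) (x : W) : (parity W ^ s) (gen x) = (-1 : ℝ) ^ s • gen x := by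
  induction s with
  | zero => rw [pow_zero, pow_zero, one_smul, AlgHom.one_apply]
  | succ s ih =>
    rw [pow_succ', AlgHom.mul_apply, ih, map_smul, parity_gen, pow_succ, mul_smul, smul_neg,
      neg_smul, one_smul, smul_neg]

theorem parity_pow_genTilde (s : ℕ) (x : W) : (parity W ^ s) (genTilde x) = genTilde x := by
  induction s with
  | zero => rw [pow_zero, AlgHom.one_apply]
  | succ s ih => rw [pow_succ', AlgHom.mul_apply, ih, parity_genTilde]

theorem d_one : d W 1 = 0 := by
  rw [Algebra.TensorProduct.one_def, d_tmul, dExt_one, zero_mul]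

end Koszul

open CategoryTheory Opposite

namespace DeRhamAlg

variable {Y : Man.{u}} {V : Type v} [AddCommGroup V] [Module ℝ V]

/-! ### The algebra map from the Koszul algebra -/

theorem incl_smul {F : Presheaf.{u, w}} {r : ℕ} (c : ℝ) (a : FormOn F r) :
    incl F r (c • a) = c • incl F r a := map_smul _ _ _

theorem pairing_add_left {M : Man.{u}} (l l' : Module.Dual ℝ V) (β : Form M 1 ⊗[ℝ] V) :
    pairing M (l + l') β = pairing M l β + pairing M l' β := by
  rw [pairing, LinearMap.lTensor_add, LinearMap.comp_add, LinearMap.add_apply]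
  rfl

theorem pairing_smul_left {M : Man.{u}} (c : ℝ) (l : Module.Dual ℝ V) (β : Form M 1 ⊗[ℝ] V) :
    pairing M (c • l) β = c • pairing M l β := by
  rw [pairing, LinearMap.lTensor_smul, LinearMap.comp_smul, LinearMap.smul_apply]
  rfl

variable (Y V) in
/-- The linear map `ℓ ↦ η(ℓ)`. -/
def thetaLinear : Module.Dual ℝ V →ₗ[ℝ] DeRhamAlg (prodOneForms Y V) where
  toFun := theta Y
  map_add' l l' := by
    have h : formOfDual Y (l + l') = formOfDual Y l + formOfDual Y l' :=
      FormOn.apply_ext fun _ s => pairing_add_left l l' s.2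
    rw [theta, h, map_add]
    rfl
  map_smul' c l := by
    have h : formOfDual Y (c • l) = c • formOfDual Y l :=
      FormOn.apply_ext fun _ s => pairing_smul_left c l s.2
    rw [theta, h, incl_smul]
    rfl

theorem theta_mul_self (l : Module.Dual ℝ V) : theta Y l * theta Y l = 0 := by
  have h := incl_mul_comm (formOfDual Y l) (formOfDual Y l)
  rw [mul_one, pow_one, neg_one_smul] at h
  have h2 : (2 : ℝ) • (theta Y l * theta Y l) = 0 := by
    rw [two_smul]
    exact eq_neg_iff_add_eq_zero.1 h
  exact (smul_eq_zero.1 h2).resolve_left two_ne_zero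

theorem d_theta (l : Module.Dual ℝ V) : d _ (theta Y l) = dTheta Y l := d_incl _

theorem d_dTheta (l : Module.Dual ℝ V) : d _ (dTheta Y l) = 0 := by
  rw [← d_theta, d_d]

/-- A form of even degree is central. The homomorphism on the symmetric algebra therefore takes
values in the center, a commutative algebra, and its image commutes with that of the exterior
algebra. -/
theorem commute_dTheta (l : Module.Dual ℝ V) (τ : DeRhamAlg (prodOneForms Y V)) :
    τ * dTheta Y l = dTheta Y l * τ := by
  induction τ using induction with
  | h r τ =>
    have h := incl_mul_comm (FormOn.d 1 (formOfDual Y l)) τ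
    rwa [pow_mul, show ((-1 : ℝ) ^ (1 + 1)) = 1 by norm_num, one_pow, one_smul] at h
  | hadd x y hx hy => rw [add_mul, mul_add, hx, hy]

variable (Y V) in
/-- The linear map `ℓ ↦ d η(ℓ)` to the center. -/
def dThetaLinear :
    Module.Dual ℝ V →ₗ[ℝ] Subalgebra.center ℝ (DeRhamAlg (prodOneForms Y V)) :=
  LinearMap.codRestrict
    (Subalgebra.toSubmodule (Subalgebra.center ℝ (DeRhamAlg (prodOneForms Y V))))
    (d _ ∘ₗ thetaLinear Y V) fun l => (Subalgebra.mem_center_iff (R := ℝ)).2 fun τ => by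
      have h : (d _ ∘ₗ thetaLinear Y V) l = dTheta Y l := d_theta l
      rw [h, commute_dTheta]

variable (Y V) in
/-- The homomorphism from the exterior algebra with `ℓ ↦ η(ℓ)`. -/
def exteriorHom :
    ExteriorAlgebra ℝ (Module.Dual ℝ V) →ₐ[ℝ] DeRhamAlg (prodOneForms Y V) :=
  ExteriorAlgebra.lift ℝ ⟨thetaLinear Y V, theta_mul_self⟩

variable (Y V) in
/-- The homomorphism from the symmetric algebra with `ℓ ↦ d η(ℓ)`. -/
def symmetricHom :
    SymmetricAlgebra ℝ (Module.Dual ℝ V) →ₐ[ℝ]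
      Subalgebra.center ℝ (DeRhamAlg (prodOneForms Y V)) :=
  SymmetricAlgebra.lift (dThetaLinear Y V)

theorem commute_exteriorHom_symmetricHom (x : ExteriorAlgebra ℝ (Module.Dual ℝ V))
    (y : SymmetricAlgebra ℝ (Module.Dual ℝ V)) : Commute (exteriorHom Y V x)
      (((Subalgebra.center ℝ (DeRhamAlg (prodOneForms Y V))).val.comp (symmetricHom Y V)) y) :=
  Subalgebra.mem_center_iff.1 (symmetricHom Y V y).2 (exteriorHom Y V x)

variable (Y V) in
/-- The homomorphism from the Koszul algebra with `ℓ ↦ η(ℓ)` and `ℓ̃ ↦ d η(ℓ)`. -/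
def koszulHom : Koszul (Module.Dual ℝ V) →ₐ[ℝ] DeRhamAlg (prodOneForms Y V) :=
  Algebra.TensorProduct.lift (exteriorHom Y V)
    ((Subalgebra.center ℝ _).val.comp (symmetricHom Y V))
    commute_exteriorHom_symmetricHom

theorem koszulHom_gen (l : Module.Dual ℝ V) : koszulHom Y V (Koszul.gen l) = theta Y l := by
  rw [koszulHom, Koszul.gen, Algebra.TensorProduct.lift_tmul, map_one, mul_one, exteriorHom]
  exact ExteriorAlgebra.lift_ι_apply ℝ (thetaLinear Y V) theta_mul_self l

theorem koszulHom_genTilde (l : Module.Dual ℝ V) :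
    koszulHom Y V (Koszul.genTilde l) = dTheta Y l := by
  have h : symmetricHom Y V (SymmetricAlgebra.ι ℝ _ l) = dThetaLinear Y V l :=
    SymmetricAlgebra.lift_ι_apply _ l
  rw [koszulHom, Koszul.genTilde, Algebra.TensorProduct.lift_tmul, map_one, one_mul]
  exact (congrArg Subtype.val h).trans (d_theta l)

/-- Both sides vanish at `1` and follow the same recursion under right multiplication by `ℓ` and
`ℓ̃`. -/
theorem del_koszulHom (v : V) (k : Koszul (Module.Dual ℝ V)) :
    del v (koszulHom Y V k) = koszulHom Y V (Koszul.delGen (Module.Dual.eval ℝ V v) k) := by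
  refine Koszul.right_induction (LinearMap.eqLocus (del v ∘ₗ (koszulHom Y V).toLinearMap)
    ((koszulHom Y V).toLinearMap ∘ₗ Koszul.delGen (Module.Dual.eval ℝ V v))) ?_ ?_ ?_ k
  · change del v (koszulHom Y V 1) = koszulHom Y V (Koszul.delGen _ 1)
    rw [map_one, del_one, Koszul.delGen_one, map_zero]
  · intro k hk l
    change del v (koszulHom Y V k) = koszulHom Y V (Koszul.delGen _ k) at hk
    change del v (koszulHom Y V (k * Koszul.gen l)) =
      koszulHom Y V (Koszul.delGen _ (k * Koszul.gen l))
    rw [map_mul, koszulHom_gen, del_mul_theta, Koszul.delGen_mul_gen, map_sub, map_smul, map_mul,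
      koszulHom_gen, hk, Module.Dual.eval_apply]
  · intro k hk l
    change del v (koszulHom Y V k) = koszulHom Y V (Koszul.delGen _ k) at hk
    change del v (koszulHom Y V (k * Koszul.genTilde l)) =
      koszulHom Y V (Koszul.delGen _ (k * Koszul.genTilde l))
    rw [map_mul, koszulHom_genTilde, del_mul_dTheta, Koszul.delGen_mul_genTilde, map_mul,
      koszulHom_genTilde, hk]

theorem del₂_koszulHom (v : V) (k : Koszul (Module.Dual ℝ V)) :
    del₂ v (koszulHom Y V k) =
      koszulHom Y V (Koszul.delGenTilde (Module.Dual.eval ℝ V v) k) := by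
  refine Koszul.right_induction (LinearMap.eqLocus (del₂ v ∘ₗ (koszulHom Y V).toLinearMap)
    ((koszulHom Y V).toLinearMap ∘ₗ Koszul.delGenTilde (Module.Dual.eval ℝ V v))) ?_ ?_ ?_ k
  · change del₂ v (koszulHom Y V 1) = koszulHom Y V (Koszul.delGenTilde _ 1)
    rw [map_one, del₂_one, Koszul.delGenTilde_one, map_zero]
  · intro k hk l
    change del₂ v (koszulHom Y V k) = koszulHom Y V (Koszul.delGenTilde _ k) at hk
    change del₂ v (koszulHom Y V (k * Koszul.gen l)) =
      koszulHom Y V (Koszul.delGenTilde _ (k * Koszul.gen l))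
    rw [map_mul, koszulHom_gen, del₂_mul_theta, Koszul.delGenTilde_mul_gen, map_mul,
      koszulHom_gen, hk]
  · intro k hk l
    change del₂ v (koszulHom Y V k) = koszulHom Y V (Koszul.delGenTilde _ k) at hk
    change del₂ v (koszulHom Y V (k * Koszul.genTilde l)) =
      koszulHom Y V (Koszul.delGenTilde _ (k * Koszul.genTilde l))
    rw [map_mul, koszulHom_genTilde, del₂_mul_dTheta, Koszul.delGenTilde_mul_genTilde, map_add,
      map_smul, map_mul, koszulHom_genTilde, hk, Module.Dual.eval_apply]

/-- The Leibniz rules on both sides are applied with a generator as the left factor, hence the left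
induction. -/
theorem d_koszulHom (k : Koszul (Module.Dual ℝ V)) :
    d _ (koszulHom Y V k) = koszulHom Y V (Koszul.d _ k) := by
  refine Koszul.left_induction (LinearMap.eqLocus (d _ ∘ₗ (koszulHom Y V).toLinearMap)
    ((koszulHom Y V).toLinearMap ∘ₗ Koszul.d (Module.Dual ℝ V))) ?_ ?_ ?_ k
  · change d _ (koszulHom Y V 1) = koszulHom Y V (Koszul.d _ 1)
    have h : d (prodOneForms Y V) 1 = 0 := by
      -- The Leibniz rule for `1 * 1` reads `d 1 = d 1 + d 1`.
      have h := d_incl_mul (FormOn.one : FormOn (prodOneForms Y V) 0) 1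
      have e : incl (prodOneForms Y V) 0 FormOn.one = 1 := rfl
      rw [e, pow_zero, one_smul, mul_one, mul_one, one_mul] at h
      exact left_eq_add.1 h
    rw [map_one, h, Koszul.d_one, map_zero]
  · intro k hk l
    change d _ (koszulHom Y V k) = koszulHom Y V (Koszul.d _ k) at hk
    change d _ (koszulHom Y V (Koszul.gen l * k)) = koszulHom Y V (Koszul.d _ (Koszul.gen l * k))
    rw [map_mul, koszulHom_gen, theta, d_incl_mul, hk, Koszul.d_mul, Koszul.d_gen, map_add,
      map_mul, map_mul, Koszul.parity_gen, koszulHom_genTilde, map_neg, koszulHom_gen, pow_one,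
      neg_one_smul, neg_mul]
    rw [← theta, d_theta]
  · intro k hk l
    change d _ (koszulHom Y V k) = koszulHom Y V (Koszul.d _ k) at hk
    change d _ (koszulHom Y V (Koszul.genTilde l * k)) =
      koszulHom Y V (Koszul.d _ (Koszul.genTilde l * k))
    rw [map_mul, koszulHom_genTilde, dTheta, d_incl_mul, hk, Koszul.d_mul, Koszul.d_genTilde,
      zero_mul, zero_add, map_mul, Koszul.parity_genTilde, koszulHom_genTilde]
    rw [← dTheta, d_dTheta, zero_mul, zero_add, neg_one_sq, one_smul]

/-- Each generator `ℓ` passes a form of degree `s` with sign `(-1)^s` and each `ℓ̃` with none; this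
is the `s`-th power of `parity`, the sign in the product of `KoszulForms`. -/
theorem koszulHom_mul_incl (k : Koszul (Module.Dual ℝ V)) {s : ℕ}
    (c : FormOn (prodOneForms Y V) s) :
    koszulHom Y V k * incl _ s c = incl _ s c * koszulHom Y V ((Koszul.parity _ ^ s) k) := by
  refine Koszul.right_induction (LinearMap.eqLocus
    (LinearMap.mulRight ℝ (incl _ s c) ∘ₗ (koszulHom Y V).toLinearMap)
    (LinearMap.mulLeft ℝ (incl _ s c) ∘ₗ (koszulHom Y V).toLinearMap ∘ₗ
      (Koszul.parity _ ^ s).toLinearMap)) ?_ ?_ ?_ k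
  · change koszulHom Y V 1 * incl _ s c = incl _ s c * koszulHom Y V ((Koszul.parity _ ^ s) 1)
    rw [map_one, map_one, map_one, one_mul, mul_one]
  · intro k hk l
    change koszulHom Y V k * incl _ s c = incl _ s c * koszulHom Y V ((Koszul.parity _ ^ s) k) at hk
    change koszulHom Y V (k * Koszul.gen l) * incl _ s c =
      incl _ s c * koszulHom Y V ((Koszul.parity _ ^ s) (k * Koszul.gen l))
    have h : theta Y l * incl _ s c = (-1 : ℝ) ^ s • (incl _ s c * theta Y l) := by
      rw [theta, incl_mul_comm, mul_one]
    rw [map_mul, map_mul, map_mul, Koszul.parity_pow_gen, map_smul, koszulHom_gen, mul_assoc, h,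
      mul_smul_comm, ← mul_assoc, hk, mul_assoc, mul_smul_comm, mul_smul_comm]
  · intro k hk l
    change koszulHom Y V k * incl _ s c = incl _ s c * koszulHom Y V ((Koszul.parity _ ^ s) k) at hk
    change koszulHom Y V (k * Koszul.genTilde l) * incl _ s c =
      incl _ s c * koszulHom Y V ((Koszul.parity _ ^ s) (k * Koszul.genTilde l))
    rw [map_mul, map_mul, map_mul, Koszul.parity_pow_genTilde, koszulHom_genTilde, mul_assoc,
      ← commute_dTheta, ← mul_assoc, hk, mul_assoc]

/-! ### Degrees -/

variable (Y V) in
/-- The forms of degree `n`. -/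
def homogeneous (n : ℕ) : Submodule ℝ (DeRhamAlg (prodOneForms Y V)) :=
  LinearMap.range (incl _ n)

theorem mul_mem_homogeneous {m n : ℕ} {x y : DeRhamAlg (prodOneForms Y V)}
    (hx : x ∈ homogeneous Y V m) (hy : y ∈ homogeneous Y V n) :
    x * y ∈ homogeneous Y V (m + n) := by
  obtain ⟨a, rfl⟩ := hx
  obtain ⟨b, rfl⟩ := hy
  exact ⟨_, (incl_mul_incl a b).symm⟩

theorem one_mem_homogeneous : (1 : DeRhamAlg (prodOneForms Y V)) ∈ homogeneous Y V 0 :=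
  ⟨FormOn.one, rfl⟩

theorem pow_le_homogeneous {P : Submodule ℝ (DeRhamAlg (prodOneForms Y V))} {m : ℕ}
    (h : P ≤ homogeneous Y V m) (n : ℕ) : P ^ n ≤ homogeneous Y V (m * n) := by
  induction n with
  | zero =>
    rw [Submodule.pow_zero, Submodule.one_le]
    exact one_mem_homogeneous
  | succ n ih =>
    rw [Submodule.pow_succ, Submodule.mul_le]
    exact fun x hx y hy => mul_mem_homogeneous (ih hx) (h hy)

theorem koszulHom_mem_homogeneous {m : ℕ} {k : Koszul (Module.Dual ℝ V)}
    (hk : k ∈ Koszul.degree _ m) : koszulHom Y V k ∈ homogeneous Y V m := by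
  refine Koszul.degree_le (P := (homogeneous Y V m).comap (koszulHom Y V).toLinearMap) ?_ hk
  rintro p q rfl a ha s hs
  change koszulHom Y V (a ⊗ₜ s) ∈ homogeneous Y V (p + 2 * q)
  rw [Koszul.tmul_eq_mul, map_mul]
  refine mul_mem_homogeneous ?_ ?_
  · let f : ExteriorAlgebra ℝ (Module.Dual ℝ V) →ₐ[ℝ] DeRhamAlg (prodOneForms Y V) :=
      (koszulHom Y V).comp Algebra.TensorProduct.includeLeft
    have h := Submodule.mem_map_of_mem (f := f.toLinearMap) ha
    rw [ExteriorAlgebra.exteriorPower, Submodule.map_pow] at h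
    have h' := pow_le_homogeneous (m := 1) ?_ p h
    · rwa [one_mul] at h'
    · rintro _ ⟨_, ⟨l, rfl⟩, rfl⟩
      exact ⟨_, (koszulHom_gen l).symm⟩
  · let f : SymmetricAlgebra ℝ (Module.Dual ℝ V) →ₐ[ℝ] DeRhamAlg (prodOneForms Y V) :=
      (koszulHom Y V).comp Algebra.TensorProduct.includeRight
    have h := Submodule.mem_map_of_mem (f := f.toLinearMap) hs
    rw [Submodule.map_pow] at h
    refine pow_le_homogeneous (m := 2) ?_ q h
    rintro _ ⟨_, ⟨l, rfl⟩, rfl⟩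
    exact ⟨_, (koszulHom_genTilde l).symm⟩

end DeRhamAlg

/-! ### Bijectivity of `η` -/

namespace DeRhamAlg

variable {Y : Man.{u}} {V : Type v} [AddCommGroup V] [Module ℝ V]

variable (Y V) in
/-- The linear map `b ⊗ k ↦ η(b) η(k)`. -/
def eta : Forms Y ⊗[ℝ] Koszul (Module.Dual ℝ V) →ₗ[ℝ] DeRhamAlg (prodOneForms Y V) :=
  TensorProduct.lift ((LinearMap.mul ℝ (DeRhamAlg (prodOneForms Y V))).compl₁₂
    (base Y V).toLinearMap (koszulHom Y V).toLinearMap)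

theorem eta_tmul (b : Forms Y) (k : Koszul (Module.Dual ℝ V)) :
    eta Y V (b ⊗ₜ k) = base Y V b * koszulHom Y V k := rfl

theorem del_eta (v : V) (z : Forms Y ⊗[ℝ] Koszul (Module.Dual ℝ V)) :
    del v (eta Y V z) =
      eta Y V ((Koszul.delGen (Module.Dual.eval ℝ V v)).lTensor (Forms Y) z) := by
  induction z using TensorProduct.induction_on with
  | zero => simp only [map_zero]
  | add z z' h h' => simp only [map_add, h, h']
  | tmul b k => rw [LinearMap.lTensor_tmul, eta_tmul, eta_tmul, del_base_mul, del_koszulHom]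

theorem del₂_eta (v : V) (z : Forms Y ⊗[ℝ] Koszul (Module.Dual ℝ V)) :
    del₂ v (eta Y V z) =
      eta Y V ((Koszul.delGenTilde (Module.Dual.eval ℝ V v)).lTensor (Forms Y) z) := by
  induction z using TensorProduct.induction_on with
  | zero => simp only [map_zero]
  | add z z' h h' => simp only [map_add, h, h']
  | tmul b k => rw [LinearMap.lTensor_tmul, eta_tmul, eta_tmul, del₂_base_mul, del₂_koszulHom]

theorem eta_lTensor_mulRight (z : Forms Y ⊗[ℝ] Koszul (Module.Dual ℝ V))
    (k : Koszul (Module.Dual ℝ V)) :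
    eta Y V ((LinearMap.mulRight ℝ k).lTensor (Forms Y) z) = eta Y V z * koszulHom Y V k := by
  induction z using TensorProduct.induction_on with
  | zero => simp only [map_zero, zero_mul]
  | add z z' h h' => simp only [map_add, add_mul, h, h']
  | tmul b k' =>
    rw [LinearMap.lTensor_tmul, eta_tmul, eta_tmul, LinearMap.mulRight_apply, map_mul, mul_assoc]

/-- Evaluation at the section `(id, 0)` on `Y` is a left inverse. -/
theorem base_injective : Function.Injective (base Y V) := by
  refine (injective_iff_map_eq_zero _).2 fun b hb => ?_
  have h := eval_base (V := V) (zeroSection (𝟙 Y)) b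
  rw [hb, map_zero] at h
  exact ((Forms.pullback_id_apply b).symm.trans h.symm)

variable {ι : Type*} [Fintype ι] [DecidableEq ι] (b : Module.Basis ι ℝ V)

theorem dualBasis_coord (i : ι) : b.dualBasis.coord i = Module.Dual.eval ℝ V (b i) :=
  LinearMap.ext fun l => b.dualBasis_repr l i

theorem lTensor_euler_apply (z : Forms Y ⊗[ℝ] Koszul (Module.Dual ℝ V)) :
    (Koszul.euler b.dualBasis).lTensor (Forms Y) z =
      ∑ i, ((LinearMap.mulRight ℝ (Koszul.gen (b.coord i))).lTensor (Forms Y)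
          ((Koszul.delGen (Module.Dual.eval ℝ V (b i))).lTensor (Forms Y) z) +
        (LinearMap.mulRight ℝ (Koszul.genTilde (b.coord i))).lTensor (Forms Y)
          ((Koszul.delGenTilde (Module.Dual.eval ℝ V (b i))).lTensor (Forms Y) z)) := by
  induction z using TensorProduct.induction_on with
  | zero => simp only [map_zero, add_zero, Finset.sum_const_zero]
  | add z z' h h' =>
    simp only [map_add, h, h', ← Finset.sum_add_distrib]
    exact Finset.sum_congr rfl fun i _ => add_add_add_comm _ _ _ _
  | tmul a k =>
    simp only [LinearMap.lTensor_tmul, Koszul.euler_apply, TensorProduct.tmul_sum,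
      ← TensorProduct.tmul_add, LinearMap.mulRight_apply, dualBasis_coord, Module.Basis.coe_dualBasis]

/-- The coordinates of the dual basis are the evaluations at the basis vectors of `V`, so both Euler
operators are built from corresponding contractions and generators. -/
theorem euler_eta (z : Forms Y ⊗[ℝ] Koszul (Module.Dual ℝ V)) :
    euler b (eta Y V z) = eta Y V ((Koszul.euler b.dualBasis).lTensor (Forms Y) z) := by
  rw [lTensor_euler_apply, map_sum, euler]
  refine Finset.sum_congr rfl fun i _ => ?_
  rw [map_add, eta_lTensor_mulRight, eta_lTensor_mulRight, del_eta, del₂_eta, koszulHom_gen,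
    koszulHom_genTilde]

theorem lTensor_mulRight_mem_range {g : Koszul (Module.Dual ℝ V)}
    (hg : ∀ k, Koszul.euler b.dualBasis (k * g) = k * g + Koszul.euler b.dualBasis k * g)
    (z : Forms Y ⊗[ℝ] Koszul (Module.Dual ℝ V)) :
    (LinearMap.mulRight ℝ g).lTensor (Forms Y) z ∈
      LinearMap.range ((Koszul.euler b.dualBasis).lTensor (Forms Y)) := by
  induction z using TensorProduct.induction_on with
  | zero => rw [map_zero]; exact zero_mem _
  | add z z' h h' => rw [map_add]; exact add_mem h h'
  | tmul a k =>
    obtain ⟨k', hk'⟩ := Koszul.mul_mem_range_euler b.dualBasis k hg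
    refine ⟨a ⊗ₜ k', ?_⟩
    rw [LinearMap.lTensor_tmul, LinearMap.lTensor_tmul, hk', LinearMap.mulRight_apply]

-- With preimages of the contractions, `E τ` is the image of a sum of products with generators. Such
-- a sum has the form `E z` on the Koszul side, so `E (τ - η(z)) = 0` and the difference comes from
-- `Y`.
include b in
theorem mem_range_eta_of_del {τ : DeRhamAlg (prodOneForms Y V)}
    (h : ∀ v, del v τ ∈ LinearMap.range (eta Y V)) (h' : ∀ v, del₂ v τ ∈ LinearMap.range (eta Y V)) :
    τ ∈ LinearMap.range (eta Y V) := by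
  choose x hx using h
  choose y hy using h'
  obtain ⟨z, hz⟩ : ∑ i, ((LinearMap.mulRight ℝ (Koszul.gen (b.coord i))).lTensor (Forms Y) (x (b i)) +
      (LinearMap.mulRight ℝ (Koszul.genTilde (b.coord i))).lTensor (Forms Y) (y (b i))) ∈
        LinearMap.range ((Koszul.euler b.dualBasis).lTensor (Forms Y)) :=
    sum_mem fun i _ => add_mem
      (lTensor_mulRight_mem_range b (fun k => Koszul.euler_mul_gen _ k _) _)
      (lTensor_mulRight_mem_range b (fun k => Koszul.euler_mul_genTilde _ k _) _)
  have h1 : euler b τ = euler b (eta Y V z) := by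
    rw [euler_eta, hz, map_sum, euler]
    refine Finset.sum_congr rfl fun i _ => ?_
    rw [map_add, eta_lTensor_mulRight, eta_lTensor_mulRight, hx, hy, koszulHom_gen,
      koszulHom_genTilde]
  have h2 : euler b (τ - eta Y V z) = 0 := by
    rw [← sub_eq_zero.2 h1, euler, euler, euler, ← Finset.sum_sub_distrib]
    refine Finset.sum_congr rfl fun i _ => ?_
    rw [map_sub, map_sub, sub_mul, sub_mul, add_sub_add_comm]
  obtain ⟨a, ha⟩ := mem_range_base_of_euler_eq_zero b h2
  refine ⟨a ⊗ₜ 1 + z, ?_⟩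
  have h3 : base Y V a = τ - eta Y V z := ha
  rw [map_add, eta_tmul, map_one, mul_one, h3, sub_add_cancel]

/-- Strong induction on the degree, which the two contractions lower by `1` and `2`. In degrees too
small for a contraction, that contraction is zero by definition. -/
theorem eta_surjective [FiniteDimensional ℝ V] : Function.Surjective (eta Y V) := by
  have h : ∀ (n : ℕ) (τ : FormOn (prodOneForms Y V) n), incl _ n τ ∈ LinearMap.range (eta Y V) := by
    intro n
    induction n using Nat.strong_induction_on with
    | _ n ih =>
      intro τ
      refine mem_range_eta_of_del (Module.finBasis ℝ V) (fun v => ?_) fun v => ?_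
      · match n, τ with
        | 0, τ =>
          rw [del_incl_zero]
          exact zero_mem _
        | n + 1, τ =>
          rw [del_incl_succ]
          exact ih n (Nat.lt_succ_self n) _
      · match n, τ with
        | 0, τ =>
          rw [del₂_incl_zero]
          exact zero_mem _
        | 1, τ =>
          rw [del₂_incl_one]
          exact zero_mem _
        | n + 2, τ =>
          rw [del₂_incl_add_two]
          exact ih n (by omega) _
  intro τ
  change τ ∈ LinearMap.range (eta Y V)
  induction τ using induction with
  | h r τ => exact h r τ
  | hadd x y hx hy => exact add_mem hx hy

variable (Y V) in
/-- The span of the `b ⊗ k` with `k` a product of at most `n` generators. -/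
def tensorFiltration (n : ℕ) : Submodule ℝ (Forms Y ⊗[ℝ] Koszul (Module.Dual ℝ V)) :=
  LinearMap.range ((Koszul.filtration (Module.Dual ℝ V) n).subtype.lTensor (Forms Y))

theorem tmul_mem_tensorFiltration {n : ℕ} (a : Forms Y) {k : Koszul (Module.Dual ℝ V)}
    (hk : k ∈ Koszul.filtration _ n) : a ⊗ₜ k ∈ tensorFiltration Y V n :=
  ⟨a ⊗ₜ ⟨k, hk⟩, rfl⟩

theorem tensorFiltration_le {n : ℕ} {P : Submodule ℝ (Forms Y ⊗[ℝ] Koszul (Module.Dual ℝ V))}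
    (h : ∀ a, ∀ k ∈ Koszul.filtration _ n, a ⊗ₜ k ∈ P) : tensorFiltration Y V n ≤ P := by
  rintro _ ⟨z, rfl⟩
  induction z using TensorProduct.induction_on with
  | zero => rw [map_zero]; exact zero_mem _
  | add z z' hz hz' => rw [map_add]; exact add_mem hz hz'
  | tmul a k => exact h a k.1 k.2

theorem exists_mem_tensorFiltration (z : Forms Y ⊗[ℝ] Koszul (Module.Dual ℝ V)) :
    ∃ n, z ∈ tensorFiltration Y V n := by
  have mono : Monotone (tensorFiltration Y V) := fun m n h =>
    tensorFiltration_le fun a k hk => tmul_mem_tensorFiltration a (Koszul.filtration_mono h hk)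
  induction z using TensorProduct.induction_on with
  | zero => exact ⟨0, zero_mem _⟩
  | add z z' hz hz' =>
    obtain ⟨n, hn⟩ := hz
    obtain ⟨n', hn'⟩ := hz'
    exact ⟨max n n', add_mem (mono (le_max_left n n') hn) (mono (le_max_right n n') hn')⟩
  | tmul a k =>
    obtain ⟨n, hn⟩ := Koszul.exists_mem_filtration k
    exact ⟨n, tmul_mem_tensorFiltration a hn⟩

theorem lTensor_mem_tensorFiltration {f : Koszul (Module.Dual ℝ V) →ₗ[ℝ] Koszul (Module.Dual ℝ V)}
    {m n : ℕ} (hf : Koszul.filtration _ m ≤ (Koszul.filtration _ n).comap f)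
    {z : Forms Y ⊗[ℝ] Koszul (Module.Dual ℝ V)} (hz : z ∈ tensorFiltration Y V m) :
    f.lTensor (Forms Y) z ∈ tensorFiltration Y V n :=
  tensorFiltration_le (P := (tensorFiltration Y V n).comap (f.lTensor (Forms Y)))
    (fun a _ hk => tmul_mem_tensorFiltration a (hf hk)) hz

-- The contractions of `z` lie one step lower in the filtration and are also killed by `η`, so they
-- vanish by induction, and with them `E z`.
include b in
theorem eq_zero_of_eta_eq_zero {n : ℕ} {z : Forms Y ⊗[ℝ] Koszul (Module.Dual ℝ V)}
    (hz : z ∈ tensorFiltration Y V n) (h : eta Y V z = 0) : z = 0 := by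
  induction n generalizing z with
  | zero =>
    obtain ⟨a, rfl⟩ : ∃ a : Forms Y, a ⊗ₜ 1 = z := by
      refine tensorFiltration_le (P := LinearMap.range
        ((TensorProduct.mk ℝ (Forms Y) (Koszul (Module.Dual ℝ V))).flip 1)) (fun a k hk => ?_) hz
      obtain ⟨c, rfl⟩ := Submodule.mem_span_singleton.1 hk
      exact ⟨c • a, TensorProduct.smul_tmul c a 1⟩
    rw [eta_tmul, map_one, mul_one] at h
    rw [base_injective (h.trans (map_zero _).symm), TensorProduct.zero_tmul]
  | succ n ih =>
    have h1 : ∀ v, (Koszul.delGen (Module.Dual.eval ℝ V v)).lTensor (Forms Y) z = 0 := fun v =>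
      ih (lTensor_mem_tensorFiltration (Koszul.filtration_le_comap_delGen _ n) hz)
        (by rw [← del_eta, h, map_zero])
    have h2 : ∀ v, (Koszul.delGenTilde (Module.Dual.eval ℝ V v)).lTensor (Forms Y) z = 0 := fun v =>
      ih (lTensor_mem_tensorFiltration (Koszul.filtration_le_comap_delGenTilde _ n) hz)
        (by rw [← del₂_eta, h, map_zero])
    have h3 : (Koszul.euler b.dualBasis).lTensor (Forms Y) z = 0 := by
      rw [lTensor_euler_apply]
      simp only [h1, h2, map_zero, add_zero, Finset.sum_const_zero]
    have h4 := lTensor_mem_tensorFiltration (Koszul.filtration_le_comap_euler b.dualBasis n) hz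
    have hn : (n : ℝ) + 1 ≠ 0 := by positivity
    -- Since `E z = 0`, the operator `E - (n + 1)` sends `z` to `-(n + 1) z`, which lies in the
    -- previous step; as `n + 1` is invertible, so does `z`.
    rw [LinearMap.lTensor_sub, LinearMap.sub_apply, h3, zero_sub, LinearMap.lTensor_smul,
      LinearMap.lTensor_id, LinearMap.smul_apply, LinearMap.id_apply, neg_mem_iff,
      Submodule.smul_mem_iff _ hn] at h4
    exact ih h4 h

theorem eta_injective [FiniteDimensional ℝ V] : Function.Injective (eta Y V) :=
  (injective_iff_map_eq_zero _).2 fun z hz =>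
    eq_zero_of_eta_eq_zero (Module.finBasis ℝ V) (exists_mem_tensorFiltration z).choose_spec hz

end DeRhamAlg

/-! ### Compatibility of `η` with degrees, products and differentials -/

namespace KoszulForms

variable {Y : Man.{u}} {V : Type v} [AddCommGroup V] [Module ℝ V]

variable (Y V) in
/-- The identification of `⨁ r, Ω^r(Y) ⊗ K` with `Ω^•(Y) ⊗ K`. -/
def toTensor : KoszulForms Y V ≃ₗ[ℝ] Forms Y ⊗[ℝ] Koszul (Module.Dual ℝ V) :=
  (TensorProduct.directSumLeft ℝ ℝ (fun r => Form Y r) (Koszul (Module.Dual ℝ V))).symm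

theorem toTensor_of {r : ℕ} (b : Form Y r) (k : Koszul (Module.Dual ℝ V)) :
    toTensor Y V (of b k) = Forms.incl r b ⊗ₜ k :=
  TensorProduct.directSumLeft_symm_lof_tmul (S := ℝ) (M₁ := fun r => Form Y r) (R := ℝ) (i := r) b k

theorem induction {P : KoszulForms Y V → Prop}
    (h : ∀ (r : ℕ) (b : Form Y r) (k : Koszul (Module.Dual ℝ V)), P (of b k))
    (hadd : ∀ x y, P x → P y → P (x + y)) (z : KoszulForms Y V) : P z := by
  have h0 : P 0 := by
    have h := h 0 0 0
    rwa [of, TensorProduct.tmul_zero, map_zero] at h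
  refine DirectSum.induction_on (motive := P) z h0 (fun r x => ?_) hadd
  induction x using TensorProduct.induction_on with
  | zero => rwa [map_zero]
  | add x y hx hy => rw [map_add]; exact hadd _ _ hx hy
  | tmul b k => exact h r b k

theorem of_mul_of {r s : ℕ} (b : Form Y r) (c : Form Y s) (k l : Koszul (Module.Dual ℝ V)) :
    of b k * of c l = of (Form.wedge r s b c) ((Koszul.parity _ ^ s) k * l) :=
  DirectSum.of_mul_of (A := fun r => KForm Y V r) (b ⊗ₜ k) (c ⊗ₜ l)

theorem dBase_of {r : ℕ} (b : Form Y r) (k : Koszul (Module.Dual ℝ V)) :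
    dBase Y V (of b k) = of (Form.d r b) k := by
  rw [dBase, of, DirectSum.toModule_lof]
  rfl

theorem dKoszul_of {r : ℕ} (b : Form Y r) (k : Koszul (Module.Dual ℝ V)) :
    dKoszul Y V (of b k) = (-1 : ℝ) ^ r • of b (Koszul.d _ k) := by
  rw [dKoszul, of, DirectSum.toModule_lof]
  rfl

theorem of_mem_degree {r m : ℕ} (b : Form Y r) {k : Koszul (Module.Dual ℝ V)}
    (hk : k ∈ Koszul.degree _ m) : of b k ∈ degree Y V (r + m) :=
  Submodule.mem_iSup_of_mem r <| Submodule.mem_iSup_of_mem m <| Submodule.mem_iSup_of_mem rfl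
    ⟨b ⊗ₜ k, ⟨b ⊗ₜ ⟨k, hk⟩, rfl⟩, rfl⟩

theorem degree_le {n : ℕ} {P : Submodule ℝ (KoszulForms Y V)}
    (h : ∀ (r m : ℕ) (_ : r + m = n) (b : Form Y r), ∀ k ∈ Koszul.degree (Module.Dual ℝ V) m,
      of b k ∈ P) : degree Y V n ≤ P := by
  refine iSup_le fun r => iSup_le fun m => iSup_le fun hrm => ?_
  rintro _ ⟨_, ⟨z, rfl⟩, rfl⟩
  induction z using TensorProduct.induction_on with
  | zero => rw [map_zero, map_zero]; exact zero_mem _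
  | add z z' hz hz' => rw [map_add, map_add]; exact add_mem hz hz'
  | tmul b k => exact h r m hrm b k.1 k.2

theorem iSup_degree : ⨆ n, degree Y V n = ⊤ := by
  refine eq_top_iff.2 fun z _ => ?_
  induction z using induction with
  | h r b k =>
    have hk : k ∈ ⨆ m, Koszul.degree (Module.Dual ℝ V) m := by
      rw [Koszul.iSup_degree]
      trivial
    let f : Koszul (Module.Dual ℝ V) →ₗ[ℝ] KoszulForms Y V :=
      DirectSum.lof ℝ ℕ (fun r => KForm Y V r) r ∘ₗ TensorProduct.mk ℝ _ _ b
    have h : ⨆ m, Koszul.degree (Module.Dual ℝ V) m ≤ (⨆ n, degree Y V n).comap f :=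
      iSup_le fun m k hk => Submodule.mem_iSup_of_mem (r + m) (of_mem_degree b hk)
    exact h hk
  | hadd x y hx hy => exact add_mem (hx trivial) (hy trivial)

variable (Y V) in
/-- The isomorphism `η_Y`. -/
def equivDeRham [FiniteDimensional ℝ V] : KoszulForms Y V ≃ₗ[ℝ] DeRhamAlg (prodOneForms Y V) :=
  toTensor Y V ≪≫ₗ LinearEquiv.ofBijective (DeRhamAlg.eta Y V)
    ⟨DeRhamAlg.eta_injective, DeRhamAlg.eta_surjective⟩

variable [FiniteDimensional ℝ V]

theorem equivDeRham_of {r : ℕ} (b : Form Y r) (k : Koszul (Module.Dual ℝ V)) :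
    equivDeRham Y V (of b k) =
      DeRhamAlg.incl _ r (formOfBase V b) * DeRhamAlg.koszulHom Y V k := by
  rw [← DeRhamAlg.base_incl, ← DeRhamAlg.eta_tmul, ← toTensor_of]
  rfl

theorem equivDeRham_one : equivDeRham Y V 1 = 1 := by
  refine (equivDeRham_of (Form.one : Form Y 0) 1).trans ?_
  rw [map_one, mul_one]
  rfl

/-- The sign in the product of `KoszulForms` is exactly what is needed to move the Koszul factor of
`x` past the form of `y`. -/
theorem equivDeRham_mul (x y : KoszulForms Y V) :
    equivDeRham Y V (x * y) = equivDeRham Y V x * equivDeRham Y V y := by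
  induction x using induction with
  | hadd x x' hx hx' => rw [add_mul, map_add, hx, hx', map_add, add_mul]
  | h r b k =>
    induction y using induction with
    | hadd y y' hy hy' => rw [mul_add, map_add, hy, hy', map_add, mul_add]
    | h s c l =>
      have h : DeRhamAlg.incl (prodOneForms Y V) (r + s) (formOfBase V (Form.wedge r s b c)) =
          DeRhamAlg.incl _ r (formOfBase V b) * DeRhamAlg.incl _ s (formOfBase V c) := by
        rw [← DeRhamAlg.base_incl, ← DeRhamAlg.base_incl, ← DeRhamAlg.base_incl, ← map_mul,
          Forms.incl_mul_incl]
      rw [of_mul_of, equivDeRham_of, equivDeRham_of, equivDeRham_of, h, map_mul, mul_assoc,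
        mul_assoc, ← mul_assoc (DeRhamAlg.koszulHom Y V k), DeRhamAlg.koszulHom_mul_incl,
        mul_assoc]

theorem equivDeRham_d (z : KoszulForms Y V) :
    equivDeRham Y V ((dBase Y V + dKoszul Y V) z) = DeRhamAlg.d _ (equivDeRham Y V z) := by
  induction z using induction with
  | hadd x y hx hy => rw [map_add, map_add, hx, hy, map_add, map_add]
  | h r b k =>
    have h : formOfBase V (Form.d r b) = FormOn.d r (formOfBase V b) :=
      FormOn.apply_ext fun M s => Form.pullback_d s.1 b
    rw [LinearMap.add_apply, dBase_of, dKoszul_of, map_add, map_smul, equivDeRham_of,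
      equivDeRham_of, equivDeRham_of, DeRhamAlg.d_incl_mul, DeRhamAlg.d_koszulHom, h,
      DeRhamAlg.d_incl]

theorem equivDeRham_mem_homogeneous {n : ℕ} {z : KoszulForms Y V} (hz : z ∈ degree Y V n) :
    equivDeRham Y V z ∈ DeRhamAlg.homogeneous Y V n := by
  refine degree_le (P := (DeRhamAlg.homogeneous Y V n).comap (equivDeRham Y V).toLinearMap)
    ?_ hz
  rintro r m rfl b k hk
  change equivDeRham Y V (of b k) ∈ DeRhamAlg.homogeneous Y V (r + m)
  rw [equivDeRham_of]
  exact DeRhamAlg.mul_mem_homogeneous ⟨_, rfl⟩ (DeRhamAlg.koszulHom_mem_homogeneous hk)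

/-- A linear bijection which respects two gradings maps each component onto its counterpart, because
the components of the source span. -/
theorem map_equivDeRham_degree (n : ℕ) :
    (degree Y V n).map (equivDeRham Y V).toLinearMap = DeRhamAlg.homogeneous Y V n := by
  refine le_antisymm ?_ ?_
  · rintro _ ⟨z, hz, rfl⟩
    exact equivDeRham_mem_homogeneous hz
  · rintro _ ⟨τ, rfl⟩
    -- The projection of `η(z)` to degree `n` is `η(z)` or `0` when `z` is homogeneous, so for every
    -- `z` it is in the image of the component of degree `n`. It is applied to the preimage of a
    -- form of degree `n`.
    let f : KoszulForms Y V →ₗ[ℝ] DeRhamAlg (prodOneForms Y V) :=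
      DeRhamAlg.incl _ n ∘ₗ DeRhamAlg.component n ∘ₗ (equivDeRham Y V).toLinearMap
    have h : ⨆ m, degree Y V m ≤
        ((degree Y V n).map (equivDeRham Y V).toLinearMap).comap f := by
      refine iSup_le fun m z hz => ?_
      obtain ⟨σ, hσ⟩ := equivDeRham_mem_homogeneous hz
      change DeRhamAlg.incl _ n (DeRhamAlg.component n (equivDeRham Y V z)) ∈
        (degree Y V n).map (equivDeRham Y V).toLinearMap
      by_cases hmn : m = n
      · subst hmn
        rw [← hσ, DeRhamAlg.component_incl, hσ]
        exact ⟨z, hz, rfl⟩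
      · rw [← hσ, DeRhamAlg.component_incl_of_ne hmn, map_zero]
        exact zero_mem _
    have hz : (equivDeRham Y V).symm (DeRhamAlg.incl _ n τ) ∈ ⨆ m, degree Y V m := by
      rw [iSup_degree]
      trivial
    have h' : DeRhamAlg.incl _ n (DeRhamAlg.component n (equivDeRham Y V
        ((equivDeRham Y V).symm (DeRhamAlg.incl _ n τ)))) ∈
          (degree Y V n).map (equivDeRham Y V).toLinearMap := h hz
    rwa [LinearEquiv.apply_symm_apply, DeRhamAlg.component_incl] at h'

end KoszulForms

end NatForm
end

noncomputable section

/-! ### Transfer to the de Rham complex -/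

namespace NatForm

/-- The product of the ring `DeRhamAlg F` and the product of `DeRham F` are both determined by the
wedge product of homogeneous forms. -/
theorem DeRhamAlg.ofDeRham_symm_mul {F : Presheaf.{u, w}} (x y : DeRhamAlg F) :
    (ofDeRham F).symm (x * y) = (ofDeRham F).symm x * (ofDeRham F).symm y := by
  induction x using DeRhamAlg.induction with
  | hadd x x' hx hx' => rw [add_mul, map_add, hx, hx', map_add, add_mul]
  | h p a =>
    induction y using DeRhamAlg.induction with
    | hadd y y' hy hy' => rw [mul_add, map_add, hy, hy', map_add, mul_add]
    | h q b =>
      rw [incl_mul_incl]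
      exact (DirectSum.of_mul_of (A := fun r => FormOn F r) a b).symm

namespace KoszulForms

variable (Y : Man.{u}) (V : Type v) [AddCommGroup V] [Module ℝ V] [FiniteDimensional ℝ V]

/-- The isomorphism `η_Y`, with values in the de Rham complex. -/
def eta : KoszulForms Y V ≃ₗ[ℝ] DeRham (prodOneForms Y V) :=
  equivDeRham Y V ≪≫ₗ (DeRhamAlg.ofDeRham _).symm

variable {Y V}

theorem eta_apply (z : KoszulForms Y V) :
    eta Y V z = (DeRhamAlg.ofDeRham _).symm (equivDeRham Y V z) := rfl

theorem ofDeRham_symm_incl {F : Presheaf.{u, w}} {r : ℕ} (a : FormOn F r) :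
    (DeRhamAlg.ofDeRham F).symm (DeRhamAlg.incl F r a) = DeRham.incl F r a := rfl

theorem map_eta_degree (n : ℕ) : (degree Y V n).map (eta Y V).toLinearMap =
    LinearMap.range (DeRham.incl (prodOneForms Y V) n) := by
  refine le_antisymm ?_ ?_
  · rintro _ ⟨z, hz, rfl⟩
    obtain ⟨σ, hσ⟩ := equivDeRham_mem_homogeneous hz
    exact ⟨σ, congrArg (DeRhamAlg.ofDeRham _).symm hσ⟩
  · rintro _ ⟨σ, rfl⟩
    obtain ⟨z, hz, h⟩ : DeRhamAlg.incl _ n σ ∈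
        (degree Y V n).map (equivDeRham Y V).toLinearMap := by
      rw [map_equivDeRham_degree]
      exact ⟨σ, rfl⟩
    exact ⟨z, hz, congrArg (DeRhamAlg.ofDeRham _).symm h⟩

theorem eta_one : eta Y V 1 = 1 := congrArg (DeRhamAlg.ofDeRham _).symm equivDeRham_one

theorem eta_mul (x y : KoszulForms Y V) : eta Y V (x * y) = eta Y V x * eta Y V y :=
  (congrArg (DeRhamAlg.ofDeRham _).symm (equivDeRham_mul x y)).trans
    (DeRhamAlg.ofDeRham_symm_mul _ _)

theorem eta_d (z : KoszulForms Y V) : eta Y V ((dBase Y V + dKoszul Y V) z) =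
    DeRham.d (prodOneForms Y V) (eta Y V z) :=
  congrArg (DeRhamAlg.ofDeRham _).symm (equivDeRham_d z)

theorem eta_of_one {r : ℕ} (b : Form Y r) :
    eta Y V (of b 1) = DeRham.incl (prodOneForms Y V) r (formOfBase V b) := by
  rw [eta_apply, equivDeRham_of, map_one, mul_one, ofDeRham_symm_incl]

theorem eta_one_of (k : Koszul (Module.Dual ℝ V)) :
    eta Y V (of Form.one k) = (DeRhamAlg.ofDeRham _).symm (DeRhamAlg.koszulHom Y V k) := by
  rw [eta_apply, equivDeRham_of]
  exact congrArg _ (one_mul _)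

theorem eta_gen (l : Module.Dual ℝ V) : eta Y V (of Form.one (Koszul.gen l)) =
    DeRham.incl (prodOneForms Y V) 1 (formOfDual Y l) := by
  rw [eta_one_of, DeRhamAlg.koszulHom_gen, DeRhamAlg.theta, ofDeRham_symm_incl]

theorem eta_genTilde (l : Module.Dual ℝ V) : eta Y V (of Form.one (Koszul.genTilde l)) =
    DeRham.incl (prodOneForms Y V) 2 (FormOn.d 1 (formOfDual Y l)) := by
  rw [eta_one_of, DeRhamAlg.koszulHom_genTilde, DeRhamAlg.dTheta, ofDeRham_symm_incl]

end KoszulForms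

end NatForm
end

open NatForm
theorem mainTheorem5 {V : Type v} [AddCommGroup V] [Module ℝ V] [FiniteDimensional ℝ V] (Y : Man.{u}) :
    ∃ η : KoszulForms Y V ≃ₗ[ℝ] DeRham (prodOneForms Y V),
      (∀ n : ℕ, (KoszulForms.degree Y V n).map η.toLinearMap =
        LinearMap.range (DeRham.incl (prodOneForms Y V) n)) ∧
      η 1 = 1 ∧
      (∀ a b, η (a * b) = η a * η b) ∧
      (∀ a, η ((KoszulForms.dBase Y V + KoszulForms.dKoszul Y V) a) =
        DeRham.d (prodOneForms Y V) (η a)) ∧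
      (∀ (r : ℕ) (b : Form Y r), η (KoszulForms.of b 1) =
        DeRham.incl (prodOneForms Y V) r (formOfBase V b)) ∧
      (∀ l : Module.Dual ℝ V, η (KoszulForms.of Form.one (Koszul.gen l)) =
        DeRham.incl (prodOneForms Y V) 1 (formOfDual Y l)) ∧
      (∀ l : Module.Dual ℝ V, η (KoszulForms.of Form.one (Koszul.genTilde l)) =
        DeRham.incl (prodOneForms Y V) 2 (FormOn.d 1 (formOfDual Y l))) := by
  exact ⟨KoszulForms.eta Y V, KoszulForms.map_eta_degree, KoszulForms.eta_one,
    KoszulForms.eta_mul, KoszulForms.eta_d, fun _ => KoszulForms.eta_of_one,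
    KoszulForms.eta_gen, KoszulForms.eta_genTilde⟩
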